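/- For $n\ge 0$, a group $\Gamma$ is of type $\mathcal F^n$ if it acts freely and geometrically on an $(n-1)$-connected CW complex, that is, it acts by homeomorphisms that freely permute the open cells, with finitely many orbits of cells (equivalently, there is a $K(\Gamma,1)$ with finite $n$-skeleton). Here a space $X$ is $(n-1)$-connected if it is nonempty and, for every $0\le k<n$, every continuous map $S^k\to X$ extends continuously to the disc $D^{k+1}$. Let $n\ge 0$, let $G$ be a group of type $\mathcal F^{n+1}$ and let $H\le G$ be a subgroup of type $\mathcal F^n$. Then the double $G *_H G$, the amalgamated free product of two copies of $G$ along the inclusion $H\hookrightarrow G$, is of type $\mathcal F^{n+1}$. -/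

import Mathlib

open Topology

universe u

/-- `ConnectedBelow n X` says that `X` is `(n - 1)`-connected: `X` is nonempty and, for every `k < n`,
each continuous map from the `k`-sphere to `X` extends continuously to the `(k + 1)`-disc.
As in Mathlib's CW complexes, the closed unit ball of `Fin (k + 1) → ℝ` with the maximum norm and
its boundary serve as disc and sphere. In particular, `ConnectedBelow 0 X` means that `X` is
nonempty and `ConnectedBelow 1 X` means that `X` is path connected. -/
def ConnectedBelow (n : ℕ) (X : Type u) [TopologicalSpace X] : Prop :=
  Nonempty X ∧ ∀ k < n, ∀ f : (Fin (k + 1) → ℝ) → X, ContinuousOn f (Metric.sphere 0 1) →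
    ∃ F : (Fin (k + 1) → ℝ) → X,
      ContinuousOn F (Metric.closedBall 0 1) ∧ Set.EqOn F f (Metric.sphere 0 1)

/-- A free, cocompact, cellular action of `G` (by homeomorphisms) on a CW complex `X`: the group
freely permutes the open cells, with finitely many orbits of cells. Since every point lies in
exactly one open cell and every compact set meets only finitely many of them, such an action is
free on points and properly discontinuous: it is a free geometric action on a cell complex. -/
structure IsFreeCocompactCellularAction (G : Type u) [Group G] (X : Type u) [TopologicalSpace X]
    [CWComplex (Set.univ : Set X)] [MulAction G X] [ContinuousConstSMul G X] : Prop where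
  /-- Each group element carries each open cell onto an open cell. -/
  permutes : ∀ (g : G) (k : ℕ) (e : RelCWComplex.cell (Set.univ : Set X) k),
    ∃ e' : RelCWComplex.cell (Set.univ : Set X) k,
      (fun x => g • x) '' RelCWComplex.openCell k e = RelCWComplex.openCell k e'
  /-- Only the identity stabilises an open cell. -/
  free : ∀ (g : G) (k : ℕ) (e : RelCWComplex.cell (Set.univ : Set X) k),
    (fun x => g • x) '' RelCWComplex.openCell k e = RelCWComplex.openCell k e → g = 1
  /-- Finitely many cells meet all orbits of cells. -/
  cocompact : ∃ S : Set (Σ k, RelCWComplex.cell (Set.univ : Set X) k), S.Finite ∧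
    ∀ (k : ℕ) (e : RelCWComplex.cell (Set.univ : Set X) k),
      ∃ (g : G) (e' : RelCWComplex.cell (Set.univ : Set X) k), ⟨k, e'⟩ ∈ S ∧
        (fun x => g • x) '' RelCWComplex.openCell k e' = RelCWComplex.openCell k e

/-- A group is of type `Fⁿ` if it acts freely and geometrically on an `(n - 1)`-connected
cell complex. -/
def IsOfTypeF (n : ℕ) (G : Type u) [Group G] : Prop :=
  ∃ (X : Type u) (_ : TopologicalSpace X) (_ : T2Space X) (_ : CWComplex (Set.univ : Set X))
    (_ : MulAction G X) (_ : ContinuousConstSMul G X),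
    ConnectedBelow n X ∧ IsFreeCocompactCellularAction G X

/-- The double `G *_H G`: the amalgamated free product of two copies of `G` along the inclusions
of the subgroup `H`. -/
abbrev GroupDouble {G : Type u} [Group G] (H : Subgroup G) : Type u :=
  Monoid.PushoutI (fun _ : Fin 2 => H.subtype)

/-! ### Sphere filling, the working form of connectivity -/

section Fillings

open Set Metric

variable {X Y : Type*} [TopologicalSpace X] [TopologicalSpace Y]

/-! Let `Γ` be the double. It acts on its Bass–Serre tree: the vertices are the cosets of the two
copies of `G`, the edges the cosets of `H`. Let `G` act on an `n`-connected complex `X` and `H` on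
an `(n - 1)`-connected complex `Y`, which may be taken of dimension at most `n`
(`IsOfTypeF.exists_finite_dimensional`). Since `Y` is free and `X` is highly connected, there is an
`H`-equivariant cellular map `f : Y → X` (`exists_equivariant_cellular`). Put a copy of `X` over
each vertex of the tree and a copy of `Y × [0, 1]` over each edge, glued at both ends by translates
of `f`. These copies are the spaces induced from `G` and `H` to `Γ`, written with cocycles on cosets
(`Twisted`), and the result is one double mapping cylinder. It inherits a cell structure with a free
cellular action, having finitely many orbits of cells because there are two orbits of vertices and
one of edges.

It remains to see that this tree of spaces is `n`-connected. A map of a sphere has compact image, so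
it lives over a finite subtree. Such a subtree is built by adding leaves: each leaf adds an open set
deforming onto a copy of `X`, and meets the earlier part in a copy of `Y` times an interval. Thus
everything follows from one gluing principle (`FillsSpheres.union`): the union of two `n`-connected
open sets with `(n - 1)`-connected intersection is `n`-connected. The single drop in degree in this
principle is why `H` needs one degree of finiteness less than `G`.

The gluing principle is proved directly by subdividing cubes, without homology or the Seifert–van
Kampen theorem: a fine grid is labelled by the open sets, and the map is extended face by face
(`exists_extension_grid`). The same device yields cellular approximation
(`exists_extension_skeletonBelow`). The tree structure comes from normal forms in amalgamated
products (`exists_rooted_tree`). -/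

/-- Every map of the boundary of the `k`-cube to `A` extends to a map of the `k`-cube to `A`. -/
def FillsSpheres (k : ℕ) (A : Set X) : Prop :=
  ∀ f : (Fin k → ℝ) → X, ContinuousOn f (sphere 0 1) → MapsTo f (sphere 0 1) A →
    ∃ F : (Fin k → ℝ) → X, ContinuousOn F (closedBall 0 1) ∧ MapsTo F (closedBall 0 1) A ∧
      EqOn F f (sphere 0 1)

/-- The `0`-cube is a point with empty boundary, so filling in dimension `0` is nonemptiness; this
lets one predicate express every degree of connectivity. -/
theorem FillsSpheres.nonempty [Nonempty X] {A : Set X} (h : FillsSpheres 0 A) : A.Nonempty := by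
  obtain ⟨F, -, hF, -⟩ := h (fun _ => Classical.arbitrary X)
    (by simp [sphere_eq_empty_of_subsingleton])
    (by simp [sphere_eq_empty_of_subsingleton, MapsTo])
  exact ⟨F 0, hF (by simp)⟩

theorem Set.Nonempty.fillsSpheres_zero {A : Set X} (h : A.Nonempty) : FillsSpheres 0 A := by
  obtain ⟨x, hx⟩ := h
  exact fun f _ _ => ⟨fun _ => x, continuousOn_const, fun _ _ => hx,
    by simp [EqOn, sphere_eq_empty_of_subsingleton]⟩

/-- An index shift: the sphere condition for `k` concerns the `(k + 1)`-cube, and the extra case of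
the `0`-cube is nonemptiness. Hence `≤ n` replaces `< n`. -/
theorem connectedBelow_iff {n : ℕ} {X : Type u} [TopologicalSpace X] :
    ConnectedBelow n X ↔ Nonempty X ∧ ∀ k ≤ n, FillsSpheres k (univ : Set X) := by
  refine and_congr_right fun hX => ⟨fun h k hk f hf _ => ?_, fun h k hk f hf => ?_⟩
  · rcases k with _ | k
    · exact Set.univ_nonempty.fillsSpheres_zero f hf (mapsTo_univ _ _)
    · obtain ⟨F, hF, hFf⟩ := h k hk f hf
      exact ⟨F, hF, mapsTo_univ _ _, hFf⟩
  · obtain ⟨F, hF, -, hFf⟩ := h (k + 1) hk f hf (mapsTo_univ _ _)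
    exact ⟨F, hF, hFf⟩

theorem fillsSpheres_singleton (k : ℕ) (x : X) : FillsSpheres k {x} := fun _ _ hf =>
  ⟨fun _ => x, continuousOn_const, fun _ _ => rfl, fun _ hy => (hf hy).symm⟩

/-- Two maps on closed sets which agree on the intersection glue. -/
theorem exists_glue {s t : Set X} (hs : IsClosed s) (ht : IsClosed t) {f g : X → Y}
    (hf : ContinuousOn f s) (hg : ContinuousOn g t) (h : ∀ x ∈ s, x ∈ t → f x = g x) :
    ∃ F : X → Y, ContinuousOn F (s ∪ t) ∧ EqOn F f s ∧ EqOn F g t := by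
  classical
  have h1 : EqOn (s.piecewise f g) f s := fun x hx => by simp [hx]
  have h2 : EqOn (s.piecewise f g) g t := fun x hx => by
    by_cases hxs : x ∈ s
    · rw [h1 hxs, h x hxs hx]
    · simp [hxs]
  exact ⟨_, (hf.congr h1).union_of_isClosed (hg.congr h2) hs ht, h1, h2⟩

/-- If `B` is dominated by `A` up to homotopy and `A` fills spheres, then so does `B`. -/
theorem FillsSpheres.of_dominated {k : ℕ} {A : Set X} {B : Set Y} (hA : FillsSpheres k A)
    {q : Y → X} {p : X → Y} {h : ℝ × Y → Y}
    (hq : ContinuousOn q B) (hqA : MapsTo q B A) (hp : ContinuousOn p A) (hpB : MapsTo p A B)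
    (hh : ContinuousOn h (Icc 0 1 ×ˢ B)) (hhB : MapsTo h (Icc 0 1 ×ˢ B) B)
    (h0 : ∀ y ∈ B, h (0, y) = y) (h1 : ∀ y ∈ B, h (1, y) = p (q y)) : FillsSpheres k B := by
  intro f hf hfB
  obtain ⟨G, hG, hGA, hGf⟩ := hA (q ∘ f) (hq.comp hf hfB) (hqA.comp hfB)
  -- The filling of `q ∘ f`, mapped back by `p`, goes on the half-size cube; the shell outside it
  -- carries the homotopy from `f` at radius `1` to `p ∘ q ∘ f` at radius `1 / 2`.
  set s : Set (Fin k → ℝ) := closedBall 0 (1 / 2)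
  set t : Set (Fin k → ℝ) := {x | 1 / 2 ≤ ‖x‖ ∧ ‖x‖ ≤ 1}
  have hs : MapsTo (fun x : Fin k → ℝ => (2 : ℝ) • x) s (closedBall 0 1) := fun x hx => by
    have := mem_closedBall_zero_iff.1 hx
    rw [mem_closedBall_zero_iff, norm_smul]; norm_num; linarith
  have ht : MapsTo (fun x : Fin k → ℝ => ‖x‖⁻¹ • x) t (sphere 0 1) := fun x hx => by
    have : ‖x‖ ≠ 0 := by have := hx.1; intro h; linarith
    rw [mem_sphere_zero_iff_norm, norm_smul, norm_inv, norm_norm, inv_mul_cancel₀ this]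
  have htc : ContinuousOn (fun x : Fin k → ℝ => ‖x‖⁻¹ • x) t :=
    (continuousOn_id.norm.inv₀ fun x hx => by
      have := hx.1; intro h; simp only [id] at h; linarith).smul continuousOn_id
  have hpair : MapsTo (fun x : Fin k → ℝ => (2 - 2 * ‖x‖, f (‖x‖⁻¹ • x))) t (Icc 0 1 ×ˢ B) :=
    fun x hx => ⟨⟨by linarith [hx.2], by linarith [hx.1]⟩, hfB (ht hx)⟩
  obtain ⟨F, hF, hF1, hF2⟩ := exists_glue (s := s) (t := t)
    (f := fun x => p (G ((2 : ℝ) • x))) (g := fun x => h (2 - 2 * ‖x‖, f (‖x‖⁻¹ • x)))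
    isClosed_closedBall
    ((isClosed_le continuous_const continuous_norm).inter
      (isClosed_le continuous_norm continuous_const))
    (hp.comp (hG.comp (by fun_prop) hs) (hGA.comp hs))
    (hh.comp ((by fun_prop : ContinuousOn (fun x : Fin k → ℝ => 2 - 2 * ‖x‖) t).prodMk
      (hf.comp htc ht)) hpair)
    (fun x hx hx' => by
      have hn : ‖x‖ = 1 / 2 := le_antisymm (mem_closedBall_zero_iff.1 hx) hx'.1
      have h2 := ht hx'
      simp only [hn] at h2 ⊢
      norm_num at h2 ⊢
      rw [h1 _ (hfB (by simpa using h2)), hGf (by simpa using h2)]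
      rfl)
  have hcov : closedBall (0 : Fin k → ℝ) 1 ⊆ s ∪ t := fun x hx => by
    rcases le_total ‖x‖ (1 / 2) with h | h
    · exact Or.inl (mem_closedBall_zero_iff.2 h)
    · exact Or.inr ⟨h, mem_closedBall_zero_iff.1 hx⟩
  refine ⟨F, hF.mono hcov, fun x hx => ?_, fun x hx => ?_⟩
  · rcases hcov hx with h | h
    · rw [hF1 h]; exact hpB (hGA (hs h))
    · rw [hF2 h]; exact hhB (hpair h)
  · have hn := mem_sphere_zero_iff_norm.1 hx
    have hxt : x ∈ t := ⟨by rw [hn]; norm_num, hn.le⟩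
    rw [hF2 hxt]
    simp only [hn]
    norm_num
    exact h0 _ (hfB hx)

/-- A retract of a set which fills spheres fills spheres. -/
theorem FillsSpheres.of_retract {k : ℕ} {A : Set X} {B : Set Y} (hA : FillsSpheres k A)
    {q : Y → X} {p : X → Y} (hq : ContinuousOn q B) (hqA : MapsTo q B A) (hp : ContinuousOn p A)
    (hpB : MapsTo p A B) (h1 : ∀ y ∈ B, p (q y) = y) : FillsSpheres k B :=
  hA.of_dominated (h := Prod.snd) hq hqA hp hpB continuousOn_snd (fun _ hx => hx.2)
    (fun _ _ => rfl) (fun y hy => (h1 y hy).symm)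

theorem StarConvex.fillsSpheres {E : Type*} [AddCommGroup E] [Module ℝ E] [TopologicalSpace E]
    [IsTopologicalAddGroup E] [ContinuousSMul ℝ E] {A : Set E} {x : E} (hA : StarConvex ℝ x A)
    (hx : x ∈ A) (k : ℕ) : FillsSpheres k A := by
  refine (fillsSpheres_singleton k x).of_dominated (q := fun _ => x) (p := id)
    (h := fun z => z.1 • x + (1 - z.1) • z.2) continuousOn_const (fun _ _ => rfl) continuousOn_id
    (by simpa using hx) (by fun_prop) (fun z hz => hA hz.2 hz.1.1 (by linarith [hz.1.2])
      (by ring)) (by simp) (by simp)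

theorem FillsSpheres.prod {k : ℕ} {A : Set X} {B : Set Y} (hA : FillsSpheres k A)
    (hB : FillsSpheres k B) : FillsSpheres k (A ×ˢ B) := by
  intro f hf hfAB
  obtain ⟨F, h1, h2, h3⟩ := hA (fun x => (f x).1) hf.fst fun x hx => (hfAB hx).1
  obtain ⟨G, k1, k2, k3⟩ := hB (fun x => (f x).2) hf.snd fun x hx => (hfAB hx).2
  exact ⟨fun x => (F x, G x), h1.prodMk k1, fun x hx => ⟨h2 hx, k2 hx⟩,
    fun x hx => Prod.ext (h3 hx) (k3 hx)⟩

end Fillings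

/-! ### Cubical grids and extension face by face -/

section Grid

open Set Metric

variable {X : Type*} [TopologicalSpace X] {k : ℕ}

theorem mem_unitClosedBall_pi {x : Fin k → ℝ} : x ∈ closedBall 0 1 ↔ ∀ i, |x i| ≤ 1 := by
  rw [mem_closedBall_zero_iff, pi_norm_le_iff_of_nonneg zero_le_one]; rfl

theorem mem_unitBall_pi {x : Fin k → ℝ} : x ∈ ball 0 1 ↔ ∀ i, |x i| < 1 := by
  rw [mem_ball_zero_iff, pi_norm_lt_iff zero_lt_one]; rfl

theorem mem_unitSphere_pi {x : Fin k → ℝ} :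
    x ∈ sphere 0 1 ↔ (∀ i, |x i| ≤ 1) ∧ ∃ i, |x i| = 1 := by
  rw [← mem_unitClosedBall_pi, ← closedBall_sdiff_ball, mem_sdiff, mem_unitBall_pi]
  refine and_congr_right fun h => ?_
  rw [mem_unitClosedBall_pi] at h
  push Not
  exact exists_congr fun i => ⟨fun h' => le_antisymm (h i) h', fun h' => h'.ge⟩

/-- The faces of the integral cubical grid in `Fin k → ℝ` are indexed by integral vectors: an even
entry `2 * j` stands for the point `j`, an odd entry `2 * j + 1` for the interval `[j, j + 1]`. -/
def gridCell (a : Fin k → ℤ) : Set (Fin k → ℝ) :=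
  {x | ∀ i, ((a i / 2 : ℤ) : ℝ) ≤ x i ∧ x i ≤ (((a i + 1) / 2 : ℤ) : ℝ)}

/-- `b` is a face of `a`. -/
def GridFace (b a : Fin k → ℤ) : Prop := ∀ i, a i / 2 ≤ b i / 2 ∧ (b i + 1) / 2 ≤ (a i + 1) / 2

/-- The dimension of a face of the grid. -/
def gridDim (a : Fin k → ℤ) : ℕ := Fintype.card {i // Odd (a i)}

/-- The smallest face of the grid containing a point. -/
noncomputable def gridCarrier (x : Fin k → ℝ) (i : Fin k) : ℤ := ⌊x i⌋ + ⌈x i⌉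

theorem isClosed_gridCell (a : Fin k → ℤ) : IsClosed (gridCell a) := by
  simp only [gridCell, ofPred_forall]
  exact isClosed_iInter fun i => (isClosed_le continuous_const (continuous_apply i)).inter
    (isClosed_le (continuous_apply i) continuous_const)

theorem GridFace.refl (a : Fin k → ℤ) : GridFace a a := fun _ => ⟨le_rfl, le_rfl⟩

theorem GridFace.trans {a b c : Fin k → ℤ} (h : GridFace a b) (h' : GridFace b c) :
    GridFace a c := fun i => ⟨(h' i).1.trans (h i).1, (h i).2.trans (h' i).2⟩

theorem GridFace.subset {a b : Fin k → ℤ} (h : GridFace b a) : gridCell b ⊆ gridCell a :=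
  fun _ hx i => ⟨(Int.cast_le.2 (h i).1).trans (hx i).1, (hx i).2.trans (Int.cast_le.2 (h i).2)⟩

/-- Floor and ceiling agree at integers and differ by one elsewhere, so their sum encodes the point
or unit interval containing a coordinate. Membership becomes integer arithmetic. -/
theorem mem_gridCell_iff {a : Fin k → ℤ} {x : Fin k → ℝ} :
    x ∈ gridCell a ↔ GridFace (gridCarrier x) a := by
  refine forall_congr' fun i => ?_
  rw [← Int.le_floor, ← Int.ceil_le]
  have h1 := Int.ceil_le_floor_add_one (x i)
  have h2 := Int.floor_le_ceil (x i)
  simp only [gridCarrier]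
  omega

theorem mem_gridCell_gridCarrier (x : Fin k → ℝ) : x ∈ gridCell (gridCarrier x) :=
  mem_gridCell_iff.2 (GridFace.refl _)

/-- Passing to a face can only turn odd entries into even ones. If the dimension does not drop, the
odd positions coincide, and then so do all entries. -/
theorem GridFace.eq_of_gridDim_le {a b : Fin k → ℤ} (h : GridFace b a)
    (hd : gridDim a ≤ gridDim b) : b = a := by
  have hs : Finset.univ.filter (fun i => Odd (b i)) ⊆ Finset.univ.filter (fun i => Odd (a i)) := by
    intro i hi
    simp only [Finset.mem_filter, Finset.mem_univ, true_and, Int.odd_iff] at *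
    have := h i
    omega
  have he := Finset.eq_of_subset_of_card_le hs (by
    simpa only [gridDim, Fintype.card_subtype] using hd)
  funext i
  have hi : Odd (b i) ↔ Odd (a i) := by simpa using Finset.ext_iff.1 he i
  have := h i
  rw [Int.odd_iff, Int.odd_iff] at hi
  omega

theorem gridDim_le (a : Fin k → ℤ) : gridDim a ≤ k := by
  simpa [gridDim] using Fintype.card_subtype_le fun i => Odd (a i)

theorem odd_of_gridDim_eq {a : Fin k → ℤ} (h : k ≤ gridDim a) (i : Fin k) : Odd (a i) := by
  have : Finset.univ.filter (fun i => Odd (a i)) = Finset.univ :=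
    Finset.eq_univ_of_card _ (le_antisymm (Finset.card_le_univ _)
      (by simpa [gridDim, Fintype.card_subtype] using h))
  simpa using Finset.ext_iff.1 this i

/-- Fillings of spheres give fillings of the boundaries of the faces of the grid. -/
theorem FillsSpheres.exists_extension_gridCell {A : Set X} {a : Fin k → ℤ}
    (hA : FillsSpheres (gridDim a) A) {f : (Fin k → ℝ) → X} {s : Set (Fin k → ℝ)}
    (hf : ContinuousOn f s) (hs : ∀ x ∈ gridCell a, gridCarrier x ≠ a → x ∈ s)
    (hfA : ∀ x ∈ gridCell a, gridCarrier x ≠ a → f x ∈ A) :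
    ∃ F : (Fin k → ℝ) → X, ContinuousOn F (gridCell a) ∧ MapsTo F (gridCell a) A ∧
      ∀ x ∈ gridCell a, gridCarrier x ≠ a → F x = f x := by
  let e : {i // Odd (a i)} ≃ Fin (gridDim a) := Fintype.equivFin _
  -- The face is parametrized by the standard cube on its odd coordinates, the even ones being
  -- frozen; `proj` inverts this on the face. Points whose carrier is not `a` correspond to the
  -- boundary of the cube.
  let emb : (Fin (gridDim a) → ℝ) → Fin k → ℝ := fun y i =>
    if h : Odd (a i) then ((a i / 2 : ℤ) : ℝ) + (1 + y (e ⟨i, h⟩)) / 2 else ((a i / 2 : ℤ) : ℝ)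
  let proj : (Fin k → ℝ) → Fin (gridDim a) → ℝ := fun x j =>
    2 * (x (e.symm j).1 - ((a (e.symm j).1 / 2 : ℤ) : ℝ)) - 1
  have hodd : ∀ i, Odd (a i) → (((a i + 1) / 2 : ℤ) : ℝ) = ((a i / 2 : ℤ) : ℝ) + 1 := by
    intro i hi
    rw [Int.odd_iff] at hi
    exact_mod_cast (by omega : (a i + 1) / 2 = a i / 2 + 1)
  have heven : ∀ i, ¬ Odd (a i) → (a i + 1) / 2 = a i / 2 := by
    intro i hi
    rw [Int.odd_iff] at hi
    omega
  have hemb : Continuous emb := by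
    refine continuous_pi fun i => ?_
    by_cases h : Odd (a i)
    · simp only [emb, h, dite_true]; fun_prop
    · simp only [emb, h, dite_false]; fun_prop
  have hproj : Continuous proj := by fun_prop
  have hembc : MapsTo emb (closedBall 0 1) (gridCell a) := by
    intro y hy i
    rw [mem_unitClosedBall_pi] at hy
    by_cases h : Odd (a i)
    · have := abs_le.1 (hy (e ⟨i, h⟩))
      simp only [emb, h, dite_true, hodd i h]
      constructor <;> linarith
    · simp [emb, h, heven i h]
  have hembs : ∀ y ∈ sphere 0 1, gridCarrier (emb y) ≠ a := by
    intro y hy hc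
    obtain ⟨-, j, hj⟩ := mem_unitSphere_pi.1 hy
    have hji := congrFun hc (e.symm j).1
    have ho := (e.symm j).2
    have hv : ∃ m : ℤ, emb y (e.symm j).1 = m := by
      rcases eq_or_eq_neg_of_abs_eq hj with h | h
      · exact ⟨a (e.symm j).1 / 2 + 1, by simp [emb, ho, h]⟩
      · exact ⟨a (e.symm j).1 / 2, by simp [emb, ho, h]⟩
    obtain ⟨m, hm⟩ := hv
    simp only [gridCarrier, hm, Int.floor_intCast, Int.ceil_intCast] at hji
    rw [← hji, Int.odd_iff] at ho
    omega
  have hprojc : MapsTo proj (gridCell a) (closedBall 0 1) := by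
    intro x hx
    rw [mem_unitClosedBall_pi]
    intro j
    have := hx (e.symm j).1
    rw [hodd _ (e.symm j).2] at this
    rw [abs_le]
    constructor <;> simp only [proj] <;> linarith [this.1, this.2]
  have hep : ∀ x ∈ gridCell a, emb (proj x) = x := by
    intro x hx
    funext i
    by_cases h : Odd (a i)
    · simp only [emb, proj, h, dite_true, Equiv.symm_apply_apply]; ring
    · have := hx i
      rw [heven i h] at this
      simp only [emb, h, dite_false]
      exact le_antisymm this.1 this.2
  have hprojs : ∀ x ∈ gridCell a, gridCarrier x ≠ a → proj x ∈ sphere 0 1 := by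
    intro x hx hc
    rw [← closedBall_sdiff_ball, mem_sdiff, mem_unitBall_pi]
    refine ⟨hprojc hx, fun hlt => hc (funext fun i => ?_)⟩
    by_cases h : Odd (a i)
    · have := abs_lt.1 (hlt (e ⟨i, h⟩))
      simp only [proj, Equiv.symm_apply_apply] at this
      have h1 : ⌊x i⌋ = a i / 2 := Int.floor_eq_iff.2 ⟨by linarith, by linarith⟩
      have h2 : ⌈x i⌉ = a i / 2 + 1 := Int.ceil_eq_iff.2
        ⟨by push_cast; linarith, by push_cast; linarith⟩
      rw [Int.odd_iff] at h
      simp only [gridCarrier, h1, h2]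
      omega
    · have := mem_gridCell_iff.1 hx i
      rw [Int.odd_iff] at h
      omega
  have hms : MapsTo emb (sphere 0 1) s := fun y hy =>
    hs _ (hembc (sphere_subset_closedBall hy)) (hembs y hy)
  obtain ⟨F, hF, hFA, hFf⟩ := hA (f ∘ emb) (hf.comp hemb.continuousOn hms)
    fun y hy => hfA _ (hembc (sphere_subset_closedBall hy)) (hembs y hy)
  refine ⟨F ∘ proj, hF.comp hproj.continuousOn hprojc, hFA.comp hprojc, fun x hx hc => ?_⟩
  rw [Function.comp_apply, hFf (hprojs x hx hc), Function.comp_apply, hep x hx]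

/-- Extension of maps over a grid, along a carrier `C` whose value at each face fills the spheres
of the dimension of that face. -/
theorem exists_extension_grid (C : (Fin k → ℤ) → Set X) (L : Set (Fin k → ℤ))
    (f : (Fin k → ℝ) → X) (hL : ∀ a ∈ L, ∀ b, GridFace b a → b ∈ L)
    (hf : ∀ a ∈ L, ContinuousOn f (gridCell a)) (hfC : ∀ a ∈ L, MapsTo f (gridCell a) (C a))
    (S : Finset (Fin k → ℤ)) (hS : ∀ a ∈ S, ∀ b, GridFace b a → b ∈ S)
    (hC : ∀ a ∈ S, ∀ b, GridFace b a → C b ⊆ C a)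
    (hfill : ∀ a ∈ S, a ∉ L → FillsSpheres (gridDim a) (C a)) :
    ∃ F : (Fin k → ℝ) → X, ContinuousOn F (⋃ a ∈ S, gridCell a) ∧
      ∀ a ∈ S, MapsTo F (gridCell a) (C a) ∧ (a ∈ L → EqOn F f (gridCell a)) := by
  induction S using Finset.strongInduction with
  | H S ih =>
  rcases S.eq_empty_or_nonempty with rfl | hne
  · exact ⟨f, by simp, by simp⟩
  -- A face of maximal dimension is not a proper face of another member of `S`, so deleting it
  -- leaves a set closed under faces, and its boundary is already covered by the remaining faces.
  obtain ⟨c, hcS, hmax⟩ := S.exists_max_image gridDim hne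
  have hmem : ∀ a ∈ S, ∀ b, GridFace b a → b ≠ c → b ∈ S.erase c := fun a ha b hb hbc =>
    Finset.mem_erase.2 ⟨hbc, hS a ha b hb⟩
  have hlt : ∀ a ∈ S.erase c, ∀ b, GridFace b a → b ≠ c := by
    rintro a ha b hb rfl
    obtain ⟨hab, haS⟩ := Finset.mem_erase.1 ha
    exact hab (hb.eq_of_gridDim_le (hmax a haS)).symm
  obtain ⟨F, hF, hFC⟩ := ih (S.erase c) (Finset.erase_ssubset hcS)
    (fun a ha b hb => hmem a (Finset.mem_of_mem_erase ha) b hb (hlt a ha b hb))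
    (fun a ha => hC a (Finset.mem_of_mem_erase ha))
    (fun a ha => hfill a (Finset.mem_of_mem_erase ha))
  have hbd : ∀ x ∈ gridCell c, gridCarrier x ≠ c → gridCarrier x ∈ S.erase c := fun x hx hxc =>
    hmem c hcS _ (mem_gridCell_iff.1 hx) hxc
  obtain ⟨g, hg, hgC, hgF, hgf⟩ : ∃ g : (Fin k → ℝ) → X, ContinuousOn g (gridCell c) ∧
      MapsTo g (gridCell c) (C c) ∧ (∀ x ∈ gridCell c, gridCarrier x ≠ c → g x = F x) ∧
      (c ∈ L → EqOn g f (gridCell c)) := by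
    by_cases hcL : c ∈ L
    · refine ⟨f, hf c hcL, hfC c hcL, fun x hx hxc => ?_, fun _ => eqOn_refl _ _⟩
      exact ((hFC _ (hbd x hx hxc)).2 (hL c hcL _ (mem_gridCell_iff.1 hx))
        (mem_gridCell_gridCarrier x)).symm
    · obtain ⟨g, h1, h2, h3⟩ := (hfill c hcS hcL).exists_extension_gridCell hF
        (fun x hx hxc => mem_biUnion (hbd x hx hxc) (mem_gridCell_gridCarrier x))
        (fun x hx hxc => hC c hcS _ (mem_gridCell_iff.1 hx)
          ((hFC _ (hbd x hx hxc)).1 (mem_gridCell_gridCarrier x)))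
      exact ⟨g, h1, h2, h3, fun h => absurd h hcL⟩
  obtain ⟨H, hH, hHF, hHg⟩ := exists_glue
    (Set.Finite.isClosed_biUnion (S.erase c).finite_toSet fun a _ => isClosed_gridCell a)
    (isClosed_gridCell c) hF hg (fun x hx hxc => by
      obtain ⟨a, ha, hxa⟩ := mem_iUnion₂.1 hx
      exact (hgF x hxc (hlt a ha _ (mem_gridCell_iff.1 hxa))).symm)
  refine ⟨H, hH.mono ?_, fun a ha => ?_⟩
  · refine iUnion₂_subset fun a ha => ?_
    by_cases hac : a = c
    · subst hac; exact subset_union_right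
    · exact subset_union_of_subset_left
        (subset_biUnion_of_mem (u := gridCell) (Finset.mem_erase.2 ⟨hac, ha⟩)) _
  · by_cases hac : a = c
    · subst hac
      exact ⟨hgC.congr hHg.symm, fun h => hHg.trans (hgf h)⟩
    · have ha' : a ∈ S.erase c := Finset.mem_erase.2 ⟨hac, ha⟩
      have hsub : gridCell a ⊆ ⋃ a ∈ S.erase c, gridCell a :=
        subset_biUnion_of_mem (u := gridCell) ha'
      exact ⟨(hFC a ha').1.congr (hHF.mono hsub).symm,
        fun h => (hHF.mono hsub).trans ((hFC a ha').2 h)⟩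

end Grid

/-! ### Subdivision of cubes and gluing of fillings -/

section Subdivision

open Set Metric

variable {X : Type*} [TopologicalSpace X] {k : ℕ}

/-- The homothety taking the cube `[-1, 1]ᵏ` to `[0, N]ᵏ`. -/
noncomputable def toGrid (N : ℕ) (y : Fin k → ℝ) : Fin k → ℝ := fun i => N * (1 + y i) / 2

/-- The homothety taking the cube `[0, N]ᵏ` to `[-1, 1]ᵏ`. -/
noncomputable def ofGrid (N : ℕ) (x : Fin k → ℝ) : Fin k → ℝ := fun i => 2 * x i / N - 1

/-- The set of faces of the grid on `[0, N]ᵏ`. -/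
noncomputable def gridFaces (k N : ℕ) : Finset (Fin k → ℤ) := Fintype.piFinset fun _ => Finset.Icc 0 (2 * N)

/-- The set of top-dimensional cubes of the grid on `[0, N]ᵏ`. -/
def gridCubes (k N : ℕ) : Set (Fin k → ℤ) :=
  {c | ∀ i, 0 ≤ c i ∧ c i ≤ 2 * N ∧ Odd (c i)}

theorem mem_gridFaces {N : ℕ} {a : Fin k → ℤ} :
    a ∈ gridFaces k N ↔ ∀ i, 0 ≤ a i ∧ a i ≤ 2 * N := by
  simp [gridFaces]

theorem GridFace.mem_gridFaces {N : ℕ} {a b : Fin k → ℤ} (h : GridFace b a)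
    (ha : a ∈ gridFaces k N) : b ∈ gridFaces k N := by
  rw [_root_.mem_gridFaces] at *
  intro i
  have := h i
  have := ha i
  omega

theorem continuous_toGrid (N : ℕ) : Continuous (toGrid N : (Fin k → ℝ) → _) := by
  unfold toGrid; fun_prop

theorem continuous_ofGrid (N : ℕ) : Continuous (ofGrid N : (Fin k → ℝ) → _) := by
  unfold ofGrid; fun_prop

theorem ofGrid_toGrid {N : ℕ} (hN : 0 < N) (y : Fin k → ℝ) : ofGrid N (toGrid N y) = y := by
  have : (N : ℝ) ≠ 0 := by positivity
  funext i
  simp only [ofGrid, toGrid]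
  field_simp
  ring

theorem toGrid_ofGrid {N : ℕ} (hN : 0 < N) (x : Fin k → ℝ) : toGrid N (ofGrid N x) = x := by
  have : (N : ℝ) ≠ 0 := by positivity
  funext i
  simp only [ofGrid, toGrid]
  field_simp
  ring

theorem gridCarrier_toGrid_mem {N : ℕ} {y : Fin k → ℝ} (hy : y ∈ closedBall 0 1) :
    gridCarrier (toGrid N y) ∈ gridFaces k N := by
  rw [mem_gridFaces]
  rw [mem_unitClosedBall_pi] at hy
  intro i
  have h := abs_le.1 (hy i)
  have hN : (0 : ℝ) ≤ N := N.cast_nonneg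
  have h1 : 0 ≤ ⌊toGrid N y i⌋ := Int.floor_nonneg.2 (by
    simp only [toGrid]; exact div_nonneg (mul_nonneg hN (by linarith)) (by norm_num))
  have h2 : ⌈toGrid N y i⌉ ≤ N := Int.ceil_le.2 (by
    simp only [toGrid, Int.cast_natCast]; nlinarith)
  have h3 := Int.floor_le_ceil (toGrid N y i)
  simp only [gridCarrier]
  omega

theorem ofGrid_mem_closedBall {N : ℕ} (hN : 0 < N) {a : Fin k → ℤ} (ha : a ∈ gridFaces k N)
    {x : Fin k → ℝ} (hx : x ∈ gridCell a) : ofGrid N x ∈ closedBall 0 1 := by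
  rw [mem_gridFaces] at ha
  rw [mem_unitClosedBall_pi]
  intro i
  have hN' : (0 : ℝ) < N := by exact_mod_cast hN
  have h1 : (0 : ℝ) ≤ x i := le_trans (by exact_mod_cast (by have := ha i; omega)) (hx i).1
  have h2 : x i ≤ N := (hx i).2.trans (by exact_mod_cast (by have := ha i; omega))
  rw [abs_le]
  simp only [ofGrid]
  constructor
  · have : 0 ≤ 2 * x i / N := by positivity
    linarith
  · have : 2 * x i / N ≤ 2 := by rw [div_le_iff₀ hN']; linarith
    linarith

theorem exists_gridCube {N : ℕ} (hN : 0 < N) {a : Fin k → ℤ} (ha : a ∈ gridFaces k N) :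
    ∃ c ∈ gridCubes k N, GridFace a c := by
  rw [mem_gridFaces] at ha
  -- In each direction the cube to the right is chosen, except at the far end `a i = 2 * N`, where
  -- only the one on the left lies in the grid.
  refine ⟨fun i => 2 * min (a i / 2) (N - 1) + 1, fun i => ?_, fun i => ?_⟩
  · have := ha i
    simp only [Int.odd_iff]
    omega
  · have := ha i
    simp only
    omega

theorem mem_gridFaces_of_mem_gridCubes {N : ℕ} {c : Fin k → ℤ} (hc : c ∈ gridCubes k N) :
    c ∈ gridFaces k N := mem_gridFaces.2 fun i => ⟨(hc i).1, (hc i).2.1⟩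

/-- A form of the Lebesgue number lemma: for a map from a compact subset of the cube to a space with
an open cover, each cube of a fine grid is sent into a member of the cover. -/
theorem exists_grid_label {ι : Type*} {K : Set (Fin k → ℝ)} (hK : IsCompact K)
    {f : (Fin k → ℝ) → X} (hf : ContinuousOn f K) {U : ι → Set X} (hU : ∀ i, IsOpen (U i))
    (hKU : ∀ x ∈ K, ∃ i, f x ∈ U i) [Nonempty ι] :
    ∃ N : ℕ, 0 < N ∧ ∃ l : (Fin k → ℤ) → ι, ∀ c ∈ gridCubes k N, ∀ y ∈ K,
      toGrid N y ∈ gridCell c → f y ∈ U (l c) := by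
  choose O hO hOK using fun i => continuousOn_iff'.1 hf (U i) (hU i)
  obtain ⟨δ, hδ, hball⟩ := lebesgue_number_lemma_of_metric hK hO fun x hx => by
    obtain ⟨i, hi⟩ := hKU x hx
    exact mem_iUnion.2 ⟨i, ((hOK i).subset ⟨hi, hx⟩).1⟩
  -- The grid cubes, scaled back to `[-1, 1]ᵏ`, have side `2 / N`, which must be less than the
  -- Lebesgue number `δ`.
  obtain ⟨N, hN⟩ := exists_nat_gt (2 / δ)
  have hNpos : (0 : ℝ) < N := (by positivity : 0 < 2 / δ).trans hN
  refine ⟨N, by exact_mod_cast hNpos, ?_⟩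
  have key : ∀ c : Fin k → ℤ, ∃ i, c ∈ gridCubes k N → ∀ y ∈ K,
      toGrid N y ∈ gridCell c → f y ∈ U i := by
    intro c
    by_cases h : ∃ y ∈ K, toGrid N y ∈ gridCell c
    · obtain ⟨y, hyK, hyc⟩ := h
      obtain ⟨i, hi⟩ := hball y hyK
      refine ⟨i, fun hc z hzK hzc => ((hOK i).symm.subset ⟨hi ?_, hzK⟩).1⟩
      rw [mem_ball, dist_pi_lt_iff hδ]
      intro j
      have h1 := hyc j
      have h2 := hzc j
      have h3 : (((c j + 1) / 2 : ℤ) : ℝ) = ((c j / 2 : ℤ) : ℝ) + 1 := by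
        have := (hc j).2.2
        rw [Int.odd_iff] at this
        exact_mod_cast (by omega : (c j + 1) / 2 = c j / 2 + 1)
      rw [h3] at h1 h2
      have h4 : |N * (z j - y j) / 2| ≤ 1 := by
        simp only [toGrid] at h1 h2
        rw [abs_le]
        constructor <;> linarith [h1.1, h1.2, h2.1, h2.2]
      rw [abs_div, abs_mul, abs_of_pos hNpos, abs_of_pos (zero_lt_two' ℝ)] at h4
      rw [Real.dist_eq]
      rw [div_lt_iff₀ hδ] at hN
      by_contra! hcon
      have : (N : ℝ) * δ ≤ N * |z j - y j| := by gcongr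
      linarith
    · push Not at h
      exact ⟨Classical.arbitrary ι, fun _ y hy hyc => absurd hyc (h y hy)⟩
  choose l hl using key
  exact ⟨l, hl⟩

/-- A face of full dimension has only odd entries and lies in no cube but itself. So faces shared by
two cubes have smaller dimension, which is the source of the drop in degree in `FillsSpheres.union`.
-/
theorem gridDim_lt_of_faces {N : ℕ} {a c c' : Fin k → ℤ} (hc : c ∈ gridCubes k N)
    (hc' : c' ∈ gridCubes k N) (h : GridFace a c) (h' : GridFace a c') (hne : c ≠ c') :
    gridDim a < k := by
  by_contra! hk
  refine hne (funext fun i => ?_)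
  have h1 := odd_of_gridDim_eq hk i
  have h2 := (hc i).2.2
  have h3 := (hc' i).2.2
  have := h i
  have := h' i
  rw [Int.odd_iff] at *
  omega

/-- If two open sets fill spheres up to dimension `k` and their intersection does so below
dimension `k`, then their union fills spheres of dimension `k`. -/
theorem FillsSpheres.union {A B : Set X} (hAo : IsOpen A) (hBo : IsOpen B)
    (hA : ∀ j ≤ k, FillsSpheres j A) (hB : ∀ j ≤ k, FillsSpheres j B)
    (hAB : ∀ j < k, FillsSpheres j (A ∩ B)) : FillsSpheres k (A ∪ B) := by
  intro f hf hfAB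
  let U : Bool → Set X := fun i => if i then A else B
  obtain ⟨N, hN, l, hl⟩ := exists_grid_label (isCompact_sphere 0 1) hf (U := U)
    (fun i => by cases i <;> simpa [U]) (fun x hx => by
      rcases hfAB hx with h | h
      · exact ⟨true, h⟩
      · exact ⟨false, h⟩)
  -- A face must be sent into the open set of every cube containing it. Passing to a face adds
  -- constraints, so the carrier is monotone; `L` consists of the faces on the boundary, where the
  -- map is prescribed.
  let C : (Fin k → ℤ) → Set X := fun a =>
    {x | ∀ c ∈ gridCubes k N, GridFace a c → x ∈ U (l c)}
  let L : Set (Fin k → ℤ) := {a | a ∈ gridFaces k N ∧ ∃ i, a i = 0 ∨ a i = 2 * N}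
  have hLs : ∀ a ∈ L, MapsTo (ofGrid N) (gridCell a) (sphere 0 1) := by
    rintro a ⟨ha, i, hi⟩ x hx
    have hb := ofGrid_mem_closedBall hN ha hx
    rw [mem_unitSphere_pi]
    refine ⟨mem_unitClosedBall_pi.1 hb, i, ?_⟩
    have hN' : (N : ℝ) ≠ 0 := by positivity
    have hxi := hx i
    rcases hi with hi | hi
    · rw [hi] at hxi
      norm_num at hxi
      have : x i = 0 := le_antisymm hxi.2 hxi.1
      simp [ofGrid, this]
    · rw [hi, show (2 * (N : ℤ) + 1) / 2 = N by omega, show (2 * (N : ℤ)) / 2 = N by omega] at hxi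
      have : x i = N := by exact_mod_cast le_antisymm hxi.2 hxi.1
      rw [ofGrid, this, mul_div_assoc, div_self hN']
      norm_num
  obtain ⟨F, hF, hFC⟩ := exists_extension_grid C L (f ∘ ofGrid N)
    (by
      rintro a ⟨ha, i, hi⟩ b hb
      refine ⟨hb.mem_gridFaces ha, i, ?_⟩
      have := hb i
      omega)
    (fun a ha => hf.comp (continuous_ofGrid N).continuousOn (hLs a ha))
    (fun a ha x hx c hc hac => by
      refine hl c hc _ (hLs a ha hx) ?_
      rw [toGrid_ofGrid hN]
      exact hac.subset hx)
    (gridFaces k N) (fun a ha b hb => hb.mem_gridFaces ha)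
    (fun a _ b hb x hx c hc hac => hx c hc (hb.trans hac))
    (fun a ha _ => by
      obtain ⟨c, hc, hac⟩ := exists_gridCube hN ha
      -- If the surrounding labels agree, the carrier is `A` or `B`. Otherwise it is `A ∩ B`, and
      -- the face has dimension below `k`.
      by_cases hall : ∀ c' ∈ gridCubes k N, GridFace a c' → l c' = l c
      · have : C a = U (l c) := by
          ext x
          refine ⟨fun hx => hx c hc hac, fun hx c' hc' hac' => ?_⟩
          rw [hall c' hc' hac']
          exact hx
        rw [this]
        cases l c
        · simpa [U] using hB _ (gridDim_le a)
        · simpa [U] using hA _ (gridDim_le a)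
      · push Not at hall
        obtain ⟨c', hc', hac', hne⟩ := hall
        have : C a = A ∩ B := by
          ext x
          refine ⟨fun hx => ?_, fun hx c'' _ _ => ?_⟩
          · have h1 := hx c hc hac
            have h2 := hx c' hc' hac'
            cases h3 : l c <;> cases h4 : l c' <;> simp_all [U]
          · cases l c''
            · simpa [U] using hx.2
            · simpa [U] using hx.1
        rw [this]
        exact hAB _ (gridDim_lt_of_faces hc hc' hac hac' fun h => hne (by rw [h])))
  have hmem : ∀ y ∈ closedBall (0 : Fin k → ℝ) 1, toGrid N y ∈ ⋃ a ∈ gridFaces k N, gridCell a :=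
    fun y hy => mem_biUnion (gridCarrier_toGrid_mem hy) (mem_gridCell_gridCarrier _)
  refine ⟨F ∘ toGrid N, hF.comp (continuous_toGrid N).continuousOn hmem, fun y hy => ?_,
    fun y hy => ?_⟩
  · have ha := gridCarrier_toGrid_mem (N := N) hy
    obtain ⟨c, hc, hac⟩ := exists_gridCube hN ha
    have := (hFC _ ha).1 (mem_gridCell_gridCarrier _) c hc hac
    cases h : l c <;> simp_all [U]
  · have ha := gridCarrier_toGrid_mem (N := N) (sphere_subset_closedBall hy)
    have hL : gridCarrier (toGrid N y) ∈ L := by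
      refine ⟨ha, ?_⟩
      obtain ⟨-, i, hi⟩ := mem_unitSphere_pi.1 hy
      refine ⟨i, ?_⟩
      rcases eq_or_eq_neg_of_abs_eq hi with h | h
      · right
        have : toGrid N y i = ((N : ℤ) : ℝ) := by simp [toGrid, h]; ring
        simp only [gridCarrier, this, Int.floor_intCast, Int.ceil_intCast]
        ring
      · left
        have : toGrid N y i = ((0 : ℤ) : ℝ) := by simp [toGrid, h]
        simp only [gridCarrier, this, Int.floor_intCast, Int.ceil_intCast]
        ring
    rw [Function.comp_apply, (hFC _ ha).2 hL (mem_gridCell_gridCarrier _), Function.comp_apply,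
      ofGrid_toGrid hN]

/-- A map of a cube to `R ⊆ U ∪ V` sending the boundary off `V` can be changed, relative to the
boundary, to a map to `R ∩ U`, provided that `R ∩ U ∩ V` fills spheres. -/
theorem exists_push_off {R U V : Set X} (hU : IsOpen U) (hV : IsOpen V)
    (hfill : ∀ j ≤ k, FillsSpheres j (R ∩ U ∩ V)) {f : (Fin k → ℝ) → X}
    (hf : ContinuousOn f (closedBall 0 1)) (hfR : MapsTo f (closedBall 0 1) R)
    (hfUV : MapsTo f (closedBall 0 1) (U ∪ V)) (hfV : ∀ x ∈ sphere 0 1, f x ∉ V) :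
    ∃ F : (Fin k → ℝ) → X, ContinuousOn F (closedBall 0 1) ∧ MapsTo F (closedBall 0 1) (R ∩ U) ∧
      EqOn F f (sphere 0 1) := by
  obtain ⟨N, hN, l, hl⟩ := exists_grid_label (isCompact_closedBall 0 1) hf
    (U := fun i : Bool => if i then U else V)
    (fun i => by cases i <;> simpa) (fun x hx => by
      rcases hfUV hx with h | h
      · exact ⟨true, h⟩
      · exact ⟨false, h⟩)
  -- Faces of cubes labelled by `U` form `L` and keep the map `f`. A face all of whose cubes are
  -- labelled by `V` has carrier `R ∩ U ∩ V` and is filled anew.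
  let C : (Fin k → ℤ) → Set X := fun a =>
    {x | x ∈ R ∩ U ∧ ∀ c ∈ gridCubes k N, GridFace a c → l c = false → x ∈ V}
  let L : Set (Fin k → ℤ) := {a | ∃ c ∈ gridCubes k N, GridFace a c ∧ l c = true}
  have hLs : ∀ a ∈ L, MapsTo (ofGrid N) (gridCell a) (closedBall 0 1) := by
    rintro a ⟨c, hc, hac, -⟩ x hx
    exact ofGrid_mem_closedBall hN (mem_gridFaces_of_mem_gridCubes hc) (hac.subset hx)
  obtain ⟨F, hF, hFC⟩ := exists_extension_grid C L (f ∘ ofGrid N)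
    (fun a ⟨c, hc, hac, hlc⟩ b hb => ⟨c, hc, hb.trans hac, hlc⟩)
    (fun a ha => hf.comp (continuous_ofGrid N).continuousOn (hLs a ha))
    (fun a ha x hx => by
      obtain ⟨c, hc, hac, hlc⟩ := ha
      have hb := hLs a ⟨c, hc, hac, hlc⟩ hx
      have hx' : ∀ c, GridFace a c → toGrid N (ofGrid N x) ∈ gridCell c := fun c hac => by
        rw [toGrid_ofGrid hN]; exact hac.subset hx
      refine ⟨⟨hfR hb, ?_⟩, fun c' hc' hac' hlc' => ?_⟩
      · simpa [hlc] using hl c hc _ hb (hx' c hac)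
      · simpa [hlc'] using hl c' hc' _ hb (hx' c' hac'))
    (gridFaces k N) (fun a ha b hb => hb.mem_gridFaces ha)
    (fun a _ b hb x hx => ⟨hx.1, fun c hc hac => hx.2 c hc (hb.trans hac)⟩)
    (fun a ha haL => by
      obtain ⟨c, hc, hac⟩ := exists_gridCube hN ha
      have hlc : l c = false := by
        by_contra h
        exact haL ⟨c, hc, hac, by simpa using h⟩
      have : C a = R ∩ U ∩ V := by
        ext x
        exact ⟨fun hx => ⟨hx.1, hx.2 c hc hac hlc⟩, fun hx => ⟨hx.1, fun _ _ _ _ => hx.2⟩⟩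
      rw [this]
      exact hfill _ (gridDim_le a))
  have hmem : ∀ y ∈ closedBall (0 : Fin k → ℝ) 1, toGrid N y ∈ ⋃ a ∈ gridFaces k N, gridCell a :=
    fun y hy => mem_biUnion (gridCarrier_toGrid_mem hy) (mem_gridCell_gridCarrier _)
  refine ⟨F ∘ toGrid N, hF.comp (continuous_toGrid N).continuousOn hmem, fun y hy => ?_,
    fun y hy => ?_⟩
  · exact ((hFC _ (gridCarrier_toGrid_mem hy)).1 (mem_gridCell_gridCarrier _)).1
  · have hy' := sphere_subset_closedBall hy
    have ha := gridCarrier_toGrid_mem (N := N) hy'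
    obtain ⟨c, hc, hac⟩ := exists_gridCube hN ha
    -- Boundary points are sent off `V`, so a cube containing one is labelled by `U`; hence the
    -- boundary values survive.
    have hL : gridCarrier (toGrid N y) ∈ L := by
      refine ⟨c, hc, hac, ?_⟩
      by_contra h
      have := hl c hc y hy' (hac.subset (mem_gridCell_gridCarrier _))
      rw [Bool.not_eq_true] at h
      exact hfV y hy (by simpa [h] using this)
    rw [Function.comp_apply, (hFC _ ha).2 hL (mem_gridCell_gridCarrier _), Function.comp_apply,
      ofGrid_toGrid hN]

end Subdivision

/-! ### Connectivity of punctured Euclidean space -/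

section Punctured

open Set Metric

/-- The complement of the origin in `ℝᵐ` fills spheres below dimension `m`. -/
theorem fillsSpheres_compl_zero (m : ℕ) :
    ∀ j < m, FillsSpheres j ({0}ᶜ : Set (Fin m → ℝ)) := by
  induction m with
  | zero => intro j hj; omega
  | succ m ih =>
    intro j hj
    -- Each `A b` is the complement of a closed half-axis, hence star-shaped about a point of the
    -- opposite half-axis. They cover the punctured space, and their intersection, the complement of
    -- the whole axis, is punctured `ℝᵐ` times a line; the induction applies to it.
    let A : Bool → Set (Fin (m + 1) → ℝ) := fun b =>
      {x | Fin.tail x ≠ 0 ∨ if b then 0 < x 0 else x 0 < 0}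
    have htail : Continuous (Fin.tail : (Fin (m + 1) → ℝ) → Fin m → ℝ) := by
      unfold Fin.tail; fun_prop
    have hopen : ∀ b, IsOpen (A b) := by
      intro b
      refine (isOpen_ne.preimage htail).union ?_
      cases b
      · exact isOpen_lt (continuous_apply 0) continuous_const
      · exact isOpen_lt continuous_const (continuous_apply 0)
    have hzero : ∀ x : Fin (m + 1) → ℝ, x = 0 ↔ Fin.tail x = 0 ∧ x 0 = 0 := by
      intro x
      refine ⟨by rintro rfl; exact ⟨rfl, rfl⟩, fun h => ?_⟩
      rw [← Fin.cons_self_tail x, h.1, h.2]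
      funext i
      refine Fin.cases rfl (fun i => rfl) i
    have hunion : ({0}ᶜ : Set (Fin (m + 1) → ℝ)) = A true ∪ A false := by
      ext x
      simp only [mem_compl_iff, mem_singleton_iff, hzero, A, mem_union, mem_ofPred_eq, if_true,
        Bool.false_eq_true, if_false]
      rcases lt_trichotomy (x 0) 0 with h | h | h
      · simp [h, h.ne]
      · simp [h]
      · simp [h, h.ne']
    have hstar : ∀ b j, FillsSpheres j (A b) := by
      intro b j
      let s : ℝ := if b then 1 else -1
      have hs : ∀ x : Fin (m + 1) → ℝ, x ∈ A b ↔ Fin.tail x ≠ 0 ∨ 0 < s * x 0 := by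
        intro x; cases b <;> simp [A, s]
      have hss : s * s = 1 := by cases b <;> simp [s]
      refine StarConvex.fillsSpheres (x := (Pi.single 0 s : Fin (m + 1) → ℝ)) ?_ ?_ j
      · intro x hx α β hα hβ hαβ
        rw [hs] at hx ⊢
        have h0 : (α • (Pi.single 0 s : Fin (m + 1) → ℝ) + β • x) 0 = α * s + β * x 0 := by simp
        have ht : Fin.tail (α • (Pi.single 0 s : Fin (m + 1) → ℝ) + β • x) = β • Fin.tail x := by
          funext i; simp [Fin.tail]
        rw [h0, ht]
        rcases hβ.eq_or_lt with rfl | hβ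
        · right
          have : α = 1 := by linarith
          rw [this]; nlinarith
        · rcases hx with hx | hx
          · exact Or.inl (smul_ne_zero hβ.ne' hx)
          · right
            have : s * (α * s + β * x 0) = α * (s * s) + β * (s * x 0) := by ring
            rw [this, hss]
            have := mul_pos hβ hx
            linarith
      · rw [hs]; right; simp [hss]
    rw [hunion]
    refine FillsSpheres.union (hopen _) (hopen _) (fun _ _ => hstar _ _) (fun _ _ => hstar _ _)
      fun i hi => ?_
    have hinter : A true ∩ A false = {x | Fin.tail x ≠ 0} := by
      ext x
      simp only [A, mem_inter_iff, mem_ofPred_eq, if_true, Bool.false_eq_true, if_false]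
      refine ⟨fun ⟨h1, h2⟩ => ?_, fun h => ⟨Or.inl h, Or.inl h⟩⟩
      rcases h1 with h1 | h1
      · exact h1
      · exact h2.resolve_right h1.not_gt
    rw [hinter]
    refine ((ih i (by omega)).prod (starConvex_univ (0 : ℝ) |>.fillsSpheres (mem_univ _) i)).of_retract
      (q := fun x => (Fin.tail x, x 0)) (p := fun z => Fin.cons z.2 z.1)
      (htail.prodMk (continuous_apply 0)).continuousOn (fun x hx => ⟨hx, mem_univ _⟩)
      (Continuous.continuousOn ?_) (fun z hz => by simpa using hz.1) (fun x _ => ?_)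
    · refine continuous_pi fun i => ?_
      refine Fin.cases ?_ (fun i => ?_) i
      · simpa using continuous_snd
      · simpa [Function.comp_def] using (continuous_apply i).comp continuous_fst
    · simp

/-- The punctured open unit ball fills spheres below its dimension. -/
theorem fillsSpheres_ball_diff_zero {m j : ℕ} (hj : j < m) :
    FillsSpheres j (ball (0 : Fin m → ℝ) 1 \ {0}) := by
  let e := OpenPartialHomeomorph.univUnitBall (E := Fin m → ℝ)
  have h0 : e 0 = 0 := OpenPartialHomeomorph.univUnitBall_apply_zero
  refine (fillsSpheres_compl_zero m j hj).of_retract (q := e.symm) (p := e)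
    (e.continuousOn_symm.mono sdiff_subset) (fun x hx hx0 => hx.2 ?_)
    (e.continuousOn.mono (subset_univ _)) (fun x hx => ⟨e.map_source (mem_univ x), fun hx0 => hx ?_⟩)
    (fun y hy => e.right_inv hy.1)
  · rw [← e.right_inv hx.1, hx0, h0, mem_singleton_iff]
  · exact e.injOn (mem_univ x) (mem_univ 0) ((mem_singleton_iff.1 hx0).trans h0.symm)

end Punctured

/-! ### CW complexes: compact sets and cellular approximation -/

section CellComplex

open Set Metric RelCWComplex

variable {X Y E : Type*} [TopologicalSpace X] [TopologicalSpace Y] [TopologicalSpace E]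

/-- A map on a compact set descends along a continuous map to a Hausdorff space, over any subset
`W` of the image, if it is compatible with the identifications over `W`. -/
theorem exists_descent [T2Space X] [Nonempty Y] {K : Set E} (hK : IsCompact K) {p : E → X}
    (hp : ContinuousOn p K) (W : Set X) {g : E → Y} (hg : ContinuousOn g (K ∩ p ⁻¹' W))
    (h : ∀ u ∈ K, ∀ v ∈ K, p u ∈ W → p u = p v → g u = g v) :
    ∃ G : X → Y, ContinuousOn G (p '' K ∩ W) ∧ ∀ u ∈ K, p u ∈ W → G (p u) = g u := by
  classical
  let G : X → Y := fun x =>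
    if hx : ∃ u ∈ K, p u = x then g hx.choose else Classical.arbitrary Y
  have hG : ∀ u ∈ K, p u ∈ W → G (p u) = g u := by
    intro u hu huW
    have hx : ∃ v ∈ K, p v = p u := ⟨u, hu, rfl⟩
    simp only [G, hx, dite_true]
    exact (h u hu _ hx.choose_spec.1 huW hx.choose_spec.2.symm).symm
  refine ⟨G, continuousOn_iff_isClosed.2 fun t ht => ?_, hG⟩
  -- The preimage of a closed set under `G` is, within `p '' K ∩ W`, the image of a compact subset
  -- of `K`, and compact sets are closed in the Hausdorff space `X`.
  obtain ⟨s, hs, hst⟩ := continuousOn_iff_isClosed.1 hg t ht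
  refine ⟨p '' (K ∩ s), ((hK.inter_right hs).image_of_continuousOn
    (hp.mono inter_subset_left)).isClosed, ?_⟩
  ext x
  constructor
  · rintro ⟨hxt, ⟨u, hu, rfl⟩, hxW⟩
    have : u ∈ s ∩ (K ∩ p ⁻¹' W) := hst.subset ⟨by
      rw [mem_preimage, hG u hu hxW] at hxt; exact hxt, hu, hxW⟩
    exact ⟨⟨u, ⟨hu, this.1⟩, rfl⟩, ⟨u, hu, rfl⟩, hxW⟩
  · rintro ⟨⟨u, ⟨hu, hus⟩, rfl⟩, hx, hxW⟩
    have : u ∈ g ⁻¹' t ∩ (K ∩ p ⁻¹' W) := hst.symm.subset ⟨hus, hu, hxW⟩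
    exact ⟨by rw [mem_preimage, hG u hu hxW]; exact this.1, hx, hxW⟩

variable [CWComplex (univ : Set X)]

variable (X) in
/-- The union of the open cells of dimension less than `n`. -/
def skeletonBelow (n : ℕ) : Set X :=
  {x | ∃ m < n, ∃ j : cell (univ : Set X) m, x ∈ openCell m j}

theorem skeletonBelow_mono {m n : ℕ} (h : m ≤ n) : skeletonBelow X m ⊆ skeletonBelow X n :=
  fun _ ⟨k, hk, j, hj⟩ => ⟨k, hk.trans_le h, j, hj⟩

theorem exists_mem_openCell (x : X) : ∃ (n : ℕ) (j : cell (univ : Set X) n), x ∈ openCell n j := by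
  have := CWComplex.iUnion_openCell_eq_complex (C := (univ : Set X)).symm.subset (mem_univ x)
  simpa using this

theorem cell_eq_of_mem {m n : ℕ} {i : cell (univ : Set X) m} {j : cell (univ : Set X) n} {x : X}
    (hi : x ∈ openCell m i) (hj : x ∈ openCell n j) :
    (⟨m, i⟩ : Σ n, cell (univ : Set X) n) = ⟨n, j⟩ :=
  eq_of_not_disjoint_openCell (not_disjoint_iff.2 ⟨x, hi, hj⟩)

theorem notMem_openCell_of_mem_skeletonBelow {m n : ℕ} (h : m ≤ n) {j : cell (univ : Set X) n}
    {x : X} (hx : x ∈ skeletonBelow X m) : x ∉ openCell n j := by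
  obtain ⟨k, hk, i, hi⟩ := hx
  intro hj
  have := congrArg Sigma.fst (cell_eq_of_mem hi hj)
  simp only at this
  omega

theorem cellFrontier_subset_finite (n : ℕ) (i : cell (univ : Set X) n) :
    ∃ J : Set (Σ m, cell (univ : Set X) m), J.Finite ∧ (∀ j ∈ J, j.1 < n) ∧
      cellFrontier n i ⊆ ⋃ j ∈ J, openCell j.1 j.2 := by
  obtain ⟨I, hI⟩ := CWComplex.cellFrontier_subset_finite_openCell n i
  refine ⟨⋃ m ∈ Finset.range n, Sigma.mk m '' (I m : Set (cell (univ : Set X) m)),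
    (Finset.finite_toSet _).biUnion fun m _ => (I m).finite_toSet.image _, ?_, ?_⟩
  · simp only [mem_iUnion, Finset.mem_range, mem_image]
    rintro _ ⟨m, hm, i, -, rfl⟩
    exact hm
  · intro x hx
    have := hI hx
    simp only [mem_iUnion] at this ⊢
    obtain ⟨m, hm, j, hj, hxj⟩ := this
    exact ⟨⟨m, j⟩, ⟨m, Finset.mem_range.2 hm, mem_image_of_mem _ hj⟩, hxj⟩

theorem closedCell_subset_finite (n : ℕ) (i : cell (univ : Set X) n) :
    ∃ J : Set (Σ m, cell (univ : Set X) m), J.Finite ∧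
      closedCell n i ⊆ ⋃ j ∈ J, openCell j.1 j.2 := by
  obtain ⟨J, hJ, -, hJi⟩ := cellFrontier_subset_finite n i
  refine ⟨insert ⟨n, i⟩ J, hJ.insert _, ?_⟩
  rw [← cellFrontier_union_openCell_eq_closedCell, biUnion_insert, union_comm]
  exact union_subset_union_right _ hJi

variable [T2Space X]

theorem skeletonBelow_eq (n : ℕ) : skeletonBelow X n = (skeletonLT (univ : Set X) n : Set X) := by
  ext x
  rw [SetLike.mem_coe, CWComplex.mem_skeletonLT_iff]
  simp [skeletonBelow]

theorem isClosed_skeletonBelow (n : ℕ) : IsClosed (skeletonBelow X n) := by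
  rw [skeletonBelow_eq]; exact (skeletonLT (univ : Set X) n).closed

theorem cellFrontier_subset_skeletonBelow (n : ℕ) (j : cell (univ : Set X) n) :
    cellFrontier n j ⊆ skeletonBelow X n := by
  rw [skeletonBelow_eq]; exact cellFrontier_subset_skeletonLT n j

theorem closedCell_subset_skeletonBelow {m n : ℕ} (h : m < n) (j : cell (univ : Set X) m) :
    closedCell m j ⊆ skeletonBelow X n := by
  rw [← cellFrontier_union_openCell_eq_closedCell]
  exact union_subset ((cellFrontier_subset_skeletonBelow m j).trans (skeletonBelow_mono h.le))
    fun x hx => ⟨m, h, j, hx⟩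

theorem isClosed_of_inter_closedCell {A : Set X}
    (h : ∀ n (j : cell (univ : Set X) n), IsClosed (A ∩ closedCell n j)) : IsClosed A :=
  (CWComplex.closed univ A (subset_univ A)).2 h

/-- A compact set meets only finitely many open cells. -/
theorem IsCompact.finite_openCells {K : Set X} (hK : IsCompact K) :
    {j : Σ m, cell (univ : Set X) m | (openCell j.1 j.2 ∩ K).Nonempty}.Finite := by
  set T := {j : Σ m, cell (univ : Set X) m | (openCell j.1 j.2 ∩ K).Nonempty}
  have hex : ∀ j, ∃ x : X, j ∈ T → x ∈ openCell j.1 j.2 ∩ K := by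
    intro j
    by_cases hj : j ∈ T
    · obtain ⟨x, hx⟩ := hj
      exact ⟨x, fun _ => hx⟩
    · exact ⟨map j.1 j.2 0, fun h => absurd h hj⟩
  -- One point is chosen in each cell met by `K`. Closed cells meet finitely many open cells, so
  -- every set of chosen points is closed; the chosen points form a compact discrete set, which is
  -- finite.
  choose p hp using hex
  have hinj : InjOn p T := fun i hi j hj hij =>
    cell_eq_of_mem (hp i hi).1 (by rw [hij]; exact (hp j hj).1)
  have hcl : ∀ S ⊆ T, IsClosed (p '' S) := by
    intro S hS
    refine isClosed_of_inter_closedCell fun n i => ?_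
    obtain ⟨J, hJ, hJi⟩ := closedCell_subset_finite n i
    refine ((hJ.image p).subset ?_).isClosed
    rintro _ ⟨⟨j, hj, rfl⟩, hji⟩
    obtain ⟨j', hj', hjj'⟩ := mem_iUnion₂.1 (hJi hji)
    have : j = j' := cell_eq_of_mem (hp j (hS hj)).1 hjj'
    exact mem_image_of_mem _ (this ▸ hj')
  have hsub : p '' T ⊆ K := by
    rintro _ ⟨j, hj, rfl⟩
    exact (hp j hj).2
  refine Finite.of_finite_image (IsCompact.finite (hK.of_isClosed_subset (hcl T subset_rfl) hsub) ?_)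
    hinj
  rw [isDiscrete_iff_discreteTopology, discreteTopology_iff_forall_isClosed]
  intro S
  have : S = Subtype.val ⁻¹' (p '' {j ∈ T | p j ∈ Subtype.val '' S}) := by
    ext ⟨x, hx⟩
    constructor
    · intro hxS
      obtain ⟨j, hj, rfl⟩ := hx
      exact ⟨j, ⟨hj, ⟨_, hxS, rfl⟩⟩, rfl⟩
    · rintro ⟨j, ⟨hj, ⟨y, hy, hyj⟩⟩, hjx⟩
      have : y = ⟨x, hx⟩ := Subtype.ext (hyj.trans hjx)
      rwa [← this]
  rw [this]
  exact (hcl _ (sep_subset _ _)).preimage continuous_subtype_val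

/-- A map of a cube can be pushed off an open cell of larger dimension. -/
theorem exists_push_off_cell {k m : ℕ} (hkm : k < m) {B : Set X} (hB : IsClosed B)
    (e : cell (univ : Set X) m) (he : cellFrontier m e ⊆ B) (hd : Disjoint B (openCell m e))
    {f : (Fin k → ℝ) → X} (hf : ContinuousOn f (closedBall 0 1))
    (hfB : MapsTo f (closedBall 0 1) (B ∪ openCell m e)) (hfs : MapsTo f (sphere 0 1) B) :
    ∃ F : (Fin k → ℝ) → X, ContinuousOn F (closedBall 0 1) ∧ MapsTo F (closedBall 0 1) B ∧
      EqOn F f (sphere 0 1) := by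
  set φ := map m e
  set c := φ 0
  have hφ : ContinuousOn φ (closedBall 0 1) := continuousOn m e
  have hsrc : φ.source = ball 0 1 := source_eq m e
  have htgt : φ.target = openCell m e := by
    rw [← φ.image_source_eq_target, hsrc]; rfl
  have h0 : (0 : Fin m → ℝ) ∈ ball (0 : Fin m → ℝ) 1 := mem_ball_self one_pos
  have hc : c ∈ openCell m e := mem_image_of_mem _ h0
  have hcB : c ∉ B := fun h => disjoint_left.1 hd h hc
  -- Away from `B` and the centre `c` there remains a punctured open `m`-cell, which fills spheres
  -- through dimension `k` because `k < m`. Hence `f` can be pushed off the single point `c`.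
  have hfill : ∀ j ≤ k, FillsSpheres j ((B ∪ openCell m e) ∩ {c}ᶜ ∩ Bᶜ) := by
    intro j hj
    have hset : (B ∪ openCell m e) ∩ {c}ᶜ ∩ Bᶜ = openCell m e \ {c} := by
      ext x
      have : x ∈ B → x ∉ openCell m e := fun hx => disjoint_left.1 hd hx
      simp only [mem_inter_iff, mem_union, mem_compl_iff, mem_singleton_iff, mem_sdiff]
      tauto
    rw [hset]
    refine (fillsSpheres_ball_diff_zero (hj.trans_lt hkm)).of_retract (q := φ.symm) (p := φ)
      ((continuousOn_symm m e).mono (by rw [htgt]; exact sdiff_subset)) (fun x hx => ?_)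
      (hφ.mono (sdiff_subset.trans ball_subset_closedBall)) (fun y hy => ?_) (fun x hx => ?_)
    · have hxt : x ∈ φ.target := by rw [htgt]; exact hx.1
      refine ⟨by rw [← hsrc]; exact φ.map_target hxt, fun h => hx.2 ?_⟩
      rw [mem_singleton_iff, ← φ.right_inv hxt, mem_singleton_iff.1 h]
    · refine ⟨mem_image_of_mem _ hy.1, fun h => hy.2 ?_⟩
      exact φ.injOn (by rw [hsrc]; exact hy.1) (by rw [hsrc]; exact h0) h
    · exact φ.right_inv (by rw [htgt]; exact hx.1)
  obtain ⟨F, hF, hFR, hFf⟩ := exists_push_off (isOpen_compl_singleton (x := c)) hB.isOpen_compl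
    hfill hf hfB (fun x hx => by
      rcases hfB hx with h | h
      · left; intro h'; exact hcB ((mem_singleton_iff.1 h') ▸ h)
      · right; exact fun h' => disjoint_left.1 hd h' h) (fun x hx h => h (hfs hx))
  have hdich : ∀ u ∈ closedBall (0 : Fin m → ℝ) 1, φ u ∈ openCell m e → u ∈ ball 0 1 := by
    intro u hu hmem
    rw [← sphere_union_ball] at hu
    exact hu.resolve_left fun h => disjoint_left.1 hd (he (mem_image_of_mem _ h)) hmem
  have : Nonempty X := ⟨c⟩
  -- Radial projection from the centre to the frontier is defined on the closed ball without its
  -- origin and descends to the closed cell without `c`: identifications occur only on the sphere,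
  -- where the projection is the identity.
  obtain ⟨ρ, hρ, hρφ⟩ := exists_descent (isCompact_closedBall (0 : Fin m → ℝ) 1) hφ {c}ᶜ
    (g := fun u => φ (‖u‖⁻¹ • u))
    (by
      refine hφ.comp ((continuousOn_id.norm.inv₀ fun u hu h => ?_).smul continuousOn_id)
        fun u hu => ?_
      · exact hu.2 (by rw [show u = 0 from norm_eq_zero.1 h]; rfl)
      · rw [mem_closedBall_zero_iff, norm_smul, norm_inv, norm_norm]
        exact inv_mul_le_one)
    (fun u hu v hv _ huv => by
      rw [← sphere_union_ball] at hu hv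
      rcases hu with hu | hu <;> rcases hv with hv | hv
      · simp only [mem_sphere_zero_iff_norm.1 hu, mem_sphere_zero_iff_norm.1 hv, inv_one, one_smul,
          huv]
      · exact absurd (hdich u (sphere_subset_closedBall hu)
          (by rw [huv]; exact mem_image_of_mem _ hv))
          (fun h => disjoint_left.1 sphere_disjoint_ball hu h)
      · exact absurd (hdich v (sphere_subset_closedBall hv)
          (by rw [← huv]; exact mem_image_of_mem _ hu))
          (fun h => disjoint_left.1 sphere_disjoint_ball hv h)
      · rw [φ.injOn (by rw [hsrc]; exact hu) (by rw [hsrc]; exact hv) huv])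
  have hρB : MapsTo ρ (closedCell m e ∩ {c}ᶜ) B := by
    rintro _ ⟨⟨u, hu, rfl⟩, huc⟩
    rw [hρφ u hu huc]
    refine he (mem_image_of_mem _ ?_)
    have : ‖u‖ ≠ 0 := fun h => huc (by rw [norm_eq_zero.1 h]; rfl)
    rw [mem_sphere_zero_iff_norm, norm_smul, norm_inv, norm_norm, inv_mul_cancel₀ this]
  have hρid : ∀ x ∈ closedCell m e, x ∈ B → ρ x = x := by
    rintro _ ⟨u, hu, rfl⟩ hxB
    have hu' : u ∈ sphere (0 : Fin m → ℝ) 1 := by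
      rw [← sphere_union_ball] at hu
      exact hu.resolve_right fun h => disjoint_left.1 hd hxB (mem_image_of_mem _ h)
    rw [hρφ u hu fun h => hcB (by rw [← mem_singleton_iff.1 h]; exact hxB),
      mem_sphere_zero_iff_norm.1 hu', inv_one, one_smul]
  have hFc : MapsTo F (closedBall 0 1 ∩ F ⁻¹' closedCell m e) (closedCell m e ∩ {c}ᶜ) :=
    fun x hx => ⟨hx.2, (hFR hx.1).2⟩
  -- The final map is `F` where it lies in `B` and `ρ ∘ F` where it lies in the closed cell.
  obtain ⟨G, hG, hG1, hG2⟩ := exists_glue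
    (hF.preimage_isClosed_of_isClosed isClosed_closedBall hB)
    (hF.preimage_isClosed_of_isClosed isClosed_closedBall (isClosed_closedCell (i := e)))
    (hF.mono inter_subset_left)
    (hρ.comp (hF.mono inter_subset_left) hFc)
    (fun x hx hx' => (hρid _ hx'.2 hx.2).symm)
  have hcov : ∀ x ∈ closedBall (0 : Fin k → ℝ) 1, x ∈ closedBall 0 1 ∩ F ⁻¹' B ∨
      x ∈ closedBall 0 1 ∩ F ⁻¹' closedCell m e := fun x hx =>
    (hFR hx).1.imp (fun h => ⟨hx, h⟩) fun h => ⟨hx, openCell_subset_closedCell _ _ h⟩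
  refine ⟨G, hG.mono hcov, fun x hx => ?_, fun x hx => ?_⟩
  · rcases hcov x hx with h | h
    · rw [hG1 h]; exact h.2
    · rw [hG2 h]; exact hρB (hFc h)
  · rw [hG1 ⟨sphere_subset_closedBall hx, by rw [mem_preimage, hFf hx]; exact hfs hx⟩, hFf hx]

/-- Cellular approximation: a map of the `k`-cube sending its boundary to the `n`-skeleton,
`k ≤ n`, can be changed, relative to the boundary, to a map to the `n`-skeleton. -/
theorem exists_extension_skeletonBelow {k n : ℕ} (hkn : k < n) {f : (Fin k → ℝ) → X}
    (hf : ContinuousOn f (closedBall 0 1)) (hfs : MapsTo f (sphere 0 1) (skeletonBelow X n)) :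
    ∃ F : (Fin k → ℝ) → X, ContinuousOn F (closedBall 0 1) ∧
      MapsTo F (closedBall 0 1) (skeletonBelow X n) ∧ EqOn F f (sphere 0 1) := by
  -- By compactness only finitely many `m`-cells matter, and they are cleared one at a time. Open
  -- cells of the same dimension are disjoint from the closures of one another, so each set `B`
  -- avoids the next cell.
  have level : ∀ m, k < m → n ≤ m → ∀ J : Set (cell (univ : Set X) m), J.Finite →
      ∀ f : (Fin k → ℝ) → X, ContinuousOn f (closedBall 0 1) →
      MapsTo f (sphere 0 1) (skeletonBelow X n) →
      MapsTo f (closedBall 0 1) (skeletonBelow X m ∪ ⋃ j ∈ J, closedCell m j) →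
      ∃ F : (Fin k → ℝ) → X, ContinuousOn F (closedBall 0 1) ∧
        MapsTo F (closedBall 0 1) (skeletonBelow X m) ∧ EqOn F f (sphere 0 1) := by
    intro m hkm hnm J hJ
    induction J, hJ using Set.Finite.induction_on with
    | empty => exact fun f hf _ hfJ => ⟨f, hf, by simpa using hfJ, eqOn_refl _ _⟩
    | @insert e J heJ hJ ih =>
      intro f hf hfs hfJ
      set B := skeletonBelow X m ∪ ⋃ j ∈ J, closedCell m j
      have hB : IsClosed B := (isClosed_skeletonBelow m).union
        (hJ.isClosed_biUnion fun j _ => isClosed_closedCell)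
      have hsm := cellFrontier_subset_skeletonBelow m e
      have hsB : skeletonBelow X m ⊆ B := subset_union_left
      have hd : Disjoint B (openCell m e) := by
        rw [disjoint_left]
        rintro x (hx | hx) hxe
        · exact notMem_openCell_of_mem_skeletonBelow le_rfl hx hxe
        · obtain ⟨j, hj, hxj⟩ := mem_iUnion₂.1 hx
          rw [← cellFrontier_union_openCell_eq_closedCell] at hxj
          rcases hxj with hxj | hxj
          · exact notMem_openCell_of_mem_skeletonBelow le_rfl
              (cellFrontier_subset_skeletonBelow m j hxj) hxe
          · have := cell_eq_of_mem hxj hxe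
            simp only [Sigma.mk.injEq, heq_eq_eq, true_and] at this
            exact heJ (this ▸ hj)
      obtain ⟨F, hF, hFB, hFf⟩ := exists_push_off_cell hkm hB e (hsm.trans hsB) hd hf
        (fun x hx => by
          rcases hfJ hx with h | h
          · exact Or.inl (hsB h)
          · rw [biUnion_insert, ← cellFrontier_union_openCell_eq_closedCell] at h
            rcases h with (h | h) | h
            · exact Or.inl (hsB (hsm h))
            · exact Or.inr h
            · exact Or.inl (Or.inr h))
        (fun x hx => hsB (skeletonBelow_mono hnm (hfs hx)))
      obtain ⟨G, hG, hGB, hGF⟩ := ih F hF (fun x hx => by rw [hFf hx]; exact hfs hx) hFB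
      exact ⟨G, hG, hGB, hGF.trans hFf⟩
  have hfin := ((isCompact_closedBall (0 : Fin k → ℝ) 1).image_of_continuousOn hf).finite_openCells
  obtain ⟨M, hM⟩ := (hfin.image Sigma.fst).bddAbove
  have hfM : MapsTo f (closedBall 0 1) (skeletonBelow X (n + (M + 1))) := by
    intro x hx
    obtain ⟨m, j, hj⟩ := exists_mem_openCell (f x)
    have : m ≤ M := hM ⟨⟨m, j⟩, ⟨f x, hj, mem_image_of_mem f hx⟩, rfl⟩
    exact ⟨m, by omega, j, hj⟩
  -- The compact image lies in a skeleton exceeding the target by `d` dimensions; the excess is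
  -- removed from the top down.
  generalize M + 1 = d at hfM
  clear hM hfin
  induction d generalizing f with
  | zero => exact ⟨f, hf, hfM, eqOn_refl _ _⟩
  | succ d ih =>
    have hfin := ((isCompact_closedBall (0 : Fin k → ℝ) 1).image_of_continuousOn hf).finite_openCells
    obtain ⟨F, hF, hFm, hFf⟩ := level (n + d) (by omega) (by omega)
      (Sigma.mk (n + d) ⁻¹' {j | (openCell j.1 j.2 ∩ f '' closedBall 0 1).Nonempty})
      (hfin.preimage (sigma_mk_injective.injOn)) f hf hfs (fun x hx => by
        obtain ⟨m, hm, j, hj⟩ := hfM hx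
        rcases (Nat.lt_succ_iff.1 hm).lt_or_eq with h | rfl
        · exact Or.inl ⟨m, h, j, hj⟩
        · exact Or.inr (mem_biUnion (x := j) ⟨f x, hj, mem_image_of_mem f hx⟩
            (openCell_subset_closedCell _ _ hj)))
    obtain ⟨G, hG, hGm, hGF⟩ := ih hF (fun x hx => by rw [hFf hx]; exact hfs hx) hFm
    exact ⟨G, hG, hGm, hGF.trans hFf⟩

/-- A filling in all of `X` is pushed down relative to its boundary. As `skeletonBelow X n` stops at
dimension `n - 1`, `k < n` is the range of cellular approximation. -/
theorem FillsSpheres.skeletonBelow {k n : ℕ} (hkn : k < n) (h : FillsSpheres k (univ : Set X)) :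
    FillsSpheres k (skeletonBelow X n) := by
  intro f hf hfs
  obtain ⟨F, hF, -, hFf⟩ := h f hf (mapsTo_univ _ _)
  obtain ⟨G, hG, hGs, hGF⟩ := exists_extension_skeletonBelow hkn hF
    (fun x hx => by rw [hFf hx]; exact hfs hx)
  exact ⟨G, hG, hGs, hGF.trans hFf⟩

end CellComplex

/-! ### Constructing CW structures from characteristic maps -/

section Builder

open Set Metric RelCWComplex

/-- The data of a CW structure on a whole space, with characteristic maps defined everywhere and
frontiers covered by open cells. -/
structure CellData (X : Type u) [TopologicalSpace X] where
  /-- The cells of each dimension. -/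
  cell : ℕ → Type u
  /-- The characteristic maps. -/
  map : ∀ n, cell n → (Fin n → ℝ) → X
  continuousOn : ∀ n i, ContinuousOn (map n i) (closedBall 0 1)
  injOn : ∀ n i, InjOn (map n i) (ball 0 1)
  disjoint : ∀ m n i j, ∀ x ∈ ball 0 1, ∀ y ∈ ball 0 1, map m i x = map n j y →
    (⟨m, i⟩ : Σ n, cell n) = ⟨n, j⟩
  frontier : ∀ n i, ∃ J : Set (Σ m, cell m), J.Finite ∧ (∀ j ∈ J, j.1 < n) ∧
    ∀ x ∈ sphere 0 1, ∃ j ∈ J, map n i x ∈ map j.1 j.2 '' ball 0 1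
  closed : ∀ A : Set X, (∀ n i, IsClosed (A ∩ map n i '' closedBall 0 1)) → IsClosed A
  surj : ∀ x, ∃ n i, x ∈ map n i '' ball 0 1

variable {X : Type u} [TopologicalSpace X]

open Classical in
/-- A cell structure on a Hausdorff space makes it a CW complex. -/
noncomputable abbrev CellData.toCWComplex [T2Space X] (D : CellData X) :
    CWComplex (univ : Set X) where
  cell := D.cell
  map n i := (D.injOn n i).toPartialEquiv
  source_eq n i := rfl
  continuousOn := D.continuousOn
  continuousOn_symm n i := by
    obtain ⟨J, -, hJn, hJ⟩ := D.frontier n i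
    -- The frontier is covered by cells of smaller dimension, so only interior points of the ball
    -- map into the open cell. There the map is injective, so the identity of the ball descends to a
    -- continuous inverse.
    have hW : closedBall 0 1 ∩ D.map n i ⁻¹' (D.map n i '' ball 0 1) ⊆ ball 0 1 := by
      rintro u ⟨hu, y, hy, hyu⟩
      rw [← sphere_union_ball] at hu
      refine hu.resolve_left fun hus => ?_
      obtain ⟨j, hj, z, hz, hzu⟩ := hJ u hus
      have := congrArg Sigma.fst (D.disjoint _ _ _ _ y hy z hz (hyu.trans hzu.symm))
      exact (hJn j hj).ne' this
    obtain ⟨G, hG, hGu⟩ := exists_descent (isCompact_closedBall (0 : Fin n → ℝ) 1)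
      (D.continuousOn n i) (D.map n i '' ball 0 1) (g := id) continuousOn_id
      (fun u hu v hv huW huv => D.injOn n i (hW ⟨hu, huW⟩)
        (hW ⟨hv, by change D.map n i v ∈ D.map n i '' ball 0 1; rw [← huv]; exact huW⟩) huv)
    have hsub : D.map n i '' ball 0 1 ⊆ D.map n i '' closedBall 0 1 ∩ D.map n i '' ball 0 1 :=
      fun x hx => ⟨image_mono ball_subset_closedBall hx, hx⟩
    refine (hG.mono hsub).congr ?_
    rintro _ ⟨u, hu, rfl⟩
    rw [hGu u (ball_subset_closedBall hu) (mem_image_of_mem _ hu)]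
    exact (D.injOn n i).toPartialEquiv.left_inv hu
  pairwiseDisjoint' := by
    rintro ⟨m, i⟩ - ⟨n, j⟩ - hne
    refine disjoint_left.2 ?_
    rintro _ ⟨x, hx, rfl⟩ ⟨y, hy, hxy⟩
    exact hne (D.disjoint m n i j x hx y hy hxy.symm)
  mapsTo' n i := by
    obtain ⟨J, hJf, hJn, hJ⟩ := D.frontier n i
    refine ⟨fun m => (hJf.preimage (f := Sigma.mk m) sigma_mk_injective.injOn).toFinset,
      fun x hx => ?_⟩
    obtain ⟨⟨m, j⟩, hj, hxj⟩ := hJ x hx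
    simp only [mem_iUnion]
    exact ⟨m, hJn _ hj, j, by simpa using hj, image_mono ball_subset_closedBall hxj⟩
  closed' A _ h := D.closed A h
  union' := by
    refine eq_univ_of_forall fun x => ?_
    obtain ⟨n, i, hx⟩ := D.surj x
    exact mem_iUnion₂.2 ⟨n, i, image_mono ball_subset_closedBall hx⟩

end Builder

/-! ### Free cocompact actions in terms of cells -/

section Actions

open Set Metric RelCWComplex

variable {G : Type u} [Group G] {X : Type u} [TopologicalSpace X]
  [CWComplex (univ : Set X)] [MulAction G X] [ContinuousConstSMul G X]

/-- An action on cell indices is easier to construct than equalities of images, and inclusions of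
translated cells suffice: the inverse element carries the target cell into one meeting, hence equal
to, the original. -/
theorem isFreeCocompactCellularAction_iff : IsFreeCocompactCellularAction G X ↔
    ∃ p : G → ∀ k, cell (univ : Set X) k → cell (univ : Set X) k,
      (∀ g k e, ∀ x ∈ openCell k e, g • x ∈ openCell k (p g k e)) ∧
      (∀ g k e, p g k e = e → g = 1) ∧
      ∃ S : Set (Σ k, cell (univ : Set X) k), S.Finite ∧
        ∀ k e, ∃ g e', ⟨k, e'⟩ ∈ S ∧ p g k e' = e := by
  constructor
  · intro h
    choose p hp using h.permutes
    refine ⟨p, fun g k e x hx => (hp g k e).subset (mem_image_of_mem _ hx),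
      fun g k e he => h.free g k e (by rw [hp, he]), ?_⟩
    obtain ⟨S, hS, hSe⟩ := h.cocompact
    refine ⟨S, hS, fun k e => ?_⟩
    obtain ⟨g, e', he', hge⟩ := hSe k e
    exact ⟨g, e', he', openCell_congr k (by rw [← hp, hge])⟩
  · rintro ⟨p, hp, hfree, S, hS, hSe⟩
    have key : ∀ g k e, (fun x => g • x) '' openCell k e = openCell k (p g k e) := by
      intro g k e
      refine subset_antisymm (by rintro _ ⟨x, hx, rfl⟩; exact hp g k e x hx) fun y hy => ?_
      refine ⟨g⁻¹ • y, ?_, smul_inv_smul g y⟩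
      have h0 : (map k e 0 : X) ∈ openCell k e := map_zero_mem_openCell k e
      have h1 := hp g⁻¹ k _ _ (hp g k e _ h0)
      rw [inv_smul_smul] at h1
      have h2 := cell_eq_of_mem h0 h1
      simp only [Sigma.mk.injEq, heq_eq_eq, true_and] at h2
      have h3 := hp g⁻¹ k _ y hy
      rwa [← h2] at h3
    exact ⟨fun g k e => ⟨_, key g k e⟩, fun g k e h => hfree g k e (openCell_congr k (by
      rw [← key, h])), S, hS, fun k e => by
        obtain ⟨g, e', he', h⟩ := hSe k e
        exact ⟨g, e', he', by rw [key, h]⟩⟩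

theorem smul_mem_skeletonBelow (h : IsFreeCocompactCellularAction G X) (g : G) {n : ℕ} {x : X}
    (hx : x ∈ skeletonBelow X n) : g • x ∈ skeletonBelow X n := by
  obtain ⟨m, hm, e, he⟩ := hx
  obtain ⟨e', he'⟩ := h.permutes g m e
  exact ⟨m, hm, e', he'.subset (mem_image_of_mem _ he)⟩

end Actions

/-! ### Passing to a skeleton -/

section Truncation

open Set Metric RelCWComplex

variable {X : Type u} [TopologicalSpace X] [T2Space X] [CWComplex (univ : Set X)]

open Classical in
/-- The cell structure of a skeleton. -/
noncomputable def skeletonBelowCellData (n : ℕ) : CellData (skeletonBelow X n) where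
  cell k := {_e : cell (univ : Set X) k // k < n}
  -- Characteristic maps are total, but only the closed ball is known to land in the skeleton;
  -- elsewhere the value at the centre is used.
  map k e x := ⟨map k e.1 (if x ∈ closedBall 0 1 then x else 0),
    closedCell_subset_skeletonBelow e.2 e.1 (mem_image_of_mem _ (by
      split_ifs with h
      · exact h
      · simp))⟩
  continuousOn k e := by
    rw [IsInducing.subtypeVal.continuousOn_iff]
    refine (continuousOn k e.1).congr fun x hx => ?_
    simp only [Function.comp_apply, if_pos hx]
  injOn k e x hx y hy h := by
    have hx' := ball_subset_closedBall hx
    have hy' := ball_subset_closedBall hy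
    rw [Subtype.ext_iff] at h
    simp only [if_pos hx', if_pos hy'] at h
    exact (map k e.1).injOn (by rw [source_eq]; exact hx) (by rw [source_eq]; exact hy) h
  disjoint l m i j x hx y hy h := by
    rw [Subtype.ext_iff] at h
    simp only [if_pos (ball_subset_closedBall hx), if_pos (ball_subset_closedBall hy)] at h
    have := cell_eq_of_mem (mem_image_of_mem (map l i.1) hx)
      (by rw [h]; exact mem_image_of_mem (map m j.1) hy)
    obtain ⟨i, hi⟩ := i
    obtain ⟨j, hj⟩ := j
    simp only [Sigma.mk.injEq] at this
    obtain ⟨rfl, h⟩ := this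
    rw [eq_of_heq h]
  frontier k e := by
    obtain ⟨J, hJ, hJk, hJe⟩ := cellFrontier_subset_finite k e.1
    refine ⟨(fun j : Σ m, {_e : cell (univ : Set X) m // m < n} =>
      (⟨j.1, j.2.1⟩ : Σ m, cell (univ : Set X) m)) ⁻¹' J, hJ.preimage ?_, fun j hj => hJk _ hj,
      fun x hx => ?_⟩
    · rintro ⟨l, i, hi⟩ - ⟨m, j, hj⟩ - h
      simp only [Sigma.mk.injEq] at h
      obtain ⟨rfl, h⟩ := h
      rw [eq_of_heq h]
    · obtain ⟨j, hj, y, hy, hyx⟩ := mem_iUnion₂.1 (hJe (mem_image_of_mem _ hx))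
      refine ⟨⟨j.1, j.2, (hJk j hj).trans e.2⟩, hj, y, hy, Subtype.ext ?_⟩
      simp only [if_pos (ball_subset_closedBall hy), if_pos (sphere_subset_closedBall hx)]
      exact hyx
  closed A hA := by
    have hcl : IsClosed (Subtype.val '' A) := by
      refine CWComplex.isClosed_of_disjoint_openCell_or_isClosed_inter_closedCell
        (C := (univ : Set X)) (subset_univ _) fun k _ e => ?_
      by_cases hk : k < n
      · right
        have h := ((isClosed_skeletonBelow n).isClosedEmbedding_subtypeVal).isClosedMap _
          (hA k ⟨e, hk⟩)
        convert h using 1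
        rw [image_inter Subtype.val_injective]
        congr 1
        ext x
        constructor
        · rintro ⟨y, hy, rfl⟩
          exact ⟨_, ⟨y, hy, rfl⟩, by simp only [if_pos hy]⟩
        · rintro ⟨_, ⟨y, hy, rfl⟩, rfl⟩
          simp only [if_pos hy]
          exact ⟨y, hy, rfl⟩
      · left
        rw [disjoint_left]
        rintro _ ⟨x, -, rfl⟩
        exact notMem_openCell_of_mem_skeletonBelow (not_lt.1 hk) x.2
    simpa [preimage_image_eq _ Subtype.val_injective] using
      hcl.preimage (continuous_subtype_val (p := (· ∈ skeletonBelow X n)))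
  surj := by
    rintro ⟨x, m, hm, e, y, hy, rfl⟩
    exact ⟨m, ⟨e, hm⟩, y, hy, by simp only [if_pos (ball_subset_closedBall hy)]⟩

/-- A group of type `Fⁿ` acts on an `(n - 1)`-connected complex of dimension at most `n`. -/
theorem IsOfTypeF.exists_finite_dimensional {n : ℕ} {G : Type u} [Group G] (h : IsOfTypeF n G) :
    ∃ (X : Type u) (_ : TopologicalSpace X) (_ : T2Space X) (_ : CWComplex (univ : Set X))
      (_ : MulAction G X) (_ : ContinuousConstSMul G X),
      ConnectedBelow n X ∧ IsFreeCocompactCellularAction G X ∧ skeletonBelow X (n + 1) = univ := by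
  classical
  obtain ⟨X, _, _, _, _, _, hconn, hact⟩ := h
  obtain ⟨hX, hfill⟩ := connectedBelow_iff.1 hconn
  -- Cells of dimension at most `n` are kept: this is the smallest skeleton for which cellular
  -- approximation retains fillings by cubes of dimension at most `n`.
  let D := skeletonBelowCellData (X := X) (n + 1)
  let Y := skeletonBelow X (n + 1)
  let _ : CWComplex (univ : Set Y) := D.toCWComplex
  let _ : MulAction G Y :=
    { smul := fun g y => ⟨g • y.1, smul_mem_skeletonBelow hact g y.2⟩
      one_smul := fun y => Subtype.ext (one_smul G y.1)
      mul_smul := fun g h y => Subtype.ext (mul_smul g h y.1) }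
  have _ : ContinuousConstSMul G Y :=
    ⟨fun g => (continuous_subtype_val.const_smul g).subtype_mk _⟩
  have hopen : ∀ k (e : D.cell k) (y : Y), y ∈ D.map k e '' ball 0 1 ↔ y.1 ∈ openCell k e.1 := by
    intro k e y
    constructor
    · rintro ⟨x, hx, rfl⟩
      refine ⟨x, hx, ?_⟩
      simp only [D, skeletonBelowCellData, if_pos (ball_subset_closedBall hx)]
    · rintro ⟨x, hx, hxy⟩
      refine ⟨x, hx, Subtype.ext ?_⟩
      simp only [D, skeletonBelowCellData, if_pos (ball_subset_closedBall hx)]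
      exact hxy
  refine ⟨Y, inferInstance, inferInstance, inferInstance, inferInstance, inferInstance,
    connectedBelow_iff.2 ⟨?_, fun k hk => ?_⟩, ?_, ?_⟩
  · exact ((hfill 0 (Nat.zero_le n)).skeletonBelow n.succ_pos).nonempty.to_subtype
  · refine ((hfill k hk).skeletonBelow (Nat.lt_succ_of_le hk)).of_retract (q := Subtype.val)
      (p := fun x => if hx : x ∈ Y then ⟨x, hx⟩ else
        ((hfill 0 (Nat.zero_le n)).skeletonBelow n.succ_pos).nonempty.to_subtype.some)
      continuous_subtype_val.continuousOn (fun y _ => y.2) ?_ (mapsTo_univ _ _) ?_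
    · rw [IsInducing.subtypeVal.continuousOn_iff]
      refine continuousOn_id.congr fun x hx => ?_
      have hx' : x ∈ Y := hx
      simp only [Function.comp_apply, dif_pos hx', id]
    · rintro ⟨y, hy⟩ -
      simp only [dif_pos hy]
  · obtain ⟨p, hp, hfree, S, hS, hSe⟩ := isFreeCocompactCellularAction_iff.1 hact
    refine isFreeCocompactCellularAction_iff.2 ⟨fun g k e => ⟨p g k e.1, e.2⟩, ?_, ?_, ?_⟩
    · intro g k e y hy
      exact (hopen k _ _).2 (hp g k e.1 y.1 ((hopen k e y).1 hy))
    · exact fun g k e he => hfree g k e.1 (congrArg Subtype.val he)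
    · refine ⟨(fun j : Σ m, {_e : cell (univ : Set X) m // m < n + 1} =>
        (⟨j.1, j.2.1⟩ : Σ m, cell (univ : Set X) m)) ⁻¹' S, hS.preimage ?_, fun k e => ?_⟩
      · rintro ⟨l, i, hi⟩ - ⟨m, j, hj⟩ - h
        simp only [Sigma.mk.injEq] at h
        obtain ⟨rfl, h⟩ := h
        rw [eq_of_heq h]
      · obtain ⟨g, e', he', hge⟩ := hSe k e.1
        exact ⟨g, ⟨e', e.2⟩, he', Subtype.ext hge⟩
  · refine eq_univ_of_forall fun y => ?_
    obtain ⟨k, e, he⟩ := D.surj y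
    exact ⟨k, e.2, e, he⟩

end Truncation

/-! ### Equivariant cellular maps out of free complexes -/

section EquivariantMap

open Set Metric RelCWComplex

variable {H : Type u} [Group H] {Y : Type u} [TopologicalSpace Y] [T2Space Y]
  [CWComplex (univ : Set Y)] [MulAction H Y] [ContinuousConstSMul H Y]
  {X : Type u} [TopologicalSpace X] [T2Space X] [CWComplex (univ : Set X)] [MulAction H X]
  [ContinuousConstSMul H X]

/-- A free complex has an equivariant cellular map to any complex with a cellular action that
fills spheres, on skeleta of the appropriate dimension. -/
theorem exists_equivariant_cellular (hY : IsFreeCocompactCellularAction H Y)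
    (hX : ∀ (h : H) (n : ℕ), ∀ x ∈ skeletonBelow X n, h • x ∈ skeletonBelow X n) [Nonempty X]
    (N : ℕ) (hfill : ∀ k < N, FillsSpheres k (univ : Set X)) :
    ∃ f : Y → X, ContinuousOn f (skeletonBelow Y N) ∧
      (∀ h : H, ∀ y ∈ skeletonBelow Y N, f (h • y) = h • f y) ∧
      ∀ k ≤ N, MapsTo f (skeletonBelow Y k) (skeletonBelow X k) := by
  classical
  induction N with
  | zero =>
    have h0 : skeletonBelow Y 0 = ∅ := by
      ext y; simp [skeletonBelow]
    refine ⟨fun _ => Classical.arbitrary X, continuousOn_const, ?_, ?_⟩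
    · rw [h0]; simp
    · intro k hk
      rw [Nat.le_zero.1 hk, h0]
      exact mapsTo_empty _ _
  | succ N ih =>
    obtain ⟨f, hf, hfe, hfk⟩ := ih fun k hk => hfill k (hk.trans N.lt_succ_self)
    have hskY : ∀ (h : H) {n : ℕ} {y : Y}, y ∈ skeletonBelow Y n → h • y ∈ skeletonBelow Y n :=
      fun h _ _ hy => smul_mem_skeletonBelow hY h hy
    obtain ⟨p, hp, hfree, -⟩ := isFreeCocompactCellularAction_iff.1 hY
    -- First a choice over each `N`-cell, with no equivariance: fill the map already given on its
    -- frontier, inside the cells of `X` of dimension at most `N`.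
    have hu : ∀ e : cell (univ : Set Y) N, ∃ u : (Fin N → ℝ) → X,
        ContinuousOn u (closedBall 0 1) ∧ MapsTo u (closedBall 0 1) (skeletonBelow X (N + 1)) ∧
        EqOn u (f ∘ map N e) (sphere 0 1) := by
      intro e
      have hs : MapsTo (map N e) (sphere 0 1) (skeletonBelow Y N) := fun x hx =>
        cellFrontier_subset_skeletonBelow N e (mem_image_of_mem _ hx)
      exact (hfill N N.lt_succ_self).skeletonBelow N.lt_succ_self _
        (hf.comp ((continuousOn N e).mono sphere_subset_closedBall) hs)
        fun x hx => skeletonBelow_mono N.le_succ (hfk N le_rfl (hs hx))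
    choose u hu hus huf using hu
    have hpt : ∀ (e e' : cell (univ : Set Y) N) (y : Y), y ∈ openCell N e → y ∈ openCell N e' →
        e = e' := fun e e' y h h' => by simpa using cell_eq_of_mem h h'
    have hmap0 : ∀ e : cell (univ : Set Y) N, (map N e 0 : Y) ∈ openCell N e :=
      fun e => map_zero_mem_openCell N e
    have hpmul : ∀ g h e, p (g * h) N e = p g N (p h N e) := fun g h e =>
      hpt _ _ _ (hp (g * h) N e _ (hmap0 e)) (by
        rw [mul_smul]; exact hp g N _ _ (hp h N e _ (hmap0 e)))
    have hpone : ∀ e, p 1 N e = e := fun e =>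
      hpt _ _ _ (hp 1 N e _ (hmap0 e)) (by rw [one_smul]; exact hmap0 e)
    let r : Setoid (cell (univ : Set Y) N) :=
      { r := fun e e' => ∃ h, p h N e = e'
        iseqv := ⟨fun e => ⟨1, hpone e⟩, by
          rintro e _ ⟨h, rfl⟩
          exact ⟨h⁻¹, by rw [← hpmul, inv_mul_cancel, hpone]⟩, by
          rintro e _ _ ⟨h, rfl⟩ ⟨g, rfl⟩
          exact ⟨g * h, hpmul g h e⟩⟩ }
    have hq : ∀ h e, Quotient.mk r e = Quotient.mk r (p h N e) := fun h e =>
      Quotient.sound (s := r) ⟨h, rfl⟩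
    -- One cell per orbit. Only the fillings over these cells are used, and they are spread over
    -- their orbits by translation.
    let R : Set (cell (univ : Set Y) N) := {e | (Quotient.mk r e).out = e}
    have hR : ∀ e, ∃ h, ∃ e' ∈ R, p h N e' = e := fun e => by
      obtain ⟨h, hh⟩ := Quotient.mk_out (s := r) e
      exact ⟨h, (Quotient.mk r e).out, by simp [R], hh⟩
    -- Freeness enters here: an interior point determines its representative cell, its translating
    -- element and its parameter, so the translated fillings are unambiguous.
    have huniq : ∀ h h' : H, ∀ e ∈ R, ∀ e' ∈ R, ∀ x ∈ ball 0 1, ∀ x' ∈ ball 0 1,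
        h • (map N e x : Y) = h' • map N e' x' → h • u e x = h' • u e' x' := by
      intro h h' e he e' he' x hx x' hx' heq
      have h1 : p h N e = p h' N e' := hpt _ _ _ (hp h N e _ (mem_image_of_mem _ hx)) (by
        rw [heq]; exact hp h' N e' _ (mem_image_of_mem _ hx'))
      have h2 : Quotient.mk r e = Quotient.mk r e' :=
        (hq h e).trans (by rw [h1]; exact (hq h' e').symm)
      have h3 : e = e' := by
        rw [← show (Quotient.mk r e).out = e from he, h2]; exact he'
      subst h3
      have h4 : h'⁻¹ * h = 1 := hfree _ N e (by
        rw [hpmul, h1, ← hpmul, inv_mul_cancel, hpone])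
      have h5 : h = h' := (inv_mul_eq_one.1 h4).symm
      subst h5
      rw [smul_left_cancel_iff] at heq
      rw [(map N e).injOn (by rw [source_eq]; exact hx) (by rw [source_eq]; exact hx') heq]
    have hnot : ∀ (h : H) e, ∀ x ∈ ball 0 1, h • (map N e x : Y) ∉ skeletonBelow Y N :=
      fun h e x hx hmem => notMem_openCell_of_mem_skeletonBelow le_rfl hmem
        (hp h N e _ (mem_image_of_mem _ hx))
    let P : Y → H × cell (univ : Set Y) N × (Fin N → ℝ) → Prop := fun y t =>
      t.2.1 ∈ R ∧ t.2.2 ∈ ball 0 1 ∧ y = t.1 • map N t.2.1 t.2.2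
    let F : Y → X := fun y => if y ∈ skeletonBelow Y N then f y else
      if ht : ∃ t, P y t then ht.choose.1 • u ht.choose.2.1 ht.choose.2.2 else
        Classical.arbitrary X
    have hFf : ∀ y ∈ skeletonBelow Y N, F y = f y := fun y hy => if_pos hy
    have hFu : ∀ (h : H), ∀ e ∈ R, ∀ x ∈ closedBall 0 1, F (h • map N e x) = h • u e x := by
      intro h e he x hx
      rw [← sphere_union_ball] at hx
      rcases hx with hx | hx
      · have hs : (map N e x : Y) ∈ skeletonBelow Y N :=
          cellFrontier_subset_skeletonBelow N e (mem_image_of_mem _ hx)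
        rw [hFf _ (hskY h hs), hfe h _ hs, huf e hx, Function.comp_apply]
      · have ht : ∃ t, P (h • map N e x) t := ⟨(h, e, x), he, hx, rfl⟩
        have hF : F (h • map N e x) = ht.choose.1 • u ht.choose.2.1 ht.choose.2.2 := by
          simp only [F, if_neg (hnot h e x hx), dif_pos ht]
        rw [hF]
        exact (huniq _ _ _ he _ ht.choose_spec.1 _ hx _ ht.choose_spec.2.1
          ht.choose_spec.2.2).symm
    have hcov : ∀ y ∈ skeletonBelow Y (N + 1), y ∈ skeletonBelow Y N ∨
        ∃ h : H, ∃ e ∈ R, ∃ x ∈ ball 0 1, y = h • map N e x := by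
      rintro y ⟨m, hm, e, hy⟩
      rcases (Nat.lt_succ_iff.1 hm).lt_or_eq with hlt | rfl
      · exact Or.inl ⟨m, hlt, e, hy⟩
      · right
        obtain ⟨h, e', he', rfl⟩ := hR e
        have := hp h⁻¹ m _ _ hy
        rw [← hpmul, inv_mul_cancel, hpone] at this
        obtain ⟨x, hx, hxy⟩ := this
        exact ⟨h, e', he', x, hx, by rw [hxy, smul_inv_smul]⟩
    -- The action need not carry one characteristic map to another, only one open cell to another.
    -- Taking closures compares the closed cells as sets, which is enough to test continuity.
    have hclosed : ∀ e : cell (univ : Set Y) N, ∃ h : H, ∃ e' ∈ R, closedCell N e =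
        (fun x => h • (map N e' x : Y)) '' closedBall 0 1 := by
      intro e
      obtain ⟨h, e', he', rfl⟩ := hR e
      refine ⟨h, e', he', ?_⟩
      obtain ⟨e'', he''⟩ := hY.permutes h N e'
      have hee : p h N e' = e'' := hpt _ _ _ (hp h N e' _ (hmap0 e'))
        (he''.subset (mem_image_of_mem _ (hmap0 e')))
      have hcl := (Homeomorph.smul h).image_closure (openCell N e')
      rw [closure_openCell_eq_closedCell, closedCell, image_image] at hcl
      rw [hee, ← closure_openCell_eq_closedCell, ← he'']
      exact hcl.symm
    refine ⟨F, ?_, ?_, ?_⟩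
    · rw [continuousOn_iff_isClosed]
      refine fun t ht => ⟨F ⁻¹' t ∩ skeletonBelow Y (N + 1), ?_, by
        rw [inter_assoc, inter_self]⟩
      refine CWComplex.isClosed_of_disjoint_openCell_or_isClosed_inter_closedCell
        (C := (univ : Set Y)) (subset_univ _) fun n _ e => ?_
      rcases lt_trichotomy n N with hn | rfl | hn
      · right
        have hsub := closedCell_subset_skeletonBelow hn e
        have : F ⁻¹' t ∩ skeletonBelow Y (N + 1) ∩ closedCell n e =
            closedCell n e ∩ f ⁻¹' t := by
          ext y
          constructor
          · rintro ⟨⟨h1, -⟩, h2⟩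
            exact ⟨h2, by rw [mem_preimage, ← hFf y (hsub h2)]; exact h1⟩
          · rintro ⟨h2, h1⟩
            exact ⟨⟨by rw [mem_preimage, hFf y (hsub h2)]; exact h1,
              skeletonBelow_mono N.le_succ (hsub h2)⟩, h2⟩
        rw [this]
        exact (hf.mono hsub).preimage_isClosed_of_isClosed isClosed_closedCell ht
      · right
        obtain ⟨h, e', he', hcl⟩ := hclosed e
        have hcont : ContinuousOn (fun x => h • u e' x) (closedBall 0 1) := (hu e').const_smul h
        have : F ⁻¹' t ∩ skeletonBelow Y (n + 1) ∩ closedCell n e =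
            (fun x => h • (map n e' x : Y)) ''
              (closedBall 0 1 ∩ (fun x => h • u e' x) ⁻¹' t) := by
          ext y
          constructor
          · rintro ⟨⟨h1, -⟩, h2⟩
            rw [hcl] at h2
            obtain ⟨x, hx, rfl⟩ := h2
            refine ⟨x, ⟨hx, ?_⟩, rfl⟩
            rw [mem_preimage, ← hFu h e' he' x hx]
            exact h1
          · rintro ⟨x, ⟨hx, hxt⟩, rfl⟩
            have hmem : h • (map n e' x : Y) ∈ closedCell n e := by
              rw [hcl]; exact mem_image_of_mem _ hx
            refine ⟨⟨?_, closedCell_subset_skeletonBelow n.lt_succ_self e hmem⟩, hmem⟩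
            rw [mem_preimage, hFu h e' he' x hx]
            exact hxt
        rw [this]
        exact (((isCompact_closedBall _ _).of_isClosed_subset
          (hcont.preimage_isClosed_of_isClosed isClosed_closedBall ht)
          inter_subset_left).image_of_continuousOn
          (((continuousOn n e').const_smul h).mono inter_subset_left)).isClosed
      · left
        rw [disjoint_left]
        rintro y ⟨-, hy⟩
        exact notMem_openCell_of_mem_skeletonBelow hn hy
    · intro h y hy
      rcases hcov y hy with hy | ⟨g, e, he, x, hx, rfl⟩
      · rw [hFf y hy, hFf _ (hskY h hy), hfe h y hy]
      · have hx' := ball_subset_closedBall hx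
        rw [← mul_smul, hFu _ e he x hx', hFu _ e he x hx', mul_smul]
    · intro k hk
      rcases Nat.le_succ_iff.1 hk with hk | rfl
      · intro y hy
        rw [hFf y (skeletonBelow_mono hk hy)]
        exact hfk k hk hy
      · intro y hy
        rcases hcov y hy with hy | ⟨g, e, he, x, hx, rfl⟩
        · rw [hFf y hy]
          exact skeletonBelow_mono N.le_succ (hfk N le_rfl hy)
        · have hx' := ball_subset_closedBall hx
          rw [hFu _ e he x hx']
          exact hX g _ _ (hus e hx')

end EquivariantMap

/-! ### Induced spaces: actions twisted by a cocycle -/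

section Twisted

open Set Metric RelCWComplex

/-- A cocycle for an action of `Γ` on `ι` with values in `K`. -/
structure ActionCocycle (Γ ι K : Type u) [Group Γ] [Group K] [MulAction Γ ι] where
  /-- The values of the cocycle. -/
  toFun : Γ → ι → K
  map_one : ∀ v, toFun 1 v = 1
  map_mul : ∀ g h v, toFun (g * h) v = toFun g (h • v) * toFun h v

variable {Γ ι K : Type u} [Group Γ] [Group K] [MulAction Γ ι]

/-- Copies of `X` indexed by `ι`, with the action of `Γ` twisted by a cocycle. -/
def Twisted (_α : ActionCocycle Γ ι K) (X : Type u) : Type u := Σ _ : ι, X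

namespace Twisted

variable {α : ActionCocycle Γ ι K} {X : Type u}

instance [MulAction K X] : MulAction Γ (Twisted α X) where
  smul g z := ⟨g • z.1, α.toFun g z.1 • z.2⟩
  one_smul z := Sigma.ext (one_smul Γ z.1) (heq_of_eq (by
    change α.toFun 1 z.1 • z.2 = z.2
    rw [α.map_one, one_smul]))
  mul_smul g h z := Sigma.ext (mul_smul g h z.1) (heq_of_eq (by
    change α.toFun (g * h) z.1 • z.2 = α.toFun g (h • z.1) • α.toFun h z.1 • z.2
    rw [α.map_mul, mul_smul]))

/-- The point of a twisted product with given components. -/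
def mk (α : ActionCocycle Γ ι K) (v : ι) (x : X) : Twisted α X := ⟨v, x⟩

theorem smul_mk [MulAction K X] (g : Γ) (v : ι) (x : X) :
    g • mk α v x = mk α (g • v) (α.toFun g v • x) := rfl

theorem mk_injective (v : ι) : Function.Injective (mk α v : X → Twisted α X) :=
  @sigma_mk_injective ι (fun _ => X) v

variable [TopologicalSpace X]

instance : TopologicalSpace (Twisted α X) := inferInstanceAs (TopologicalSpace (Σ _ : ι, X))

instance [T2Space X] : T2Space (Twisted α X) := inferInstanceAs (T2Space (Σ _ : ι, X))

theorem continuous_mk (v : ι) : Continuous (mk α v : X → Twisted α X) :=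
  @continuous_sigmaMk ι (fun _ => X) _ v

theorem continuous_iff {Y : Type*} [TopologicalSpace Y] {f : Twisted α X → Y} :
    Continuous f ↔ ∀ v, Continuous fun x => f (mk α v x) := continuous_sigma_iff

theorem isClosed_iff {A : Set (Twisted α X)} : IsClosed A ↔ ∀ v, IsClosed (mk α v ⁻¹' A) :=
  isClosed_sigma_iff

instance [MulAction K X] [ContinuousConstSMul K X] : ContinuousConstSMul Γ (Twisted α X) :=
  ⟨fun g => continuous_iff.2 fun v => by
    simp only [smul_mk]
    exact (continuous_mk _).comp (continuous_const_smul _)⟩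

variable [T2Space X] [CWComplex (univ : Set X)]

/-- The cell structure of a twisted product. -/
def cellData (α : ActionCocycle Γ ι K) (X : Type u) [TopologicalSpace X] [T2Space X]
    [CWComplex (univ : Set X)] : CellData (Twisted α X) where
  cell k := ι × cell (univ : Set X) k
  map k e x := mk α e.1 (map k e.2 x)
  continuousOn k e := (continuous_mk _).comp_continuousOn (RelCWComplex.continuousOn k e.2)
  injOn k e x hx y hy h := (RelCWComplex.map k e.2).injOn (by rw [source_eq]; exact hx)
    (by rw [source_eq]; exact hy) (mk_injective _ h)
  disjoint := by
    rintro m n ⟨v, i⟩ ⟨w, j⟩ x hx y hy h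
    obtain rfl : v = w := congrArg Sigma.fst h
    have := cell_eq_of_mem (mem_image_of_mem (RelCWComplex.map m i) hx)
      (by rw [mk_injective _ h]; exact mem_image_of_mem (RelCWComplex.map n j) hy)
    simp only [Sigma.mk.injEq] at this
    obtain ⟨rfl, h⟩ := this
    rw [eq_of_heq h]
  frontier := by
    rintro n ⟨v, i⟩
    obtain ⟨J, hJ, hJn, hJi⟩ := cellFrontier_subset_finite n i
    refine ⟨(fun j : Σ m, cell (univ : Set X) m =>
      (⟨j.1, v, j.2⟩ : Σ m, ι × cell (univ : Set X) m)) '' J, hJ.image _, ?_, fun x hx => ?_⟩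
    · rintro _ ⟨j, hj, rfl⟩
      exact hJn j hj
    · obtain ⟨j, hj, y, hy, hyx⟩ := mem_iUnion₂.1 (hJi (mem_image_of_mem _ hx))
      exact ⟨_, mem_image_of_mem _ hj, y, hy, congrArg (mk α v) hyx⟩
  closed A hA := by
    refine isClosed_iff.2 fun v => isClosed_of_inter_closedCell fun n j => ?_
    convert (hA n (v, j)).preimage (continuous_mk v) using 1
    rw [preimage_inter]
    congr 1
    ext x
    constructor
    · rintro ⟨y, hy, rfl⟩
      exact ⟨y, hy, rfl⟩
    · rintro ⟨y, hy, h⟩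
      exact ⟨y, hy, mk_injective v h⟩
  surj := by
    rintro ⟨v, x⟩
    obtain ⟨n, i, y, hy, rfl⟩ := exists_mem_openCell x
    exact ⟨n, (v, i), y, hy, rfl⟩

noncomputable instance : CWComplex (univ : Set (Twisted α X)) := (cellData α X).toCWComplex

theorem mk_mem_openCell {v w : ι} {x : X} {k : ℕ} {e : cell (univ : Set X) k} :
    mk α w x ∈ openCell (C := (univ : Set (Twisted α X))) k ((v, e) : (cellData α X).cell k) ↔
      v = w ∧ x ∈ openCell k e := by
  constructor
  · rintro ⟨y, hy, h⟩
    obtain rfl : v = w := congrArg Sigma.fst h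
    exact ⟨rfl, y, hy, mk_injective v h⟩
  · rintro ⟨rfl, y, hy, rfl⟩
    exact ⟨y, hy, rfl⟩

theorem mk_mem_skeletonBelow {v : ι} {x : X} {n : ℕ} :
    mk α v x ∈ skeletonBelow (Twisted α X) n ↔ x ∈ skeletonBelow X n := by
  constructor
  · rintro ⟨m, hm, ⟨w, e⟩, he⟩
    exact ⟨m, hm, e, (mk_mem_openCell.1 he).2⟩
  · rintro ⟨m, hm, e, he⟩
    exact ⟨m, hm, _, mk_mem_openCell.2 ⟨rfl, he⟩⟩

/-- An element stabilizing a cell fixes its index, and then its cocycle value stabilizes a cell of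
`X`, so is trivial. For cocompactness, the stabilizer of each representative index realizes all of
`K`, so representatives in `T` and `S` combine. -/
theorem isFreeCocompactCellularAction [MulAction K X] [ContinuousConstSMul K X]
    (h : IsFreeCocompactCellularAction K X) (hfree : ∀ g v, g • v = v → α.toFun g v = 1 → g = 1)
    {T : Set ι} (hT : T.Finite) (hTv : ∀ v, ∃ t ∈ T, ∃ g : Γ, g • t = v)
    (hTα : ∀ t ∈ T, ∀ a, ∃ g : Γ, g • t = t ∧ α.toFun g t = a) :
    IsFreeCocompactCellularAction Γ (Twisted α X) := by
  obtain ⟨p, hp, hpf, S, hS, hSe⟩ := isFreeCocompactCellularAction_iff.1 h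
  refine isFreeCocompactCellularAction_iff.2
    ⟨fun g k e => (g • e.1, p (α.toFun g e.1) k e.2), ?_, ?_, ?_⟩
  · rintro g k ⟨v, e⟩ ⟨w, x⟩ hx
    obtain ⟨rfl, hx'⟩ := mk_mem_openCell.1 hx
    exact mk_mem_openCell.2 ⟨rfl, hp _ k e x hx'⟩
  · rintro g k ⟨v, e⟩ he
    obtain ⟨h1, h2⟩ := Prod.ext_iff.1 he
    exact hfree g v h1 (hpf _ k e h2)
  · refine ⟨(fun t : ι × Σ k, cell (univ : Set X) k =>
      (⟨t.2.1, t.1, t.2.2⟩ : Σ k, ι × cell (univ : Set X) k)) '' (T ×ˢ S), (hT.prod hS).image _, ?_⟩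
    rintro k ⟨v, e⟩
    obtain ⟨t, ht, g, rfl⟩ := hTv v
    obtain ⟨a, e', he', rfl⟩ := hSe k e
    -- The element `d` fixes `t` and corrects the cocycle so that `g * d` acts on the fibre over `t`
    -- by exactly `a`.
    obtain ⟨d, hd, hda⟩ := hTα t ht ((α.toFun g t)⁻¹ * a)
    refine ⟨g * d, (t, e'), ⟨(t, ⟨k, e'⟩), ⟨ht, he'⟩, rfl⟩, Prod.ext ?_ ?_⟩
    · change (g * d) • t = g • t
      rw [mul_smul, hd]
    · change p (α.toFun (g * d) t) k e' = p a k e'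
      rw [α.map_mul, hd, hda, mul_inv_cancel_left]

end Twisted

end Twisted

/-! ### The cocycle of a coset space -/

section CosetCocycle

variable {Γ K : Type u} [Group Γ] [Group K]

open Classical in
/-- A section of the projection to the cosets of a subgroup, normalized at the trivial coset. -/
noncomputable def cosetSection (S : Subgroup Γ) (c : Γ ⧸ S) : Γ := if c = (1 : Γ) then 1 else c.out

theorem mk_cosetSection (S : Subgroup Γ) (c : Γ ⧸ S) : ((cosetSection S c : Γ) : Γ ⧸ S) = c := by
  unfold cosetSection
  split_ifs with h
  · exact h.symm
  · exact QuotientGroup.out_eq' c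

theorem cosetSection_one (S : Subgroup Γ) : cosetSection S (1 : Γ) = 1 := if_pos rfl

variable (j : K →* Γ)

theorem cosetSection_smul_mem (g : Γ) (c : Γ ⧸ j.range) :
    ∃ a, j a = (cosetSection j.range (g • c))⁻¹ * (g * cosetSection j.range c) := by
  have h : ((cosetSection j.range (g • c) : Γ) : Γ ⧸ j.range) =
      ((g * cosetSection j.range c : Γ) : Γ ⧸ j.range) := by
    rw [mk_cosetSection, ← smul_eq_mul, ← MulAction.Quotient.smul_coe, mk_cosetSection]
  exact QuotientGroup.eq.1 h

variable {j}

/-- The cocycle on the cosets of the image of `j` describing the action induced from `K` to `Γ`. -/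
noncomputable def cosetCocycle (hj : Function.Injective j) :
    ActionCocycle Γ (Γ ⧸ j.range) K where
  toFun g c := (cosetSection_smul_mem j g c).choose
  map_one c := hj (by
    rw [(cosetSection_smul_mem j 1 c).choose_spec, one_smul, one_mul, inv_mul_cancel, map_one])
  map_mul g h c := hj (by
    rw [map_mul, (cosetSection_smul_mem j (g * h) c).choose_spec,
      (cosetSection_smul_mem j h c).choose_spec, (cosetSection_smul_mem j g (h • c)).choose_spec,
      mul_smul]
    group)

/-- The defining equation of the cocycle: it measures the failure of the section to be equivariant.
Injectivity of `j` makes it determine the value. -/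
theorem cosetSection_mul_cosetCocycle (hj : Function.Injective j) (g : Γ) (c : Γ ⧸ j.range) :
    cosetSection j.range (g • c) * j ((cosetCocycle hj).toFun g c) =
      g * cosetSection j.range c := by
  rw [show j ((cosetCocycle hj).toFun g c) = _ from (cosetSection_smul_mem j g c).choose_spec,
    mul_inv_cancel_left]

theorem smul_one_coset (c : Γ ⧸ j.range) :
    cosetSection j.range c • ((1 : Γ) : Γ ⧸ j.range) = c := by
  rw [MulAction.Quotient.smul_coe, smul_eq_mul, mul_one, mk_cosetSection]

theorem map_smul_one_coset (a : K) : j a • ((1 : Γ) : Γ ⧸ j.range) = (1 : Γ) := by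
  rw [MulAction.Quotient.smul_coe, smul_eq_mul, mul_one]
  exact QuotientGroup.eq.2 (by simp)

/-- Because the section takes the value `1` on the trivial coset, `K` acts on the fibre over that
coset by its original action, with no conjugation. -/
theorem cosetCocycle_map_one (hj : Function.Injective j) (a : K) :
    (cosetCocycle hj).toFun (j a) ((1 : Γ) : Γ ⧸ j.range) = a := hj (by
  have := cosetSection_mul_cosetCocycle hj (j a) ((1 : Γ) : Γ ⧸ j.range)
  rwa [map_smul_one_coset, cosetSection_one, one_mul, mul_one] at this)

theorem cosetCocycle_free (hj : Function.Injective j) (g : Γ) (c : Γ ⧸ j.range) (hc : g • c = c)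
    (h : (cosetCocycle hj).toFun g c = 1) : g = 1 := by
  have := cosetSection_mul_cosetCocycle hj g c
  rw [hc, h, map_one, mul_one] at this
  exact mul_eq_right.1 this.symm

end CosetCocycle

/-! ### The double mapping cylinder and its topology -/

section DoubleCylinderSection

open Set Metric

variable {A B : Type u} [TopologicalSpace A] [TopologicalSpace B]

/-- The double mapping cylinder of two maps `A → B`: the disjoint union of `B` and
`A × (0, 1)`, where the ends of `A × (0, 1)` are glued to `B` by the two maps. -/
def DoubleCylinder (_φ : Fin 2 → C(A, B)) : Type u := B ⊕ (A × Ioo (0 : ℝ) 1)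

namespace DoubleCylinder

variable (φ : Fin 2 → C(A, B))

/-- The inclusion of the base. -/
def base (b : B) : DoubleCylinder φ := Sum.inl b

/-- The inclusion of the open cylinder. -/
def inner (z : A × Ioo (0 : ℝ) 1) : DoubleCylinder φ := Sum.inr z

open Classical in
/-- The map from the infinite cylinder which collapses both ends to the base. -/
noncomputable def cyl (z : A × ℝ) : DoubleCylinder φ :=
  if h : z.2 ∈ Ioo (0 : ℝ) 1 then inner φ (z.1, ⟨z.2, h⟩)
  else base φ (φ (if z.2 ≤ 0 then 0 else 1) z.1)

/-- The quotient map onto the double mapping cylinder. -/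
noncomputable def proj : B ⊕ (A × ℝ) → DoubleCylinder φ := Sum.elim (base φ) (cyl φ)

/-- The parameter runs over all of `ℝ`, with both ends prolonged constantly, so that homotopies can
move it without leaving the domain. The underlying set is an explicit sum, so that points can be
compared by cases. -/
noncomputable instance : TopologicalSpace (DoubleCylinder φ) := .coinduced (proj φ) inferInstance

variable {φ}

theorem cyl_of_nonpos {a : A} {t : ℝ} (h : t ≤ 0) : cyl φ (a, t) = base φ (φ 0 a) := by
  rw [cyl, dif_neg (fun h' => h.not_gt h'.1), if_pos h]

theorem cyl_of_one_le {a : A} {t : ℝ} (h : 1 ≤ t) : cyl φ (a, t) = base φ (φ 1 a) := by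
  rw [cyl, dif_neg (fun h' => h.not_gt h'.2), if_neg (by simp only; linarith)]

theorem cyl_of_mem {a : A} {t : ℝ} (h : t ∈ Ioo (0 : ℝ) 1) :
    cyl φ (a, t) = inner φ (a, ⟨t, h⟩) := dif_pos h

theorem base_injective : Function.Injective (base φ) := Sum.inl_injective

theorem inner_injective : Function.Injective (inner φ) := Sum.inr_injective

theorem base_ne_inner (b : B) (z : A × Ioo (0 : ℝ) 1) : base φ b ≠ inner φ z := Sum.inl_ne_inr

theorem isQuotientMap_proj : IsQuotientMap (proj φ) :=
  ⟨⟨rfl⟩, by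
    rintro (b | ⟨a, t, ht⟩)
    · exact ⟨Sum.inl b, rfl⟩
    · exact ⟨Sum.inr (a, t), cyl_of_mem ht⟩⟩

theorem isOpen_iff {S : Set (DoubleCylinder φ)} :
    IsOpen S ↔ IsOpen (base φ ⁻¹' S) ∧ IsOpen (cyl φ ⁻¹' S) := by
  rw [← isQuotientMap_proj.isOpen_preimage, isOpen_sum_iff]; rfl

theorem isClosed_iff {S : Set (DoubleCylinder φ)} :
    IsClosed S ↔ IsClosed (base φ ⁻¹' S) ∧ IsClosed (cyl φ ⁻¹' S) := by
  rw [← isOpen_compl_iff, isOpen_iff, preimage_compl, preimage_compl, isOpen_compl_iff,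
    isOpen_compl_iff]

theorem continuous_iff {Z : Type*} [TopologicalSpace Z] {f : DoubleCylinder φ → Z} :
    Continuous f ↔ Continuous (f ∘ base φ) ∧ Continuous (f ∘ cyl φ) := by
  rw [isQuotientMap_proj.continuous_iff, continuous_sum_dom]; rfl

theorem continuous_base : Continuous (base φ) := (continuous_iff.1 continuous_id).1

theorem continuous_cyl : Continuous (cyl φ) := (continuous_iff.1 continuous_id).2

variable (φ) in
/-- The function on the double mapping cylinder given by functions on the base and the cylinder. -/
def lift {Z : Type*} (f : B → Z) (g : A × ℝ → Z) : DoubleCylinder φ → Z :=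
  Sum.elim f fun z => g (z.1, z.2)

theorem lift_base {Z : Type*} (f : B → Z) (g : A × ℝ → Z) (b : B) :
    lift φ f g (base φ b) = f b := rfl

theorem lift_inner {Z : Type*} (f : B → Z) (g : A × ℝ → Z) (z : A × Ioo (0 : ℝ) 1) :
    lift φ f g (inner φ z) = g (z.1, z.2) := rfl

theorem lift_cyl {Z : Type*} {f : B → Z} {g : A × ℝ → Z} (h0 : ∀ a t, t ≤ 0 → g (a, t) = f (φ 0 a))
    (h1 : ∀ a t, 1 ≤ t → g (a, t) = f (φ 1 a)) (z : A × ℝ) : lift φ f g (cyl φ z) = g z := by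
  obtain ⟨a, t⟩ := z
  rcases le_or_gt t 0 with h | h
  · rw [cyl_of_nonpos h, lift_base, h0 a t h]
  rcases le_or_gt 1 t with h' | h'
  · rw [cyl_of_one_le h', lift_base, h1 a t h']
  · rw [cyl_of_mem ⟨h, h'⟩, lift_inner]

theorem continuous_lift {Z : Type*} [TopologicalSpace Z] {f : B → Z} {g : A × ℝ → Z}
    (hf : Continuous f) (hg : Continuous g) (h0 : ∀ a t, t ≤ 0 → g (a, t) = f (φ 0 a))
    (h1 : ∀ a t, 1 ≤ t → g (a, t) = f (φ 1 a)) : Continuous (lift φ f g) :=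
  continuous_iff.2 ⟨hf, by
    rw [show lift φ f g ∘ cyl φ = g from funext (lift_cyl h0 h1)]; exact hg⟩

theorem isOpen_lift {f : B → Prop} {g : A × ℝ → Prop}
    (hf : IsOpen {b | f b}) (hg : IsOpen {z | g z}) (h0 : ∀ a t, t ≤ 0 → (g (a, t) ↔ f (φ 0 a)))
    (h1 : ∀ a t, 1 ≤ t → (g (a, t) ↔ f (φ 1 a))) : IsOpen {z | lift φ f g z} :=
  isOpen_iff.2 ⟨hf, by
    convert hg using 1
    ext z
    exact iff_of_eq (lift_cyl (fun a t h => propext (h0 a t h)) (fun a t h => propext (h1 a t h)) z)⟩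

theorem isOpenEmbedding_inner : IsOpenEmbedding (inner φ) := by
  refine .of_continuous_injective_isOpenMap ?_ inner_injective fun O hO => isOpen_iff.2 ⟨?_, ?_⟩
  · have : inner φ = cyl φ ∘ Prod.map id Subtype.val := by
      funext ⟨a, t, ht⟩
      exact (cyl_of_mem ht).symm
    rw [this]
    exact continuous_cyl.comp (continuous_id.prodMap continuous_subtype_val)
  · convert isOpen_empty
    ext b
    simp only [mem_preimage, mem_image, mem_empty_iff_false, iff_false]
    rintro ⟨z, -, h⟩
    exact base_ne_inner b z h.symm
  · have hop : IsOpenMap (Prod.map id Subtype.val : A × Ioo (0 : ℝ) 1 → A × ℝ) :=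
      IsOpenMap.id.prodMap isOpen_Ioo.isOpenMap_subtype_val
    convert hop O hO
    ext ⟨a, t⟩
    constructor
    · rintro ⟨z, hz, h⟩
      by_cases ht : t ∈ Ioo (0 : ℝ) 1
      · rw [cyl_of_mem ht] at h
        exact ⟨z, hz, by rw [inner_injective h]; rfl⟩
      · rw [cyl, dif_neg ht] at h
        exact absurd h.symm (base_ne_inner _ _)
    · rintro ⟨⟨a', t', ht'⟩, hz, h⟩
      obtain ⟨rfl, rfl⟩ := Prod.ext_iff.1 h
      exact ⟨_, hz, (cyl_of_mem ht').symm⟩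

theorem isClosedEmbedding_base : IsClosedEmbedding (base φ) := by
  refine .of_continuous_injective_isClosedMap continuous_base base_injective fun C hC =>
    isClosed_iff.2 ⟨by rwa [preimage_image_eq _ base_injective], ?_⟩
  have : cyl φ ⁻¹' (base φ '' C) =
      ({z : A × ℝ | z.2 ≤ 0} ∩ (fun z => φ 0 z.1) ⁻¹' C) ∪
        ({z : A × ℝ | 1 ≤ z.2} ∩ (fun z => φ 1 z.1) ⁻¹' C) := by
    ext ⟨a, t⟩
    rcases le_or_gt t 0 with h | h
    · rw [mem_preimage, cyl_of_nonpos h, base_injective.mem_set_image]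
      simp [h, (h.trans_lt one_pos).not_ge]
    rcases le_or_gt 1 t with h' | h'
    · rw [mem_preimage, cyl_of_one_le h', base_injective.mem_set_image]
      simp [h', h.not_ge]
    · rw [mem_preimage, cyl_of_mem ⟨h, h'⟩]
      simp only [mem_image, mem_union, mem_inter_iff, mem_ofPred_eq, h.not_ge, h'.not_ge, false_and,
        or_self, iff_false]
      rintro ⟨b, -, hb⟩
      exact base_ne_inner _ _ hb
  rw [this]
  exact ((isClosed_le continuous_snd continuous_const).inter
    (hC.preimage ((φ 0).continuous.comp continuous_fst))).union
    ((isClosed_le continuous_const continuous_snd).inter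
    (hC.preimage ((φ 1).continuous.comp continuous_fst)))

/-- A base point and an inner point are separated by the function `t * (1 - t)`, extended by `0`;
two base points by neighbourhoods thickened along half of each attached cylinder; two inner points
inside the open cylinder. -/
instance [T2Space A] [T2Space B] : T2Space (DoubleCylinder φ) := by
  have hbi : ∀ (b : B) (z : A × Ioo (0 : ℝ) 1), ∃ U V : Set (DoubleCylinder φ),
      IsOpen U ∧ IsOpen V ∧ base φ b ∈ U ∧ inner φ z ∈ V ∧ Disjoint U V := by
    rintro b ⟨a, t, ht⟩
    have hc : Continuous (lift φ (fun _ => (0 : ℝ)) fun z => max 0 (z.2 * (1 - z.2))) :=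
      continuous_lift continuous_const (by fun_prop)
        (fun a t h => max_eq_left (by nlinarith)) (fun a t h => max_eq_left (by nlinarith))
    refine separated_by_continuous hc ?_
    rw [lift_base, lift_inner]
    have : 0 < t * (1 - t) := mul_pos ht.1 (by linarith [ht.2])
    exact (lt_max_of_lt_right this).ne
  refine ⟨fun x y hxy => ?_⟩
  rcases x with b | z <;> rcases y with b' | z'
  · obtain ⟨U, V, hU, hV, hb, hb', hUV⟩ := t2_separation fun h : b = b' => hxy (by rw [h])
    have key : ∀ U : Set B, IsOpen U → IsOpen {z | lift φ (· ∈ U) (fun z =>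
        (z.2 < 1 / 2 ∧ φ 0 z.1 ∈ U) ∨ (1 / 2 < z.2 ∧ φ 1 z.1 ∈ U)) z} := by
      intro U hU
      refine isOpen_lift hU ?_ (fun a t h => ?_) (fun a t h => ?_)
      · exact ((isOpen_lt continuous_snd continuous_const).inter
          (hU.preimage ((φ 0).continuous.comp continuous_fst))).union
          ((isOpen_lt continuous_const continuous_snd).inter
          (hU.preimage ((φ 1).continuous.comp continuous_fst)))
      · simp only
        constructor
        · rintro (h' | h')
          · exact h'.2
          · linarith [h'.1]
        · exact fun h' => Or.inl ⟨by linarith, h'⟩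
      · simp only
        constructor
        · rintro (h' | h')
          · linarith [h'.1]
          · exact h'.2
        · exact fun h' => Or.inr ⟨by linarith, h'⟩
    refine ⟨_, _, key U hU, key V hV, hb, hb', disjoint_left.2 ?_⟩
    rintro (c | ⟨a, t⟩)
    · exact fun h h' => disjoint_left.1 hUV h h'
    · rintro (⟨h1, h2⟩ | ⟨h1, h2⟩) (⟨h3, h4⟩ | ⟨h3, h4⟩)
      · exact disjoint_left.1 hUV h2 h4
      · simp only at h1 h3; linarith
      · simp only at h1 h3; linarith
      · exact disjoint_left.1 hUV h2 h4
  · exact hbi b z'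
  · obtain ⟨U, V, hU, hV, h1, h2, h3⟩ := hbi b' z
    exact ⟨V, U, hV, hU, h2, h1, h3.symm⟩
  · obtain ⟨U, V, hU, hV, hz, hz', hUV⟩ := t2_separation fun h : z = z' => hxy (by rw [h])
    exact ⟨_, _, isOpenEmbedding_inner.isOpenMap U hU, isOpenEmbedding_inner.isOpenMap V hV,
      mem_image_of_mem (inner φ) hz, mem_image_of_mem (inner φ) hz',
      disjoint_image_of_injective inner_injective hUV⟩

section Action

variable {Γ : Type u} [Group Γ] [MulAction Γ A] [MulAction Γ B]

instance : MulAction Γ (DoubleCylinder φ) where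
  smul g := Sum.map (g • ·) (Prod.map (g • ·) id)
  one_smul := by
    rintro (b | ⟨a, t⟩)
    · exact congrArg Sum.inl (one_smul Γ b)
    · exact congrArg Sum.inr (Prod.ext (one_smul Γ a) rfl)
  mul_smul := by
    rintro g h (b | ⟨a, t⟩)
    · exact congrArg Sum.inl (mul_smul g h b)
    · exact congrArg Sum.inr (Prod.ext (mul_smul g h a) rfl)

theorem smul_base (g : Γ) (b : B) : g • base φ b = base φ (g • b) := rfl

theorem smul_inner (g : Γ) (z : A × Ioo (0 : ℝ) 1) : g • inner φ z = inner φ (g • z.1, z.2) := rfl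

theorem smul_cyl (hφ : ∀ i (g : Γ) a, φ i (g • a) = g • φ i a) (g : Γ) (z : A × ℝ) :
    g • cyl φ z = cyl φ (g • z.1, z.2) := by
  unfold cyl
  split_ifs with h
  · rfl
  · rw [smul_base, hφ]
  · rw [smul_base, hφ]

theorem continuousConstSMul [ContinuousConstSMul Γ A] [ContinuousConstSMul Γ B]
    (hφ : ∀ i (g : Γ) a, φ i (g • a) = g • φ i a) : ContinuousConstSMul Γ (DoubleCylinder φ) := by
  refine ⟨fun g => continuous_iff.2
    ⟨continuous_base.comp (continuous_const_smul g), ?_⟩⟩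
  have : (fun z => g • z) ∘ cyl φ = cyl φ ∘ Prod.map (g • ·) id := funext (smul_cyl hφ g)
  rw [this]
  exact continuous_cyl.comp ((continuous_const_smul g).prodMap continuous_id)

end Action

end DoubleCylinder

end DoubleCylinderSection

/-! ### Cells of the double mapping cylinder -/

section DoubleCylinderCells

open Set Metric RelCWComplex

theorem mem_ball_succ {k : ℕ} {x : Fin (k + 1) → ℝ} :
    x ∈ ball 0 1 ↔ |x 0| < 1 ∧ Fin.tail x ∈ ball 0 1 := by
  rw [mem_unitBall_pi, mem_unitBall_pi, Fin.forall_fin_succ]; rfl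

theorem mem_closedBall_succ {k : ℕ} {x : Fin (k + 1) → ℝ} :
    x ∈ closedBall 0 1 ↔ |x 0| ≤ 1 ∧ Fin.tail x ∈ closedBall 0 1 := by
  rw [mem_unitClosedBall_pi, mem_unitClosedBall_pi, Fin.forall_fin_succ]; rfl

theorem continuous_fin_tail {k : ℕ} : Continuous (Fin.tail : (Fin (k + 1) → ℝ) → Fin k → ℝ) := by
  unfold Fin.tail; fun_prop

/-- Closedness in the cylinder over a CW complex can be tested on closed cells. -/
theorem isClosed_inter_prod_Icc {A : Type u} [TopologicalSpace A] [T2Space A]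
    [CWComplex (univ : Set A)] {T : Set (A × ℝ)}
    (h : ∀ n (j : cell (univ : Set A) n), IsClosed (T ∩ closedCell n j ×ˢ Icc 0 1)) :
    IsClosed (T ∩ univ ×ˢ Icc 0 1) := by
  rw [← isOpen_compl_iff, isOpen_iff_mem_nhds]
  rintro ⟨a, t⟩ hat
  obtain ⟨n, e, he⟩ := exists_mem_openCell a
  have hsl : (fun s => (a, s)) ⁻¹' (T ∩ univ ×ˢ Icc 0 1) =
      (fun s => (a, s)) ⁻¹' (T ∩ closedCell n e ×ˢ Icc 0 1) := by
    ext s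
    have := openCell_subset_closedCell n e he
    simp [this]
  have hslc : IsClosed ((fun s => (a, s)) ⁻¹' (T ∩ univ ×ˢ Icc 0 1)) := by
    rw [hsl]; exact (h n e).preimage (by fun_prop)
  -- A compact interval around `t` misses the slice over `a`. The points over which `T` meets this
  -- interval within `[0, 1]` form, in each closed cell, the projection of a compact set; hence they
  -- form a closed set, which avoids `a`.
  obtain ⟨ε, hε, hεt⟩ := nhds_basis_closedBall.mem_iff.1 (hslc.isOpen_compl.mem_nhds hat)
  have hV : IsClosed (Prod.fst '' (T ∩ univ ×ˢ Icc 0 1 ∩ univ ×ˢ closedBall t ε)) := by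
    refine isClosed_of_inter_closedCell fun m j => ?_
    have : Prod.fst '' (T ∩ univ ×ˢ Icc 0 1 ∩ univ ×ˢ closedBall t ε) ∩ closedCell m j =
        Prod.fst '' (T ∩ closedCell m j ×ˢ Icc 0 1 ∩ univ ×ˢ closedBall t ε) := by
      ext x
      constructor
      · rintro ⟨⟨⟨y, s⟩, ⟨⟨h1, -, h2⟩, h3⟩, rfl⟩, hx⟩
        exact ⟨(y, s), ⟨⟨h1, hx, h2⟩, h3⟩, rfl⟩
      · rintro ⟨⟨y, s⟩, ⟨⟨h1, hx, h2⟩, h3⟩, rfl⟩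
        exact ⟨⟨(y, s), ⟨⟨h1, trivial, h2⟩, h3⟩, rfl⟩, hx⟩
    rw [this]
    exact (((isCompact_closedCell.prod isCompact_Icc).of_isClosed_subset (h m j)
      inter_subset_right).inter_right (isClosed_univ.prod isClosed_closedBall)).image
      continuous_fst |>.isClosed
  have ha : a ∉ Prod.fst '' (T ∩ univ ×ˢ Icc 0 1 ∩ univ ×ˢ closedBall t ε) := by
    rintro ⟨⟨y, s⟩, ⟨h1, -, h2⟩, rfl⟩
    exact hεt h2 h1
  filter_upwards [prod_mem_nhds (hV.isOpen_compl.mem_nhds ha) (closedBall_mem_nhds t hε)]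
  rintro ⟨y, s⟩ ⟨h1, h2⟩ h3
  exact h1 ⟨(y, s), ⟨h3, trivial, h2⟩, rfl⟩

theorem injOn_map {A : Type u} [TopologicalSpace A] [CWComplex (univ : Set A)] {k : ℕ}
    (e : cell (univ : Set A) k) : InjOn (map k e) (ball 0 1) := by
  rw [← source_eq k e]; exact (map k e).injOn

theorem DoubleCylinder.base_mem_image {A B : Type u} [TopologicalSpace A] [TopologicalSpace B]
    [CWComplex (univ : Set B)] {φ : Fin 2 → C(A, B)} {b : B} {k : ℕ} {e : cell (univ : Set B) k} :
    DoubleCylinder.base φ b ∈ (fun x => DoubleCylinder.base φ (map k e x)) '' ball 0 1 ↔ b ∈ openCell k e :=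
  ⟨fun ⟨x, hx, h⟩ => ⟨x, hx, DoubleCylinder.base_injective h⟩, fun ⟨x, hx, h⟩ => ⟨x, hx, congrArg _ h⟩⟩

namespace DoubleCylinder

variable {A B : Type u} [TopologicalSpace A] [TopologicalSpace B] [CWComplex (univ : Set A)]

variable (A) in
/-- The cells of the open cylinder over a complex. -/
def CylCell : ℕ → Type u
  | 0 => PEmpty
  | k + 1 => cell (univ : Set A) k

/-- The characteristic maps of the cells of the cylinder. -/
noncomputable def cylMap (φ : Fin 2 → C(A, B)) :
    ∀ k, CylCell A k → (Fin k → ℝ) → DoubleCylinder φ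
  | 0 => fun e => e.elim
  | k + 1 => fun e x => cyl φ (RelCWComplex.map k (e : cell (univ : Set A) k) (Fin.tail x),
      (1 + x 0) / 2)

variable {φ : Fin 2 → C(A, B)}

theorem mem_cylMap_image {z : DoubleCylinder φ} {k : ℕ} {e : cell (univ : Set A) k} :
    z ∈ cylMap φ (k + 1) e '' ball 0 1 ↔ ∃ y, z = inner φ y ∧ y.1 ∈ openCell k e := by
  constructor
  · rintro ⟨x, hx, rfl⟩
    obtain ⟨h0, ht⟩ := mem_ball_succ.1 hx
    rw [abs_lt] at h0
    exact ⟨_, cyl_of_mem ⟨by linarith, by linarith⟩, mem_image_of_mem _ ht⟩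
  · rintro ⟨⟨a, t, ht⟩, rfl, y, hy, rfl⟩
    refine ⟨Fin.cons (2 * t - 1) y, mem_ball_succ.2 ⟨?_, by simpa using hy⟩, ?_⟩
    · rw [Fin.cons_zero, abs_lt]; constructor <;> linarith [ht.1, ht.2]
    · simp only [cylMap, Fin.tail_cons, Fin.cons_zero]
      rw [show (1 + (2 * t - 1)) / 2 = t by ring, cyl_of_mem ht]

theorem cylMap_image_closedBall {k : ℕ} {e : cell (univ : Set A) k} :
    cylMap φ (k + 1) e '' closedBall 0 1 = cyl φ '' (closedCell k e ×ˢ Icc 0 1) := by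
  ext z
  constructor
  · rintro ⟨x, hx, rfl⟩
    obtain ⟨h0, ht⟩ := mem_closedBall_succ.1 hx
    rw [abs_le] at h0
    exact ⟨_, ⟨mem_image_of_mem _ ht, by simp only; constructor <;> linarith⟩, rfl⟩
  · rintro ⟨⟨_, t⟩, ⟨⟨y, hy, rfl⟩, ht⟩, rfl⟩
    refine ⟨Fin.cons (2 * t - 1) y, mem_closedBall_succ.2 ⟨?_, by simpa using hy⟩, ?_⟩
    · rw [Fin.cons_zero, abs_le]; simp only at ht; constructor <;> linarith [ht.1, ht.2]
    · simp only [cylMap, Fin.tail_cons, Fin.cons_zero]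
      rw [show (1 + (2 * t - 1)) / 2 = t by ring]

variable [T2Space A] [T2Space B] [CWComplex (univ : Set B)]

/-- The cell structure of the double mapping cylinder of two cellular maps. -/
noncomputable def cellData (hφ : ∀ i n, MapsTo (φ i) (skeletonBelow A n) (skeletonBelow B n)) :
    CellData (DoubleCylinder φ) where
  cell k := cell (univ : Set B) k ⊕ CylCell A k
  map k := Sum.elim (fun e x => base φ (map k e x)) (cylMap φ k)
  continuousOn := by
    rintro k (e | e)
    · exact continuous_base.comp_continuousOn (RelCWComplex.continuousOn k e)
    · rcases k with _ | k
      · exact e.elim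
      · exact continuous_cyl.comp_continuousOn
          (((RelCWComplex.continuousOn k (e : cell (univ : Set A) k)).comp
            continuous_fin_tail.continuousOn fun x hx => (mem_closedBall_succ.1 hx).2).prodMk
            (by fun_prop))
  injOn := by
    rintro k (e | e) x hx y hy h
    · exact (RelCWComplex.map k e).injOn (by rw [source_eq]; exact hx) (by rw [source_eq]; exact hy)
        (base_injective h)
    · rcases k with _ | k
      · exact e.elim
      · obtain ⟨hx0, hxt⟩ := mem_ball_succ.1 hx
        obtain ⟨hy0, hyt⟩ := mem_ball_succ.1 hy
        rw [abs_lt] at hx0 hy0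
        simp only [Sum.elim_inr, cylMap] at h
        rw [cyl_of_mem ⟨by linarith, by linarith⟩, cyl_of_mem ⟨by linarith, by linarith⟩] at h
        obtain ⟨h1, h2⟩ := Prod.ext_iff.1 (inner_injective h)
        have h3 : Fin.tail x = Fin.tail y :=
          injOn_map (e : cell (univ : Set A) k) hxt hyt h1
        have h4 : x 0 = y 0 := by
          have := Subtype.ext_iff.1 h2
          simp only at this
          linarith
        rw [← Fin.cons_self_tail x, ← Fin.cons_self_tail y, h3, h4]
  disjoint := by
    rintro m n (i | i) (j | j) x hx y hy h
    · have := cell_eq_of_mem (mem_image_of_mem (RelCWComplex.map m i) hx)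
        (by rw [base_injective h]; exact mem_image_of_mem (RelCWComplex.map n j) hy)
      simp only [Sigma.mk.injEq] at this
      obtain ⟨rfl, h⟩ := this
      rw [eq_of_heq h]
    · rcases n with _ | n
      · exact j.elim
      · obtain ⟨z, hz, -⟩ := mem_cylMap_image.1 (mem_image_of_mem (cylMap φ (n + 1) j) hy)
        exact absurd (h.trans hz) (base_ne_inner _ _)
    · rcases m with _ | m
      · exact i.elim
      · obtain ⟨z, hz, -⟩ := mem_cylMap_image.1 (mem_image_of_mem (cylMap φ (m + 1) i) hx)
        exact absurd (h.symm.trans hz) (base_ne_inner _ _)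
    · rcases m with _ | m
      · exact i.elim
      rcases n with _ | n
      · exact j.elim
      obtain ⟨z, hz, hzi⟩ := mem_cylMap_image.1 (mem_image_of_mem (cylMap φ (m + 1) i) hx)
      obtain ⟨w, hw, hwj⟩ := mem_cylMap_image.1 (mem_image_of_mem (cylMap φ (n + 1) j) hy)
      have hzw : z = w := inner_injective (hz.symm.trans (h.trans hw))
      obtain ⟨rfl, h⟩ := Sigma.mk.inj_iff.1 (cell_eq_of_mem hzi (by rw [hzw]; exact hwj))
      rw [eq_of_heq h]
  frontier := by
    rintro n (i | i)
    · obtain ⟨J, hJ, hJn, hJi⟩ := cellFrontier_subset_finite n i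
      refine ⟨(fun j : Σ m, cell (univ : Set B) m =>
        (⟨j.1, Sum.inl j.2⟩ : Σ m, cell (univ : Set B) m ⊕ CylCell A m)) '' J, hJ.image _, ?_,
        fun x hx => ?_⟩
      · rintro _ ⟨j, hj, rfl⟩
        exact hJn j hj
      · obtain ⟨j, hj, hx⟩ := mem_iUnion₂.1 (hJi (mem_image_of_mem _ hx))
        exact ⟨_, mem_image_of_mem _ hj, base_mem_image.2 hx⟩
    · rcases n with _ | k
      · exact i.elim
      let e : cell (univ : Set A) k := i
      -- Cellularity of the attaching maps enters here: the ends of the `(k + 1)`-cell over `e` land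
      -- in cells of dimension at most `k`, finitely many by compactness.
      have hB : ∀ i, ∃ J : Set (Σ m, cell (univ : Set B) m), J.Finite ∧ (∀ j ∈ J, j.1 < k + 1) ∧
          ∀ a ∈ closedCell k e, ∃ j ∈ J, φ i a ∈ openCell j.1 j.2 := by
        intro i
        refine ⟨_, (isCompact_closedCell.image (φ i).continuous).finite_openCells (K :=
          φ i '' closedCell k e), ?_, fun a ha => ?_⟩
        · rintro j ⟨_, hx, a, ha, rfl⟩
          by_contra! hj
          exact notMem_openCell_of_mem_skeletonBelow hj
            (hφ i _ (closedCell_subset_skeletonBelow k.lt_succ_self e ha)) hx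
        · obtain ⟨n, j, hj⟩ := exists_mem_openCell (φ i a)
          exact ⟨⟨n, j⟩, ⟨_, hj, mem_image_of_mem _ ha⟩, hj⟩
      choose JB hJB hJBk hJBe using hB
      obtain ⟨JA, hJA, hJAk, hJAe⟩ := cellFrontier_subset_finite k e
      refine ⟨(⋃ i, (fun j : Σ m, cell (univ : Set B) m =>
        (⟨j.1, Sum.inl j.2⟩ : Σ m, cell (univ : Set B) m ⊕ CylCell A m)) '' JB i) ∪
        (fun j : Σ m, cell (univ : Set A) m =>
        (⟨j.1 + 1, Sum.inr j.2⟩ : Σ m, cell (univ : Set B) m ⊕ CylCell A m)) '' JA,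
        (finite_iUnion fun i => (hJB i).image _).union (hJA.image _), ?_, fun x hx => ?_⟩
      · rintro _ (hj | ⟨j, hj, rfl⟩)
        · obtain ⟨i, j, hj', rfl⟩ := mem_iUnion.1 hj
          exact hJBk i j hj'
        · exact Nat.succ_lt_succ (hJAk j hj)
      · obtain ⟨hx0, hxt⟩ := mem_closedBall_succ.1 (sphere_subset_closedBall hx)
        rw [abs_le] at hx0
        have hbase : ∀ i, ∀ a ∈ closedCell k e, cylMap φ (k + 1) e x = base φ (φ i a) →
            ∃ j ∈ (⋃ i, (fun j : Σ m, cell (univ : Set B) m =>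
            (⟨j.1, Sum.inl j.2⟩ : Σ m, cell (univ : Set B) m ⊕ CylCell A m)) '' JB i) ∪
            (fun j : Σ m, cell (univ : Set A) m =>
            (⟨j.1 + 1, Sum.inr j.2⟩ : Σ m, cell (univ : Set B) m ⊕ CylCell A m)) '' JA,
            cylMap φ (k + 1) e x ∈ Sum.elim (fun e x => base φ (map j.1 e x)) (cylMap φ j.1) j.2 ''
              ball 0 1 := by
          intro i a ha h
          obtain ⟨j, hj, hja⟩ := hJBe i a ha
          exact ⟨_, Or.inl (mem_iUnion.2 ⟨i, mem_image_of_mem _ hj⟩), by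
            rw [h]; exact base_mem_image.2 hja⟩
        -- The boundary of the cube consists of the bottom, the top, and the sides, which lie over
        -- the frontier of `e`.
        rcases hx0.1.eq_or_lt with h0 | h0
        · exact hbase 0 _ (mem_image_of_mem _ hxt) (cyl_of_nonpos (by linarith))
        rcases hx0.2.eq_or_lt with h1 | h1
        · exact hbase 1 _ (mem_image_of_mem _ hxt) (cyl_of_one_le (by linarith))
        have hts : Fin.tail x ∈ sphere (0 : Fin k → ℝ) 1 := by
          rw [← sphere_union_ball] at hxt
          exact hxt.resolve_right fun h => disjoint_left.1 sphere_disjoint_ball hx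
            (mem_ball_succ.2 ⟨abs_lt.2 ⟨h0, h1⟩, h⟩)
        obtain ⟨j, hj, hjx⟩ := mem_iUnion₂.1 (hJAe (mem_image_of_mem _ hts))
        exact ⟨_, Or.inr (mem_image_of_mem _ hj), mem_cylMap_image.2
          ⟨_, cyl_of_mem ⟨by linarith, by linarith⟩, hjx⟩⟩
  closed S hS := by
    have hB : IsClosed (base φ ⁻¹' S) := by
      refine isClosed_of_inter_closedCell fun n j => ?_
      convert (hS n (Sum.inl j)).preimage continuous_base using 1
      rw [preimage_inter]
      congr 1
      ext b
      exact ⟨fun ⟨x, hx, h⟩ => ⟨x, hx, congrArg _ h⟩, fun ⟨x, hx, h⟩ => ⟨x, hx, base_injective h⟩⟩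
    refine isClosed_iff.2 ⟨hB, ?_⟩
    have h1 : IsClosed (cyl φ ⁻¹' S ∩ univ ×ˢ Icc 0 1) := by
      refine isClosed_inter_prod_Icc fun n j => ?_
      have h2 := (hS (n + 1) (Sum.inr j)).preimage continuous_cyl
      change IsClosed (cyl φ ⁻¹' (S ∩ cylMap φ (n + 1) j '' closedBall 0 1)) at h2
      rw [cylMap_image_closedBall] at h2
      convert h2.inter ((isClosed_closedCell (i := j)).prod isClosed_Icc) using 1
      ext z
      exact ⟨fun ⟨hz, hz'⟩ => ⟨⟨hz, mem_image_of_mem _ hz'⟩, hz'⟩, fun ⟨⟨hz, _⟩, hz'⟩ => ⟨hz, hz'⟩⟩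
    have h2 : cyl φ ⁻¹' S = (cyl φ ⁻¹' S ∩ univ ×ˢ Icc 0 1) ∪
        (({z : A × ℝ | z.2 ≤ 0} ∩ (fun z => φ 0 z.1) ⁻¹' (base φ ⁻¹' S)) ∪
        ({z : A × ℝ | 1 ≤ z.2} ∩ (fun z => φ 1 z.1) ⁻¹' (base φ ⁻¹' S))) := by
      ext ⟨a, t⟩
      rcases le_or_gt t 0 with h | h
      · simp only [mem_preimage, mem_union, mem_inter_iff, mem_ofPred_eq, cyl_of_nonpos h]
        have : ¬ 1 ≤ t := by linarith
        simp only [h, this, true_and, false_and, or_false]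
        tauto
      rcases le_or_gt 1 t with h' | h'
      · simp only [mem_preimage, mem_union, mem_inter_iff, mem_ofPred_eq, cyl_of_one_le h']
        simp only [h', h.not_ge, true_and, false_and, false_or]
        tauto
      · simp [h.not_ge, h'.not_ge, h.le, h'.le]
    rw [h2]
    exact h1.union (((isClosed_le continuous_snd continuous_const).inter
      (hB.preimage ((φ 0).continuous.comp continuous_fst))).union
      ((isClosed_le continuous_const continuous_snd).inter
      (hB.preimage ((φ 1).continuous.comp continuous_fst))))
  surj := by
    rintro (b | z)
    · obtain ⟨n, e, he⟩ := exists_mem_openCell b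
      exact ⟨n, Sum.inl e, base_mem_image.2 he⟩
    · obtain ⟨n, e, he⟩ := exists_mem_openCell z.1
      exact ⟨n + 1, Sum.inr e, mem_cylMap_image.2 ⟨z, rfl, he⟩⟩

/-- The double mapping cylinder of two equivariant cellular maps of free cocompact complexes is
a free cocompact complex. -/
theorem isFreeCocompactCellularAction {Γ : Type u} [Group Γ] [MulAction Γ A] [MulAction Γ B]
    [ContinuousConstSMul Γ A] [ContinuousConstSMul Γ B]
    (hA : IsFreeCocompactCellularAction Γ A) (hB : IsFreeCocompactCellularAction Γ B)
    (hφ : ∀ i n, MapsTo (φ i) (skeletonBelow A n) (skeletonBelow B n))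
    [ContinuousConstSMul Γ (DoubleCylinder φ)] :
    @IsFreeCocompactCellularAction Γ _ (DoubleCylinder φ) _ (cellData hφ).toCWComplex _ _ := by
  let _ : CWComplex (univ : Set (DoubleCylinder φ)) := (cellData hφ).toCWComplex
  obtain ⟨p, hp, hpf, S, hS, hSe⟩ := isFreeCocompactCellularAction_iff.1 hA
  obtain ⟨q, hq, hqf, T, hT, hTe⟩ := isFreeCocompactCellularAction_iff.1 hB
  let r : Γ → ∀ k, CylCell A k → CylCell A k := fun g k =>
    match k with
    | 0 => id
    | k + 1 => p g k
  refine isFreeCocompactCellularAction_iff.2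
    ⟨fun g k => Sum.map (q g k) (r g k), ?_, ?_, ?_⟩
  · rintro g k (e | e) z hz
    · obtain ⟨x, hx, rfl⟩ := hz
      exact base_mem_image.2 (hq g k e _ (mem_image_of_mem _ hx))
    · rcases k with _ | k
      · exact e.elim
      · obtain ⟨y, rfl, hy⟩ := mem_cylMap_image.1 hz
        exact mem_cylMap_image.2 ⟨_, smul_inner g y, hp g k e _ hy⟩
  · rintro g k (e | e) h
    · exact hqf g k e (Sum.inl_injective h)
    · rcases k with _ | k
      · exact e.elim
      · exact hpf g k e (Sum.inr_injective h)
  · refine ⟨(fun j : Σ m, cell (univ : Set B) m =>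
      (⟨j.1, Sum.inl j.2⟩ : Σ m, cell (univ : Set B) m ⊕ CylCell A m)) '' T ∪
      (fun j : Σ m, cell (univ : Set A) m =>
      (⟨j.1 + 1, Sum.inr j.2⟩ : Σ m, cell (univ : Set B) m ⊕ CylCell A m)) '' S,
      (hT.image _).union (hS.image _), ?_⟩
    rintro k (e | e)
    · obtain ⟨g, e', he', rfl⟩ := hTe k e
      exact ⟨g, Sum.inl e', Or.inl ⟨_, he', rfl⟩, rfl⟩
    · rcases k with _ | k
      · exact e.elim
      · obtain ⟨g, e', he', h⟩ := hSe k e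
        exact ⟨g, Sum.inr e', Or.inr ⟨_, he', rfl⟩, congrArg Sum.inr h⟩

end DoubleCylinder

end DoubleCylinderCells

/-! ### Trees of highly connected spaces -/

section TreeOfSpaces

open Set Metric

variable {A B : Type u} [TopologicalSpace A] [TopologicalSpace B] {φ : Fin 2 → C(A, B)}

namespace DoubleCylinder

/-- A ray of parameters around one end of the cylinder, and away from the other end. -/
def endRay : Fin 2 → Set ℝ := ![Iio (2 / 3), Ioi (1 / 3)]

/-- The neighbourhood of a subset of the base consisting of this subset and parts of the
cylinders attached to it along their `i`-th end. -/
def star (φ : Fin 2 → C(A, B)) (i : Fin 2) (C : Set B) : Set (DoubleCylinder φ) :=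
  {z | lift φ (· ∈ C) (fun z => φ i z.1 ∈ C ∧ z.2 ∈ endRay i) z}

/-- The compatibility conditions for `lift`: near the `i`-th end the ray imposes nothing, while the
other end is excluded by the ray on one side and by the hypothesis on `C` on the other. -/
theorem star_aux {i : Fin 2} {C : Set B} (hC : ∀ j ≠ i, ∀ a, φ j a ∉ C) :
    (∀ a t, t ≤ 0 → ((φ i a ∈ C ∧ t ∈ endRay i) ↔ φ 0 a ∈ C)) ∧
      ∀ a t, 1 ≤ t → ((φ i a ∈ C ∧ t ∈ endRay i) ↔ φ 1 a ∈ C) := by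
  fin_cases i
  · refine ⟨fun a t h => and_iff_left ?_, fun a t h => iff_of_false ?_ (hC 1 (by decide) a)⟩
    · change t < 2 / 3
      linarith
    · rintro ⟨-, h'⟩
      change t < 2 / 3 at h'
      linarith
  · refine ⟨fun a t h => iff_of_false ?_ (hC 0 (by decide) a), fun a t h => and_iff_left ?_⟩
    · rintro ⟨-, h'⟩
      change 1 / 3 < t at h'
      linarith
    · change 1 / 3 < t
      linarith

theorem cyl_mem_star {i : Fin 2} {C : Set B} (hC : ∀ j ≠ i, ∀ a, φ j a ∉ C) {z : A × ℝ} :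
    cyl φ z ∈ star φ i C ↔ φ i z.1 ∈ C ∧ z.2 ∈ endRay i :=
  iff_of_eq (lift_cyl (f := (· ∈ C)) (g := fun z => φ i z.1 ∈ C ∧ z.2 ∈ endRay i)
    (fun a t h => propext ((star_aux hC).1 a t h))
    (fun a t h => propext ((star_aux hC).2 a t h)) z)

theorem isOpen_star {i : Fin 2} {C : Set B} (hC : ∀ j ≠ i, ∀ a, φ j a ∉ C) (hCo : IsOpen C) :
    IsOpen (star φ i C) := by
  refine isOpen_lift hCo ?_ (star_aux hC).1 (star_aux hC).2
  refine (hCo.preimage ((φ i).continuous.comp continuous_fst)).inter (.preimage continuous_snd ?_)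
  fin_cases i
  · exact isOpen_Iio
  · exact isOpen_Ioi

/-- A homotopy of the parameter of the cylinder, starting at the identity up to the
identifications, and moving a ray to its end. -/
noncomputable def endHomotopy : Fin 2 → ℝ → ℝ → ℝ :=
  ![fun s t => max ((1 - max 0 (min s 1)) * t) (3 * t - 2),
    fun s t => 1 - max ((1 - max 0 (min s 1)) * (1 - t)) (3 * (1 - t) - 2)]

/-- The first term contracts the parameter to `0` as `s` goes from `0` to `1`. The second is
negative below `2 / 3`, so does not interfere there, and is at least `1` from `t = 1` on, which
holds the far end in place. The other end is the mirror image under `t ↦ 1 - t`. -/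
theorem endHomotopy_aux (s t : ℝ) :
    let m := max ((1 - max 0 (min s 1)) * t) (3 * t - 2)
    (t ≤ 0 → m ≤ 0) ∧ (1 ≤ t → 1 ≤ m) ∧ (t < 2 / 3 → m < 2 / 3) ∧ (s = 0 → t ≤ 1 → m = t) ∧
      (s = 1 → t < 2 / 3 → m ≤ 0) := by
  have h0 : 0 ≤ max 0 (min s 1) := le_max_left _ _
  have h1 : max 0 (min s 1) ≤ 1 := max_le zero_le_one (min_le_right _ _)
  refine ⟨fun h => max_le ?_ (by linarith), fun h => le_max_of_le_right (by linarith),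
    fun h => max_lt ?_ (by linarith), ?_, ?_⟩
  · nlinarith
  · rcases le_or_gt t 0 with ht | ht <;> nlinarith
  · rintro rfl h
    norm_num
    linarith
  · rintro rfl h
    norm_num
    linarith

theorem continuous_endHomotopy (i : Fin 2) :
    Continuous fun z : ℝ × ℝ => endHomotopy i z.1 z.2 := by
  fin_cases i
  · change Continuous fun z : ℝ × ℝ => max ((1 - max 0 (min z.1 1)) * z.2) (3 * z.2 - 2)
    fun_prop
  · change Continuous fun z : ℝ × ℝ =>
      1 - max ((1 - max 0 (min z.1 1)) * (1 - z.2)) (3 * (1 - z.2) - 2)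
    fun_prop

theorem endHomotopy_nonpos (i : Fin 2) (s : ℝ) {t : ℝ} (ht : t ≤ 0) : endHomotopy i s t ≤ 0 := by
  fin_cases i
  · exact (endHomotopy_aux s t).1 ht
  · exact sub_nonpos.2 ((endHomotopy_aux s (1 - t)).2.1 (by linarith))

theorem one_le_endHomotopy (i : Fin 2) (s : ℝ) {t : ℝ} (ht : 1 ≤ t) : 1 ≤ endHomotopy i s t := by
  fin_cases i
  · exact (endHomotopy_aux s t).2.1 ht
  · have := (endHomotopy_aux s (1 - t)).1 (by linarith)
    change 1 ≤ 1 - _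
    linarith

theorem endHomotopy_mem_endRay (i : Fin 2) (s : ℝ) {t : ℝ} (ht : t ∈ endRay i) :
    endHomotopy i s t ∈ endRay i := by
  fin_cases i
  · exact (endHomotopy_aux s t).2.2.1 ht
  · change 1 / 3 < t at ht
    have := (endHomotopy_aux s (1 - t)).2.2.1 (by linarith)
    refine mem_Ioi.2 (?_ : (1 / 3 : ℝ) < 1 - _)
    linarith

theorem endHomotopy_zero (i : Fin 2) {t : ℝ} (ht : t ∈ Ioo (0 : ℝ) 1) : endHomotopy i 0 t = t := by
  fin_cases i
  · exact (endHomotopy_aux 0 t).2.2.2.1 rfl ht.2.le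
  · have := (endHomotopy_aux 0 (1 - t)).2.2.2.1 rfl (by linarith [ht.1])
    change 1 - _ = t
    linarith

theorem cyl_endHomotopy_one {i : Fin 2} (a : A) {t : ℝ} (ht : t ∈ endRay i) :
    cyl φ (a, endHomotopy i 1 t) = base φ (φ i a) := by
  fin_cases i
  · exact cyl_of_nonpos ((endHomotopy_aux 1 t).2.2.2.2 rfl ht)
  · change 1 / 3 < t at ht
    have := (endHomotopy_aux 1 (1 - t)).2.2.2.2 rfl (by linarith)
    refine cyl_of_one_le ?_
    change 1 ≤ 1 - _
    linarith

variable (φ) in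
/-- The homotopy of the double mapping cylinder induced by a homotopy of the parameter. -/
noncomputable def slide (i : Fin 2) (z : ℝ × DoubleCylinder φ) : DoubleCylinder φ :=
  lift φ (base φ) (fun y => cyl φ (y.1, endHomotopy i z.1 y.2)) z.2

theorem slide_cyl (i : Fin 2) (s : ℝ) (z : A × ℝ) :
    slide φ i (s, cyl φ z) = cyl φ (z.1, endHomotopy i s z.2) :=
  lift_cyl (g := fun y => cyl φ (y.1, endHomotopy i s y.2))
    (fun _ _ h => cyl_of_nonpos (endHomotopy_nonpos i s h))
    (fun _ _ h => cyl_of_one_le (one_le_endHomotopy i s h)) z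

/-- Since `ℝ` is locally compact, its product with the quotient map is again a quotient map, so
continuity can be checked on the base and on the cylinder separately. -/
theorem continuous_slide (i : Fin 2) : Continuous (slide φ i) := by
  refine isQuotientMap_proj.continuous_lift_prod_right ?_
  refine (Homeomorph.prodSumDistrib (X := ℝ) (Y := B) (Z := A × ℝ)).symm.comp_continuous_iff'.1
    (continuous_sum_dom.2 ⟨continuous_base.comp continuous_snd, ?_⟩)
  refine (continuous_cyl (φ := φ).comp (f := fun z : ℝ × A × ℝ =>
    (z.2.1, endHomotopy i z.1 z.2.2)) ?_).congr fun z => (slide_cyl i z.1 z.2).symm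
  exact continuous_snd.fst.prodMk ((continuous_endHomotopy i).comp
    (continuous_fst.prodMk continuous_snd.snd))

/-- Sliding the cylinders to their `i`-th end deforms the star, within itself, onto the embedded
copy of `C`. -/
theorem fillsSpheres_star {k : ℕ} {i : Fin 2} {C : Set B} (hC : ∀ j ≠ i, ∀ a, φ j a ∉ C)
    (h : FillsSpheres k C) : FillsSpheres k (star φ i C) := by
  have hb : FillsSpheres k (base φ '' C) := by
    refine h.of_retract (q := lift φ id fun z => φ 0 z.1) (p := base φ) ?_ ?_
      continuous_base.continuousOn (mapsTo_image _ _) ?_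
    · refine ContinuousOn.mono (s := range (base φ)) ?_ (image_subset_range _ _)
      rw [continuousOn_iff_continuous_domRestrict]
      convert (isClosedEmbedding_base (φ := φ)).isEmbedding.toHomeomorph.symm.continuous using 1
      funext ⟨_, b, rfl⟩
      rw [eq_comm, Homeomorph.symm_apply_eq]
      rfl
    · rintro _ ⟨b, hb, rfl⟩
      exact hb
    · rintro _ ⟨b, hb, rfl⟩
      rfl
  refine hb.of_dominated (q := fun z => slide φ i (1, z)) (p := id) (h := slide φ i)
    ((continuous_slide i).comp (by fun_prop)).continuousOn ?_ continuousOn_id ?_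
    (continuous_slide i).continuousOn ?_ ?_ (fun _ _ => rfl)
  · rintro (b | z) hz
    · exact ⟨b, hz, rfl⟩
    · refine ⟨_, hz.1, (cyl_endHomotopy_one z.1 hz.2).symm⟩
  · rintro _ ⟨b, hb, rfl⟩
    exact hb
  · rintro ⟨s, b | z⟩ ⟨-, hz⟩
    · exact hz
    · exact (cyl_mem_star hC).2 ⟨hz.1, endHomotopy_mem_endRay i s hz.2⟩
  · rintro (b | ⟨a, t, ht⟩) hz
    · rfl
    · change cyl φ (a, endHomotopy i 0 t) = _
      rw [endHomotopy_zero i ht, cyl_of_mem ht]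
      rfl

theorem fillsSpheres_cyl [Nonempty A] {k : ℕ} {F : Set A} (h : FillsSpheres k F) :
    FillsSpheres k (cyl φ '' (F ×ˢ Ioo (1 / 3) (2 / 3))) := by
  have hI : Ioo (1 / 3 : ℝ) (2 / 3) ⊆ Ioo 0 1 := Ioo_subset_Ioo (by norm_num) (by norm_num)
  have hc : StarConvex ℝ (1 / 2) (Ioo (1 / 3 : ℝ) (2 / 3)) :=
    (convex_Ioo _ _).starConvex (by norm_num)
  have hA := h.prod (hc.fillsSpheres (by norm_num) k)
  -- The value on the base is arbitrary: the set in question lies in the open cylinder, where the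
  -- coordinates are continuous.
  refine hA.of_retract (q := lift φ (fun _ => (Classical.arbitrary A, 0)) id) (p := cyl φ) ?_ ?_
    continuous_cyl.continuousOn (mapsTo_image _ _) ?_
  · rintro _ ⟨⟨a, t⟩, ⟨-, ht⟩, rfl⟩
    rw [cyl_of_mem (hI ht)]
    refine (isOpenEmbedding_inner.continuousAt_iff.1 ?_).continuousWithinAt
    exact (continuous_fst.prodMk (continuous_subtype_val.comp continuous_snd)).continuousAt
  · rintro _ ⟨⟨a, t⟩, ⟨ha, ht⟩, rfl⟩
    rw [cyl_of_mem (hI ht)]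
    exact ⟨ha, ht⟩
  · rintro _ ⟨⟨a, t⟩, ⟨ha, ht⟩, rfl⟩
    rw [cyl_of_mem (hI ht), lift_inner]
    exact cyl_of_mem (hI ht)

section Tree

variable {V E : Type u} {πB : B → V} {πA : A → E} {kind : V → Fin 2} {vert : Fin 2 → E → V}
  {top : E → Fin 2} {depth : V → ℕ} {root : V}

/-- The end `vert (top e) e` is the child of the edge and the other end its parent. Depth decreases
towards the parent, so each vertex has a finite path to the root; a union of such paths is a finite
subtree. -/
theorem exists_finite_ancestors (hinj : Function.Injective fun e => vert (top e) e)
    (hroot : ∀ e, vert (top e) e ≠ root) (hsurj : ∀ v ≠ root, ∃ e, vert (top e) e = v)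
    (hdepth : ∀ e, ∀ i ≠ top e, depth (vert i e) < depth (vert (top e) e)) (t : Finset V) :
    ∃ S : Finset V, t ⊆ S ∧ root ∈ S ∧ ∀ e, vert (top e) e ∈ S → ∀ i, vert i e ∈ S := by
  classical
  have key : ∀ d v, depth v = d → ∃ S : Finset V, v ∈ S ∧ root ∈ S ∧
      ∀ e, vert (top e) e ∈ S → ∀ i, vert i e ∈ S := by
    intro d
    induction d using Nat.strong_induction_on with
    | _ d ih =>
      intro v hv
      by_cases hvr : v = root
      · subst hvr
        exact ⟨{v}, by simp, by simp, fun e he => absurd (Finset.mem_singleton.1 he) (hroot e)⟩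
      · obtain ⟨e, rfl⟩ := hsurj v hvr
        have hne : (top e).rev ≠ top e := by
          generalize top e = i
          revert i
          decide
        obtain ⟨S, hS, hSr, hSc⟩ := ih _ (hv ▸ hdepth e _ hne) _ rfl
        refine ⟨insert (vert (top e) e) S, by simp, by simp [hSr], fun e' he' i => ?_⟩
        rcases Finset.mem_insert.1 he' with h | h
        · obtain rfl : e' = e := hinj h
          by_cases hi : i = top e'
          · simp [hi]
          · have : i = (top e').rev := by
              revert hi
              generalize top e' = j
              revert i j
              decide
            simp [this, hS]
        · exact Finset.mem_insert_of_mem (hSc e' h i)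
  induction t using Finset.induction_on with
  | empty =>
    obtain ⟨S, hS⟩ := key _ root rfl
    exact ⟨S, by simp, hS.2⟩
  | insert v t _ ih =>
    obtain ⟨S, h1, h2, h3⟩ := ih
    obtain ⟨S', h1', h2', h3'⟩ := key _ v rfl
    refine ⟨S ∪ S', Finset.insert_subset (by simp [h1'])
      (h1.trans Finset.subset_union_left), by simp [h2], fun e he i => ?_⟩
    rcases Finset.mem_union.1 he with h | h
    · exact Finset.mem_union_left _ (h3 e h i)
    · exact Finset.mem_union_right _ (h3' e h i)

theorem kind_ne (hend : ∀ i a, πB (φ i a) = vert i (πA a)) (hkind : ∀ i e, kind (vert i e) = i)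
    (v : V) : ∀ j ≠ kind v, ∀ a, φ j a ∉ πB ⁻¹' {v} := by
  rintro j hj a rfl
  rw [hend, hkind] at hj
  exact hj rfl

/-- A deepest vertex of a finite subtree is a leaf. Removing it splits off a star that meets the
rest in the middle of a single edge space, so `FillsSpheres.union` applies by induction on the
number of vertices. -/
theorem fillsSpheres_iUnion_star [Nonempty A] {N : ℕ}
    (hend : ∀ i a, πB (φ i a) = vert i (πA a)) (hkind : ∀ i e, kind (vert i e) = i)
    (hop : ∀ v, IsOpen (πB ⁻¹' {v})) (hinj : Function.Injective fun e => vert (top e) e)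
    (hroot : ∀ e, vert (top e) e ≠ root) (hsurj : ∀ v ≠ root, ∃ e, vert (top e) e = v)
    (hdepth : ∀ e, ∀ i ≠ top e, depth (vert i e) < depth (vert (top e) e))
    (hB : ∀ v, ∀ k ≤ N, FillsSpheres k (πB ⁻¹' {v}))
    (hA : ∀ e, ∀ k < N, FillsSpheres k (πA ⁻¹' {e})) (m : ℕ) :
    ∀ S : Finset V, S.card = m → root ∈ S → (∀ e, vert (top e) e ∈ S → ∀ i, vert i e ∈ S) →
      ∀ k ≤ N, FillsSpheres k (⋃ v ∈ S, star φ (kind v) (πB ⁻¹' {v})) := by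
  classical
  have hkn := kind_ne (φ := φ) hend hkind
  induction m with
  | zero =>
    intro S hS hr
    simp [Finset.card_eq_zero.1 hS] at hr
  | succ m ih =>
    intro S hS hr hc k hk
    by_cases hne : (S.erase root).Nonempty
    · obtain ⟨w, hw, hmax⟩ := Finset.exists_max_image _ depth hne
      obtain ⟨hwr, hwS⟩ := Finset.mem_erase.1 hw
      obtain ⟨e₀, rfl⟩ := hsurj w hwr
      set w := vert (top e₀) e₀ with hwe
      have hlt : ∀ e, vert (top e) e ∈ S → ∀ i ≠ top e, vert i e ≠ w := by
        intro e he i hi h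
        have := hmax _ (Finset.mem_erase.2 ⟨hroot e, he⟩)
        exact (h ▸ hdepth e i hi).not_ge this
      have hSw : S = insert w (S.erase w) := (Finset.insert_erase hwS).symm
      have hW : (⋃ v ∈ S, star φ (kind v) (πB ⁻¹' {v})) =
          (⋃ v ∈ S.erase w, star φ (kind v) (πB ⁻¹' {v})) ∪ star φ (kind w) (πB ⁻¹' {w}) := by
        conv_lhs => rw [hSw]
        rw [Finset.set_biUnion_insert, union_comm]
      have hint : (⋃ v ∈ S.erase w, star φ (kind v) (πB ⁻¹' {v})) ∩
          star φ (kind w) (πB ⁻¹' {w}) = cyl φ '' ((πA ⁻¹' {e₀}) ×ˢ Ioo (1 / 3) (2 / 3)) := by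
        have hray : ∀ i j : Fin 2, i ≠ j → endRay i ∩ endRay j = Ioo (1 / 3) (2 / 3) := by
          intro i j hij
          fin_cases i <;> fin_cases j
          · exact absurd rfl hij
          · exact (inter_comm _ _).trans Ioi_inter_Iio
          · exact Ioi_inter_Iio
          · exact absurd rfl hij
        ext z
        constructor
        · rintro ⟨hz, hzw⟩
          obtain ⟨v, hv, hzv⟩ := mem_iUnion₂.1 hz
          obtain ⟨hvw, hvS⟩ := Finset.mem_erase.1 hv
          rcases z with b | ⟨a, t, ht⟩
          · exact absurd ((show πB b = v from hzv).symm.trans hzw) hvw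
          · obtain ⟨h1, h2⟩ : πB (φ (kind v) a) = v ∧ t ∈ endRay (kind v) := hzv
            obtain ⟨h3, h4⟩ : πB (φ (kind w) a) = w ∧ t ∈ endRay (kind w) := hzw
            rw [hend] at h1 h3
            have hk : kind v ≠ kind w := fun h => hvw (by rw [← h1, ← h3, h])
            refine ⟨(a, t), ⟨?_, hray _ _ hk ▸ ⟨h2, h4⟩⟩, cyl_of_mem ht⟩
            -- An edge with child `w` is `e₀`, since children determine edges. Otherwise `w` would
            -- be the parent of `v ∈ S`, against the maximality of its depth.
            by_cases htop : kind w = top (πA a)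
            · exact hinj (show vert (top (πA a)) (πA a) = w by rw [← htop]; exact h3)
            · refine absurd h3 (hlt _ ?_ _ htop)
              have : top (πA a) = kind v := by
                revert hk htop
                generalize kind w = i, kind v = j, top (πA a) = l
                revert i j l
                decide
              rwa [this, h1]
        · rintro ⟨⟨a, t⟩, ⟨ha, ht⟩, rfl⟩
          have hkw : kind w = top e₀ := hkind _ _
          have hne : (top e₀).rev ≠ top e₀ := by
            generalize top e₀ = i
            revert i
            decide
          have ha : πA a = e₀ := ha
          rw [← hray _ _ hne] at ht
          refine ⟨mem_iUnion₂.2 ⟨vert (top e₀).rev e₀, Finset.mem_erase.2 ⟨fun h => hne ?_,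
            hc e₀ hwS _⟩, (cyl_mem_star (hkn _)).2 ?_⟩, (cyl_mem_star (hkn _)).2 ?_⟩
          · rw [← hkind (top e₀).rev e₀, h, hkw]
          · rw [hkind]
            exact ⟨by rw [mem_preimage, hend, ha]; rfl, ht.1⟩
          · rw [hkw]
            exact ⟨by rw [mem_preimage, hend, ha]; rfl, ht.2⟩
      rw [hW]
      refine FillsSpheres.union ?_ (isOpen_star (hkn _) (hop _)) ?_ ?_ ?_
      · exact isOpen_biUnion fun v _ => isOpen_star (hkn _) (hop _)
      · refine fun j hj => ih _ (by rw [Finset.card_erase_of_mem hwS, hS]; rfl)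
          (Finset.mem_erase.2 ⟨hwr.symm, hr⟩) (fun e he i => ?_) j (hj.trans hk)
        obtain ⟨h1, h2⟩ := Finset.mem_erase.1 he
        refine Finset.mem_erase.2 ⟨?_, hc e h2 i⟩
        by_cases hi : i = top e
        · rwa [hi]
        · exact hlt e h2 i hi
      · exact fun j hj => fillsSpheres_star (hkn _) (hB _ j (hj.trans hk))
      · intro j hj
        rw [hint]
        exact fillsSpheres_cyl (hA e₀ j (hj.trans_le hk))
    · have : S = {root} := by
        refine Finset.eq_singleton_iff_unique_mem.2 ⟨hr, fun v hv => ?_⟩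
        by_contra h
        exact hne ⟨v, Finset.mem_erase.2 ⟨h, hv⟩⟩
      rw [this, Finset.set_biUnion_singleton]
      exact fillsSpheres_star (hkn _) (hB _ k hk)

/-- A tree of highly connected spaces is highly connected. -/
theorem fillsSpheres_univ [Nonempty A] {N : ℕ}
    (hend : ∀ i a, πB (φ i a) = vert i (πA a)) (hkind : ∀ i e, kind (vert i e) = i)
    (hop : ∀ v, IsOpen (πB ⁻¹' {v})) (hinj : Function.Injective fun e => vert (top e) e)
    (hroot : ∀ e, vert (top e) e ≠ root) (hsurj : ∀ v ≠ root, ∃ e, vert (top e) e = v)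
    (hdepth : ∀ e, ∀ i ≠ top e, depth (vert i e) < depth (vert (top e) e))
    (hB : ∀ v, ∀ k ≤ N, FillsSpheres k (πB ⁻¹' {v}))
    (hA : ∀ e, ∀ k < N, FillsSpheres k (πA ⁻¹' {e})) {k : ℕ} (hk : k ≤ N) :
    FillsSpheres k (univ : Set (DoubleCylinder φ)) := by
  have hkn := kind_ne (φ := φ) hend hkind
  intro f hf _
  have hcov : f '' sphere 0 1 ⊆ ⋃ v, star φ (kind v) (πB ⁻¹' {v}) := by
    rintro z -
    rcases z with b | ⟨a, t, ht⟩
    · exact mem_iUnion.2 ⟨πB b, rfl⟩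
    · rcases lt_or_ge t (2 / 3) with h | h
      · refine mem_iUnion.2 ⟨vert 0 (πA a), ?_⟩
        rw [hkind]
        exact ⟨hend 0 a, h⟩
      · refine mem_iUnion.2 ⟨vert 1 (πA a), ?_⟩
        rw [hkind]
        exact ⟨hend 1 a, mem_Ioi.2 (by simp only; linarith)⟩
  -- By compactness finitely many stars suffice, and they are completed to a finite subtree
  -- containing the root.
  obtain ⟨t, ht⟩ := ((isCompact_sphere 0 1).image_of_continuousOn hf).elim_finite_subcover _
    (fun v => isOpen_star (hkn v) (hop v)) hcov
  obtain ⟨S, htS, hr, hS⟩ := exists_finite_ancestors hinj hroot hsurj hdepth t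
  obtain ⟨F, hF, -, hFf⟩ := fillsSpheres_iUnion_star hend hkind hop hinj hroot hsurj hdepth hB hA _
    S rfl hr hS k hk f hf (mapsTo_iff_image_subset.2 (ht.trans (biUnion_subset_biUnion_left htS)))
  exact ⟨F, hF, mapsTo_univ _ _, hFf⟩

end Tree

end DoubleCylinder

end TreeOfSpaces

/-! ### The Bass–Serre tree from normal forms -/

section BassSerre

open Monoid Monoid.PushoutI Monoid.CoprodI

section Words

variable {ι : Type*} [DecidableEq ι] {G : ι → Type*} [∀ i, Group (G i)] [∀ i, DecidableEq (G i)]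
  {H : Type*} [Group H] {φ : ∀ i, H →* G i}

theorem Monoid.CoprodI.Word.length_equivPair_tail_lt {w : Word G} {i : ι} (h : w.fstIdx = some i) :
    (Word.equivPair i w).tail.toList.length < w.toList.length := by
  have hw : Word.rcons (Word.equivPair i w) = w := (Word.equivPair i).symm_apply_apply w
  have h1 : (Word.equivPair i w).head ≠ 1 := fun h1 => by
    rw [Word.rcons, dif_pos h1] at hw
    exact (Word.equivPair i w).fstIdx_ne (by rw [hw, h])
  rw [Word.rcons, dif_neg h1] at hw
  conv_rhs => rw [← hw]
  simp [Word.cons]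

variable (d : NormalWord.Transversal φ)

/-- The word of the normal form of the inverse of `g`; it classifies the cosets of the base group. -/
noncomputable def edgeWord (g : PushoutI φ) : Word G := (g⁻¹ • (NormalWord.empty : NormalWord d)).toWord

/-- The part of the normal form of the inverse of `g` which classifies the cosets of the `i`-th
factor. -/
noncomputable def vertexWord (i : ι) (g : PushoutI φ) : Word G := (Word.equivPair i (edgeWord d g)).tail

theorem vertexWord_eq (i : ι) (g : PushoutI φ) :
    vertexWord d i g = (NormalWord.equivPair i (g⁻¹ • (NormalWord.empty : NormalWord d))).tail := by
  change _ = (Word.equivPair i (CoprodI.of _ • edgeWord d g)).tail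
  rw [Word.equivPair_smul_same]
  rfl

/-- Inversion turns right multiplication by the factor into left multiplication, which changes only
the head of the `i`-th decomposition of the normal form. -/
theorem vertexWord_mul_of (i : ι) (g : PushoutI φ) (x : G i) :
    vertexWord d i (g * of i x) = vertexWord d i g := by
  rw [vertexWord_eq, vertexWord_eq, mul_inv_rev, mul_smul, ← map_inv, NormalWord.summand_smul_def,
    Equiv.apply_symm_apply]

theorem eq_mul_of_of_vertexWord_eq {i : ι} {g g' : PushoutI φ}
    (h : vertexWord d i g = vertexWord d i g') : ∃ x, g' = g * of i x := by
  rw [vertexWord_eq, vertexWord_eq] at h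
  set p := NormalWord.equivPair i (g⁻¹ • (NormalWord.empty : NormalWord d)) with hp
  set p' := NormalWord.equivPair i (g'⁻¹ • (NormalWord.empty : NormalWord d)) with hp'
  refine ⟨p.head * p'.head⁻¹, ?_⟩
  have : g'⁻¹ • (NormalWord.empty : NormalWord d) =
      (of i (p'.head * p.head⁻¹) * g⁻¹) • (NormalWord.empty : NormalWord d) := by
    rw [mul_smul, NormalWord.summand_smul_def, ← hp, Equiv.eq_symm_apply, ← hp']
    obtain ⟨⟨a, w, hw⟩, hn⟩ := p
    obtain ⟨⟨a', w', hw'⟩, hn'⟩ := p'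
    obtain rfl : w = w' := h
    simp
  have := (NormalWord.equiv (d := d)).injective this
  rw [← inv_inv g', this]
  simp

theorem eq_mul_base_of_edgeWord_eq {g g' : PushoutI φ} (h : edgeWord d g = edgeWord d g') :
    ∃ x, g' = g * base φ x := by
  unfold edgeWord at h
  set p := g⁻¹ • (NormalWord.empty : NormalWord d) with hp
  set p' := g'⁻¹ • (NormalWord.empty : NormalWord d) with hp'
  refine ⟨p.head * p'.head⁻¹, ?_⟩
  have : g'⁻¹ • (NormalWord.empty : NormalWord d) =
      (base φ (p'.head * p.head⁻¹) * g⁻¹) • (NormalWord.empty : NormalWord d) := by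
    rw [mul_smul, NormalWord.base_smul_def, ← hp, ← hp']
    refine NormalWord.ext (by simp) ?_
    exact congrArg Word.toList h.symm
  have := (NormalWord.equiv (d := d)).injective this
  rw [← inv_inv g', this]
  simp

/-- The tail of a normal form is itself normalized, so it occurs as the word of an edge; this is the
edge joining a vertex to its parent. -/
theorem exists_edgeWord_eq (i : ι) (g : PushoutI φ) :
    ∃ g', edgeWord d g' = vertexWord d i g := by
  refine ⟨(⟨vertexWord d i g, 1, fun j x hx => ?_⟩ : NormalWord d).prod⁻¹, ?_⟩
  · rw [vertexWord_eq] at hx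
    exact (NormalWord.equivPair i _).normalized j x hx
  · rw [edgeWord, inv_inv, NormalWord.prod_smul_empty]

theorem vertexWord_one (i : ι) : vertexWord d i 1 = .empty := by
  rw [vertexWord, edgeWord, inv_one, one_smul]
  exact congrArg Word.Pair.tail (Word.equivPair_eq_of_fstIdx_ne (w := .empty)
    (by simp [Word.fstIdx, Word.empty]))

theorem edgeWord_mul_base (g : PushoutI φ) (x : H) : edgeWord d (g * base φ x) = edgeWord d g := by
  rw [edgeWord, mul_inv_rev, mul_smul, ← map_inv, NormalWord.base_smul_def]
  rfl

end Words

variable {G : Fin 2 → Type u} [∀ i, Group (G i)] {H : Type u} [Group H] {φ : ∀ i, H →* G i}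

variable (φ) in
/-- The end of an edge in the Bass-Serre tree of an amalgamated product of two groups. -/
noncomputable def edgeEnd (i : Fin 2) (e : PushoutI φ ⧸ (base φ).range) :
    Σ i : Fin 2, PushoutI φ ⧸ (of (φ := φ) i).range :=
  ⟨i, cosetSection _ e • ((1 : PushoutI φ) : PushoutI φ ⧸ (of (φ := φ) i).range)⟩

/-- The Bass-Serre graph of an amalgamated product of two groups is a rooted tree. -/
theorem exists_rooted_tree (hφ : ∀ i, Function.Injective (φ i)) :
    ∃ (top : PushoutI φ ⧸ (base φ).range → Fin 2)
      (depth : (Σ i : Fin 2, PushoutI φ ⧸ (of (φ := φ) i).range) → ℕ)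
      (root : Σ i : Fin 2, PushoutI φ ⧸ (of (φ := φ) i).range),
      (Function.Injective fun e => edgeEnd φ (top e) e) ∧ (∀ e, edgeEnd φ (top e) e ≠ root) ∧
      (∀ v ≠ root, ∃ e, edgeEnd φ (top e) e = v) ∧
      ∀ e, ∀ i ≠ top e, depth (edgeEnd φ i e) < depth (edgeEnd φ (top e) e) := by
  classical
  obtain ⟨d⟩ := NormalWord.transversal_nonempty φ hφ
  let s (e : PushoutI φ ⧸ (base φ).range) : PushoutI φ := cosetSection _ e
  have hs : ∀ e, (s e : PushoutI φ ⧸ (base φ).range) = e := mk_cosetSection _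
  let vw (v : Σ i : Fin 2, PushoutI φ ⧸ (of (φ := φ) i).range) : Word G :=
    vertexWord d v.1 v.2.out
  have hvw : ∀ i (g : PushoutI φ), vw ⟨i, (g : PushoutI φ ⧸ (of (φ := φ) i).range)⟩ =
      vertexWord d i g := by
    intro i g
    obtain ⟨⟨_, x, rfl⟩, hx⟩ := QuotientGroup.mk_out_eq_mul (of (φ := φ) i).range g
    change vertexWord d i _ = _
    rw [hx]
    exact vertexWord_mul_of d i g x
  have hend : ∀ i e, edgeEnd φ i e = ⟨i, (s e : PushoutI φ ⧸ (of (φ := φ) i).range)⟩ := by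
    intro i e
    rw [edgeEnd, MulAction.Quotient.smul_coe, smul_eq_mul, mul_one]
  have hvinj : ∀ i (g g' : PushoutI φ), vertexWord d i g = vertexWord d i g' →
      (g : PushoutI φ ⧸ (of (φ := φ) i).range) = g' := by
    intro i g g' h
    obtain ⟨x, rfl⟩ := eq_mul_of_of_vertexWord_eq d h
    exact QuotientGroup.eq.2 (by simp)
  -- The child of an edge is the end whose factor does not contain the first letter, so that its
  -- vertex word is the whole edge word. The empty word is assigned child kind `1`, which makes the
  -- trivial coset of factor `0` the root.
  let tw (w : Word G) : Fin 2 := if w.fstIdx = some 1 then 0 else 1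
  have htw : ∀ w, w.fstIdx ≠ some (tw w) := by
    intro w
    by_cases h : w.fstIdx = some 1 <;> simp [tw, h]
  let top e := tw (edgeWord d (s e))
  have hchild : ∀ e, vw (edgeEnd φ (top e) e) = edgeWord d (s e) := by
    intro e
    rw [hend, hvw, vertexWord, Word.equivPair_eq_of_fstIdx_ne (htw _)]
  -- The trivial cosets of both factors have the empty word; the extra `1` away from the root puts
  -- the one of kind `1` strictly below it.
  let depth v := (vw v).toList.length + if v.1 = 0 ∧ vw v = .empty then 0 else 1
  have hroot : vw ⟨0, ((1 : PushoutI φ) : PushoutI φ ⧸ (of (φ := φ) 0).range)⟩ = .empty := by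
    rw [hvw, vertexWord_one]
  have hne : ∀ e, ¬ ((edgeEnd φ (top e) e).1 = 0 ∧ vw (edgeEnd φ (top e) e) = .empty) := by
    rintro e ⟨h0, h⟩
    rw [hchild] at h
    have : tw (edgeWord d (s e)) = 0 := h0
    rw [h] at this
    simp [tw, Word.fstIdx, Word.empty] at this
  refine ⟨top, depth, ⟨0, ((1 : PushoutI φ) : PushoutI φ ⧸ (of (φ := φ) 0).range)⟩, ?_, ?_, ?_, ?_⟩
  · intro e e' h
    have := congrArg vw h
    simp only [hchild] at this
    obtain ⟨x, hx⟩ := eq_mul_base_of_edgeWord_eq d this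
    rw [← hs e, ← hs e', hx]
    exact QuotientGroup.eq.2 (by simp)
  · exact fun e h => hne e (by rw [h]; exact ⟨rfl, hroot⟩)
  · rintro ⟨i, c⟩ hv
    obtain ⟨g, rfl⟩ := QuotientGroup.mk_surjective c
    obtain ⟨g', hg'⟩ := exists_edgeWord_eq d i g
    have hw : edgeWord d (s g') = vertexWord d i g := by
      obtain ⟨x, hx⟩ := QuotientGroup.eq.1 (hs g').symm
      rw [← hg', ← edgeWord_mul_base d g' x, hx, mul_inv_cancel_left]
    have hi : (vertexWord d i g).fstIdx ≠ some i := (Word.equivPair i (edgeWord d g)).fstIdx_ne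
    have ht : top g' = i := by
      change tw (edgeWord d (s g')) = i
      rw [hw]
      by_cases h : (vertexWord d i g).fstIdx = some 1
      · have : i ≠ 1 := by
          rintro rfl
          exact hi h
        simp only [tw, h, if_true]
        omega
      · simp only [tw, h, if_false]
        by_contra h1
        obtain rfl : i = 0 := by omega
        refine hv (congrArg (Sigma.mk 0) (hvinj 0 _ _ ?_))
        rw [vertexWord_one]
        generalize vertexWord d 0 g = w at h hi
        ext1
        obtain ⟨_ | ⟨⟨j, x⟩, l⟩, _, _⟩ := w
        · rfl
        · simp only [Word.fstIdx, List.head?_cons, Option.map_some, ne_eq, Option.some.injEq] at h hi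
          omega
    refine ⟨g', ?_⟩
    rw [ht, hend]
    refine congrArg (Sigma.mk i) (hvinj i _ _ ?_)
    rw [vertexWord, hw, Word.equivPair_eq_of_fstIdx_ne hi]
  · intro e i hi
    change _ < (vw _).toList.length + ite _ _ _
    rw [if_neg (hne e), hchild]
    change (vw _).toList.length + ite _ _ _ < _
    rw [hend, hvw]
    change (Word.equivPair i (edgeWord d (s e))).tail.toList.length + _ < _
    -- Either the parent's word loses the first letter, or the edge word is empty and the parent is
    -- the root, where only the correction term decreases.
    by_cases h : (edgeWord d (s e)).fstIdx = some i
    · have := Word.length_equivPair_tail_lt h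
      split_ifs <;> omega
    · have hi' : i ≠ tw (edgeWord d (s e)) := hi
      rw [vertexWord, Word.equivPair_eq_of_fstIdx_ne h]
      have h1 : (edgeWord d (s e)).fstIdx ≠ some 1 := by
        intro h1
        simp only [tw, h1, if_true] at hi'
        exact h (by rw [h1, show i = 1 by omega])
      simp only [tw, h1, if_false] at hi'
      obtain rfl : i = 0 := by omega
      have : edgeWord d (s e) = .empty := by
        generalize edgeWord d (s e) = w at h h1
        ext1
        obtain ⟨_ | ⟨⟨j, x⟩, l⟩, _, _⟩ := w
        · rfl
        · simp only [Word.fstIdx, List.head?_cons, Option.map_some, ne_eq, Option.some.injEq] at h h1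
          omega
      simp [this]

end BassSerre

/-! ### Assembling the complex for the double -/

section Double

open Set Metric RelCWComplex Monoid Monoid.PushoutI

section

variable {Γ K : Type u} [Group Γ] [Group K]

/-- The cocycle on the disjoint union of the cosets of the images of injective homomorphisms. -/
noncomputable def sigmaCosetCocycle {j : Fin 2 → K →* Γ} (hj : ∀ i, Function.Injective (j i)) :
    ActionCocycle Γ (Σ i : Fin 2, Γ ⧸ (j i).range) K where
  toFun g v := (cosetCocycle (hj v.1)).toFun g v.2
  map_one v := (cosetCocycle (hj v.1)).map_one v.2
  map_mul g h v := (cosetCocycle (hj v.1)).map_mul g h v.2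

end

theorem Twisted.fillsSpheres_fiber {Γ ι K : Type u} [Group Γ] [Group K] [MulAction Γ ι]
    {α : ActionCocycle Γ ι K} {X : Type u} [TopologicalSpace X] {k : ℕ}
    (h : FillsSpheres k (univ : Set X)) (v : ι) :
    FillsSpheres k {z : Twisted α X | z.1 = v} :=
  h.of_retract (q := Sigma.snd) (p := Twisted.mk α v)
    (Twisted.continuous_iff.2 fun _ => continuous_id).continuousOn (mapsTo_univ _ _)
    (Twisted.continuous_mk v).continuousOn (fun _ _ => rfl) (by
      rintro ⟨w, x⟩ rfl
      rfl)

end Double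

open Set Metric RelCWComplex Monoid Monoid.PushoutI

theorem mainTheorem6 {G : Type u} [Group G] (H : Subgroup G) (n : ℕ)
    (hG : IsOfTypeF (n + 1) G) (hH : IsOfTypeF n H) :
    IsOfTypeF (n + 1) (GroupDouble H) := by
  obtain ⟨X, _, _, _, _, _, hXc, hX⟩ := hG
  obtain ⟨Y, _, _, _, _, _, hYc, hY, hYn⟩ := hH.exists_finite_dimensional
  obtain ⟨_, hXf⟩ := connectedBelow_iff.1 hXc
  obtain ⟨_, hYf⟩ := connectedBelow_iff.1 hYc
  have : ContinuousConstSMul H X := ⟨fun h => continuous_const_smul (h : G)⟩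
  obtain ⟨f, hf, hfH, hfs⟩ := exists_equivariant_cellular hY
    (fun (h : H) m x hx => smul_mem_skeletonBelow hX (h : G) hx) (n + 1)
    (fun k hk => hXf k (by omega))
  rw [hYn] at hf hfH
  -- Beyond dimension `n` nothing new happens, since `Y` has no cells there and `f` already lands in
  -- `skeletonBelow X (n + 1)`.
  have hfs' : ∀ m, MapsTo f (skeletonBelow Y m) (skeletonBelow X m) := by
    intro m y hy
    rcases le_total m (n + 1) with h | h
    · exact hfs m h hy
    · exact skeletonBelow_mono h (hfs (n + 1) le_rfl (hYn ▸ mem_univ y))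
  have hφ : ∀ i : Fin 2, Function.Injective ((fun _ : Fin 2 => H.subtype) i) :=
    fun _ => H.subtype_injective
  let Γ := GroupDouble H
  let j : Fin 2 → G →* Γ := fun i => of (φ := fun _ : Fin 2 => H.subtype) i
  let b : H →* Γ := base (fun _ : Fin 2 => H.subtype)
  have hj : ∀ i, Function.Injective (j i) := of_injective hφ
  have hb : Function.Injective b := base_injective hφ
  have hjb : ∀ i (h : H), j i h = b h := fun i h => of_apply_eq_base (fun _ : Fin 2 => H.subtype) i h
  let α := cosetCocycle hb
  let β := sigmaCosetCocycle hj
  let v₀ : Fin 2 → Σ i : Fin 2, Γ ⧸ (j i).range := fun i => ⟨i, (1 : Γ)⟩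
  have hv₀ : ∀ i (a : G), j i a • v₀ i = v₀ i := fun i a =>
    congrArg (Sigma.mk i) (map_smul_one_coset a)
  have hβ : ∀ i (a : G), β.toFun (j i a) (v₀ i) = a := fun i a => cosetCocycle_map_one (hj i) a
  -- On the trivial coset this is `f` into the base copy of `X` of kind `i`; over other cosets it is
  -- transported by the section. The cocycle equation, with the equivariance of `f` and the fact
  -- that both factors restrict to the same map on `H`, makes it `Γ`-equivariant.
  let φ : Fin 2 → C(Twisted α Y, Twisted β X) := fun i =>
    ⟨fun z => cosetSection b.range z.1 • Twisted.mk β (v₀ i) (f z.2),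
      Twisted.continuous_iff.2 fun e => ((Twisted.continuous_mk (α := β) (v₀ i)).comp
        (continuousOn_univ.1 hf)).const_smul (cosetSection b.range e)⟩
  have hφe : ∀ i (g : Γ) z, φ i (g • z) = g • φ i z := by
    rintro i g ⟨e, y⟩
    change cosetSection b.range (g • e) • Twisted.mk β (v₀ i) (f (α.toFun g e • y)) =
      g • cosetSection b.range e • Twisted.mk β (v₀ i) (f y)
    have h1 : j i (α.toFun g e) • Twisted.mk β (v₀ i) (f y) =
        Twisted.mk β (v₀ i) (f (α.toFun g e • y)) := by
      rw [Twisted.smul_mk, hv₀, hβ, hfH _ y (mem_univ y)]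
      rfl
    rw [← h1, hjb, ← mul_smul, ← mul_smul]
    exact congrArg (· • _) (cosetSection_mul_cosetCocycle hb g e)
  have hA : IsFreeCocompactCellularAction Γ (Twisted α Y) :=
    Twisted.isFreeCocompactCellularAction hY (fun g v => cosetCocycle_free hb g v)
      (finite_singleton ((1 : Γ) : Γ ⧸ b.range))
      (fun c => ⟨_, rfl, _, smul_one_coset c⟩) (by
        rintro _ rfl a
        exact ⟨b a, map_smul_one_coset a, cosetCocycle_map_one hb a⟩)
  have hB : IsFreeCocompactCellularAction Γ (Twisted β X) :=
    Twisted.isFreeCocompactCellularAction hX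
      (fun g v hv => cosetCocycle_free (hj v.1) g v.2 (eq_of_heq (Sigma.mk.inj hv).2))
      (finite_range v₀)
      (fun v => ⟨_, mem_range_self v.1, _, congrArg (Sigma.mk v.1) (smul_one_coset v.2)⟩) (by
        rintro _ ⟨i, rfl⟩ a
        exact ⟨j i a, hv₀ i a, hβ i a⟩)
  have hφs : ∀ i m, MapsTo (φ i) (skeletonBelow (Twisted α Y) m)
      (skeletonBelow (Twisted β X) m) := by
    rintro i m ⟨e, y⟩ hy
    exact smul_mem_skeletonBelow hB _
      (Twisted.mk_mem_skeletonBelow.2 (hfs' m (Twisted.mk_mem_skeletonBelow.1 hy)))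
  have := DoubleCylinder.continuousConstSMul hφe
  have : Nonempty (Twisted α Y) := ⟨Twisted.mk α ((1 : Γ) : Γ ⧸ b.range) (Classical.arbitrary Y)⟩
  obtain ⟨top, depth, root, hinj, hroot, hsurj, hdepth⟩ := exists_rooted_tree hφ
  refine ⟨DoubleCylinder φ, inferInstance, inferInstance,
    (DoubleCylinder.cellData hφs).toCWComplex, inferInstance, inferInstance,
    connectedBelow_iff.2 ⟨this.map fun a => DoubleCylinder.base φ (φ 0 a), fun k hk => ?_⟩,
    DoubleCylinder.isFreeCocompactCellularAction hA hB hφs⟩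
  -- The incidence condition holds by definition, because `edgeEnd` uses the same coset section as
  -- the attaching maps. Vertex spaces fill cubes up to dimension `n + 1`, edge spaces up to `n`.
  refine DoubleCylinder.fillsSpheres_univ (πA := fun z : Twisted α Y => z.1)
    (πB := fun z : Twisted β X => z.1) (kind := Sigma.fst) (fun i a => rfl) (fun i e => rfl) (fun v => ?_) hinj hroot hsurj hdepth
    (fun v m hm => Twisted.fillsSpheres_fiber (hXf m hm) v)
    (fun e m hm => Twisted.fillsSpheres_fiber (hYf m (Nat.lt_succ_iff.1 hm)) e) hk
  refine @isOpen_sigma_iff _ (fun _ => X) _ _ |>.2 fun w => ?_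
  by_cases h : w = v
  · convert isOpen_univ
    exact eq_univ_of_forall fun _ => h
  · convert isOpen_empty
    exact eq_empty_of_forall_notMem fun _ => h
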